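/- Let $(X,\rho,\mu)$ be a space of homogeneous type: $\rho$ is a quasimetric with $\rho(x,z)\le K(\rho(x,y)+\rho(y,z))$, and $\mu$ is a Borel measure for which all balls $B(x,r)=\{y:\rho(x,y)<r\}$ are measurable, $0<\mu(B(x,r))<\infty$ and $\mu(B(x,2r))\le A\,\mu(B(x,r))$ for all $x\in X$, $r>0$. Let $\kappa>1$, $\Phi>0$ and $\beta\ge 1$, and let $\omega:[0,\infty)\to[0,\infty)$ be a modulus of continuity, that is, $\omega(0)=0$ and $\omega(u)\le\omega(t)+\omega(s)$ whenever $u\le t+s$. Put $$\|\omega\|_{\mathrm{Dini}}=\int_0^1\omega(t)\,\frac{dt}{t},\qquad \|\omega\|_{\mathrm{log\text{-}Dini}}=\int_0^1\omega(t)\,|\log t|\,\frac{dt}{t}.$$ For $x\in X$ and $k\in\mathbb Z$ let $C_\omega(x,k)$ be the set of all integrable $\phi:X\to\mathbb R$ that vanish outside $B(x,\kappa^k)$ and satisfy $\int\phi\,d\mu=0$, $\sup|\phi|\le\Phi\,\mu(B(x,\kappa^k))^{-1}$ and $|\phi(y)-\phi(y')|\le\mu(B(x,\kappa^k))^{-1}\,\omega(\rho(y,y')/\kappa^k)$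 for all $y,y'\in X$. For a locally integrable (that is, integrable on every ball) real- or complex-valued function $f$ let $$A_\omega f(x,k)=\sup_{\phi\in C_\omega(x,k)}\Big|\int f\phi\,d\mu\Big|,\qquad G_{\omega,\beta}f(x)=\Big(\sum_{k\in\mathbb Z}\frac{1}{\mu(B(x,\beta\kappa^k))}\int_{B(x,\beta\kappa^k)}A_\omega f(y,k)^2\,d\mu(y)\Big)^{1/2}.$$ Let $M$ be the uncentered Hardy–Littlewood maximal function, $Mv(x)=\sup_{B\ni x}\mu(B)^{-1}\int_B|v|\,d\mu$, the supremum being over all balls containing $x$, and let $$\gamma=\sup_{x\in X,\ t>0}\frac{\mu(B(x,\beta t))}{\mu(B(x,t))}.$$ Write $v(E)=\int_E v\,d\mu$. Then there is a finite constant $C$ depending only on $K$, $A$ and $\kappa$ (and not on $v,\omega,\beta,\Phi,f$) such that for every non-negative locally integrable $v$ and every locally integrable $f$ $$\int_X (G_{\omega,\beta}f)^2\,v\,d\mu\le C\,\Phi\,\|\omega\|_{\mathrm{Dini}}\int_X|f|^2\,Mv\,d\mu$$ and $$\sup_{\lambda>0}\lambda\,v(\{G_{\omega,\beta}f>\lambda\})\le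 C\,\gamma^{1/2}\,\|\omega\|_{\mathrm{log\text{-}Dini}}\int_X|f|\,Mv\,d\mu .$$ If moreover there are $c>1$ and $\varepsilon>0$ such that the reverse doubling property $\mu(B(x,cR))\ge(1+\varepsilon)\,\mu(B(x,R))$ holds for all $x\in X$ and $R>0$, then $$\sup_{\lambda>0}\lambda\,v(\{G_{\omega,\beta}f>\lambda\})\le C'\,\gamma^{1/2}\,\|\omega\|_{\mathrm{Dini}}\int_X|f|\,Mv\,d\mu$$ with a finite constant $C'$ depending only on $K,A,\kappa,c,\varepsilon$. (All quantities take values in $[0,\infty]$, with $0\cdot\infty=0$.) -/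

import Mathlib

open MeasureTheory Set
open scoped NNReal ENNReal

namespace IntrinsicSquare

/-- A quasimetric `ρ` on `X` with quasi-triangle constant `K`. -/
structure IsQuasiMetric {X : Type*} (ρ : X → X → ℝ) (K : ℝ) : Prop where
  nonneg : ∀ x y, 0 ≤ ρ x y
  eq_zero_iff : ∀ x y, ρ x y = 0 ↔ x = y
  symm : ∀ x y, ρ x y = ρ y x
  one_le : 1 ≤ K
  quasi_triangle : ∀ x y z, ρ x z ≤ K * (ρ x y + ρ y z)

/-- The ball `B(x, r) = {y | ρ(x, y) < r}`. -/
def qball {X : Type*} (ρ : X → X → ℝ) (x : X) (r : ℝ) : Set X := {y | ρ x y < r}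

/-- The topology of a quasimetric: `U` is open iff it contains a ball around each of its points.
(Balls themselves need not be open.) -/
@[reducible] def quasiTopology {X : Type*} (ρ : X → X → ℝ) : TopologicalSpace X where
  IsOpen U := ∀ x ∈ U, ∃ r : ℝ, 0 < r ∧ qball ρ x r ⊆ U
  isOpen_univ := fun _ _ => ⟨1, one_pos, subset_univ _⟩
  isOpen_inter := by
    rintro U V hU hV x ⟨hxU, hxV⟩
    obtain ⟨r, hr, h⟩ := hU x hxU
    obtain ⟨s, hs, h'⟩ := hV x hxV
    exact ⟨min r s, lt_min hr hs, fun y hy =>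
      ⟨h (lt_of_lt_of_le hy (min_le_left r s)), h' (lt_of_lt_of_le hy (min_le_right r s))⟩⟩
  isOpen_sUnion := by
    rintro S hS x ⟨U, hU, hxU⟩
    obtain ⟨r, hr, h⟩ := hS U hU x hxU
    exact ⟨r, hr, h.trans (subset_sUnion_of_mem hU)⟩

/-- `(X, ρ, μ)` is a space of homogeneous type with quasi-triangle constant `K` and doubling
constant `A`: `ρ` is a quasimetric, `μ` is a Borel measure, balls are measurable and have
positive finite measure, and `μ` is doubling. -/
structure IsHomogeneousType {X : Type*} [mX : MeasurableSpace X] (ρ : X → X → ℝ)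
    (μ : Measure X) (K : ℝ) (A : ℝ≥0) : Prop where
  quasiMetric : IsQuasiMetric ρ K
  borel_eq : mX = @borel X (quasiTopology ρ)
  measurableSet_ball : ∀ (x : X) (r : ℝ), MeasurableSet (qball ρ x r)
  ball_pos : ∀ (x : X) (r : ℝ), 0 < r → 0 < μ (qball ρ x r)
  ball_lt_top : ∀ (x : X) (r : ℝ), 0 < r → μ (qball ρ x r) < ∞
  doubling : ∀ (x : X) (r : ℝ), 0 < r → μ (qball ρ x (2 * r)) ≤ A * μ (qball ρ x r)

/-- Reverse doubling with parameters `c` and `ε`. -/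
def ReverseDoubling {X : Type*} [MeasurableSpace X] (ρ : X → X → ℝ) (μ : Measure X)
    (c ε : ℝ) : Prop :=
  ∀ (x : X) (R : ℝ), 0 < R →
    ENNReal.ofReal (1 + ε) * μ (qball ρ x R) ≤ μ (qball ρ x (c * R))

/-- A modulus of continuity; only the values on `[0, ∞)` matter. -/
structure IsModulus (ω : ℝ → ℝ) : Prop where
  nonneg : ∀ t, 0 ≤ t → 0 ≤ ω t
  zero : ω 0 = 0
  subadd : ∀ u t s, 0 ≤ u → 0 ≤ t → 0 ≤ s → u ≤ t + s → ω u ≤ ω t + ω s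

/-- The Dini norm `∫₀¹ ω(t) dt / t`, possibly infinite. -/
noncomputable def diniNorm (ω : ℝ → ℝ) : ℝ≥0∞ :=
  ∫⁻ t in Ioo (0 : ℝ) 1, ENNReal.ofReal (ω t / t)

/-- The log-Dini norm `∫₀¹ ω(t) |log t| dt / t`, possibly infinite. -/
noncomputable def logDiniNorm (ω : ℝ → ℝ) : ℝ≥0∞ :=
  ∫⁻ t in Ioo (0 : ℝ) 1, ENNReal.ofReal (ω t * |Real.log t| / t)

/-- Integrability on every ball. -/
def LocInt {X E : Type*} [NormedAddCommGroup E] [MeasurableSpace X] (ρ : X → X → ℝ)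
    (μ : Measure X) (f : X → E) : Prop :=
  ∀ (x : X) (r : ℝ), IntegrableOn f (qball ρ x r) μ

/-- The class `C_ω(x, k)` of test functions at the point `x` and the scale `κ ^ k`. -/
def testClass {X : Type*} [MeasurableSpace X] (ρ : X → X → ℝ) (μ : Measure X) (κ : ℝ)
    (ω : ℝ → ℝ) (Φ : ℝ) (x : X) (k : ℤ) : Set (X → ℝ) :=
  {φ | Function.support φ ⊆ qball ρ x (κ ^ k) ∧
    (Integrable φ μ ∧ ∫ y, φ y ∂μ = 0) ∧
    (∀ y, |φ y| ≤ (μ.real (qball ρ x (κ ^ k)))⁻¹ * Φ) ∧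
    ∀ y y', |φ y - φ y'| ≤ (μ.real (qball ρ x (κ ^ k)))⁻¹ * ω (ρ y y' / κ ^ k)}

/-- `A_ω f(x, k)`, the supremum of `|∫ f φ|` over `φ ∈ C_ω(x, k)`. -/
noncomputable def testSup {X : Type*} [MeasurableSpace X] (ρ : X → X → ℝ) (μ : Measure X)
    (κ : ℝ) (ω : ℝ → ℝ) (Φ : ℝ) (f : X → ℂ) (x : X) (k : ℤ) : ℝ≥0∞ :=
  ⨆ φ ∈ testClass ρ μ κ ω Φ x k, ‖∫ y, f y * (φ y : ℂ) ∂μ‖ₑ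

/-- The intrinsic square function `G_{ω,β} f` with aperture `β`, with values in `[0, ∞]`. -/
noncomputable def squareFunction {X : Type*} [MeasurableSpace X] (ρ : X → X → ℝ)
    (μ : Measure X) (κ : ℝ) (ω : ℝ → ℝ) (Φ β : ℝ) (f : X → ℂ) (x : X) : ℝ≥0∞ :=
  (∑' k : ℤ, ⨍⁻ y in qball ρ x (β * κ ^ k), testSup ρ μ κ ω Φ f y k ^ 2 ∂μ) ^ (1 / 2 : ℝ)

/-- The uncentered Hardy–Littlewood maximal function. -/
noncomputable def maximalFunction {X : Type*} [MeasurableSpace X] (ρ : X → X → ℝ)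
    (μ : Measure X) (v : X → ℝ) (x : X) : ℝ≥0∞ :=
  ⨆ (z : X) (r : ℝ) (_ : 0 < r) (_ : x ∈ qball ρ z r), ⨍⁻ y in qball ρ z r, ‖v y‖ₑ ∂μ

/-- `γ = sup_{x, t > 0} μ(B(x, β t)) / μ(B(x, t))`. -/
noncomputable def ballRatio {X : Type*} [MeasurableSpace X] (ρ : X → X → ℝ)
    (μ : Measure X) (β : ℝ) : ℝ≥0∞ :=
  ⨆ (x : X) (t : ℝ) (_ : 0 < t), μ (qball ρ x (β * t)) / μ (qball ρ x t)

/-- `v(E) = ∫_E v dμ` (as an outer measure, should `E` be non-measurable). -/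
noncomputable def weightMeasure {X : Type*} [MeasurableSpace X] (μ : Measure X) (v : X → ℝ) :
    Measure X :=
  μ.withDensity fun x => ENNReal.ofReal (v x)

end IntrinsicSquare

namespace IntrinsicSquare

/-! ### Quasimetric balls and maximal separated nets -/

section Geometry

variable {X : Type*} {ρ : X → X → ℝ} {K : ℝ}

/-! Discretization. At each scale `κ ^ k` fix a maximal `κ ^ k`-separated net. Replacing `A_ω f(y,
k)` by its supremum over the net ball (cell) containing `y` dominates the square of the square
function by a sum over pairs (scale, net point), with weights supported on balls of radius `2Kβκ ^
k` (`squareFunction_sq_le`). All estimates are made for finite sets `T` of pairs, uniformly in `T`.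

The `L²` bound. Choose for each pair a test function that nearly attains the supremum. A mean-zero
function at a fine scale sees only the oscillation of one at a coarser scale, so inner products
across scales `k`, `l` decay like `ω (κ ^ (-|k - l|))`. These sum to the Dini norm, and Schur's test
gives a Bessel inequality (`schur`, `sum_mul_norm_inner_sq_le`). Weights enter through level sets:
if each coefficient `W a` is at most `h` on the support of its test function, then among the pairs
with `W a > t` only the restriction of `f` to `{h > t}` matters, and integration in `t` gives the
inequality with weight `h`. Averages of `v` over the dilated cells are at most `Mv` there, so `h` is
bounded by `Mv`.

The weak type bound. Mean zero also lets `Φ` be replaced by `ω (2K)`, which the Dini norm controls,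
so the bound does not involve `Φ`. Apply a Calderón–Zygmund decomposition whose stopping radii are
at least the smallest scale `δ` in `T`; this makes differentiation of integrals unnecessary. The
good part spreads the mass of `f` on each piece evenly over a disjoint stopping ball, hence is
bounded by a multiple of the height, and the `L²` bound applies. Off an exceptional union of dilated
balls, only pairs with a scale at least the radius of the stopping balls they meet contribute. There
the bad part sees the oscillation of the test functions over these balls, and the moduli again sum
to the Dini norm (`lintegral_bad_le`). With `D` the Dini norm, the height `t γ^{1/2} / D` balances
the three contributions. If `μ` is too small for the decomposition at this height to exist, the
total weight is already small enough.

Both weak type estimates come from this single bound with the Dini norm, which is at most a constant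
times the log-Dini norm (`diniNorm_le_logDiniNorm`). -/

lemma IsQuasiMetric.pos (h : IsQuasiMetric ρ K) : 0 < K := one_pos.trans_le h.one_le

lemma IsQuasiMetric.self (h : IsQuasiMetric ρ K) (x : X) : ρ x x = 0 :=
  (h.eq_zero_iff x x).2 rfl

lemma IsQuasiMetric.mem_qball_self (h : IsQuasiMetric ρ K) (x : X) {r : ℝ} (hr : 0 < r) :
    x ∈ qball ρ x r := by
  simpa [qball, h.self] using hr

lemma IsQuasiMetric.triangle_lt (h : IsQuasiMetric ρ K) {x y z : X} {a b : ℝ}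
    (hxy : ρ x y ≤ a) (hyz : ρ y z < b) : ρ x z < K * (a + b) :=
  (h.quasi_triangle x y z).trans_lt
    (mul_lt_mul_of_pos_left (add_lt_add_of_le_of_lt hxy hyz) h.pos)

lemma IsQuasiMetric.qball_subset (h : IsQuasiMetric ρ K) {x y : X} {d s t : ℝ}
    (hxy : ρ x y ≤ d) (ht : K * (d + s) ≤ t) : qball ρ y s ⊆ qball ρ x t :=
  fun _ hw => (h.triangle_lt hxy hw).trans_le ht

lemma qball_mono (x : X) {r s : ℝ} (h : r ≤ s) : qball ρ x r ⊆ qball ρ x s :=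
  fun _ hy => lt_of_lt_of_le hy h

/-- The constant in `μ (B(x, L r)) ≤ doublingFactor A L * μ (B(x, r))`. -/
noncomputable def doublingFactor (A : ℝ≥0) (L : ℝ) : ℝ≥0 := A ^ ⌈L⌉₊

/-- A maximal `r`-separated set. -/
structure IsNet (ρ : X → X → ℝ) (r : ℝ) (Z : Set X) : Prop where
  separated : ∀ z ∈ Z, ∀ z' ∈ Z, z ≠ z' → r ≤ ρ z z'
  covers : ∀ x, ∃ z ∈ Z, ρ z x < r

lemma IsQuasiMetric.exists_isNet (h : IsQuasiMetric ρ K) {r : ℝ} (hr : 0 < r) :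
    ∃ Z, IsNet ρ r Z := by
  obtain ⟨Z, hZ⟩ := zorn_subset {Z : Set X | ∀ z ∈ Z, ∀ z' ∈ Z, z ≠ z' → r ≤ ρ z z'} (by
    intro c hc hchain
    refine ⟨⋃₀ c, ?_, fun s hs => subset_sUnion_of_mem hs⟩
    rintro z ⟨s, hs, hz⟩ z' ⟨t, ht, hz'⟩ hne
    rcases hchain.total hs ht with hst | hst
    · exact hc ht z (hst hz) z' hz' hne
    · exact hc hs z hz z' (hst hz') hne)
  refine ⟨Z, hZ.prop, fun x => ?_⟩
  by_contra! hx
  have hsep : insert x Z ∈ {Z : Set X | ∀ z ∈ Z, ∀ z' ∈ Z, z ≠ z' → r ≤ ρ z z'} := by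
    rintro z (rfl | hz) z' (rfl | hz') hne
    · exact absurd rfl hne
    · rw [h.symm]; exact hx z' hz'
    · exact hx z hz
    · exact hZ.prop z hz z' hz' hne
  have hxZ : x ∈ Z := hZ.le_of_ge hsep (subset_insert x Z) (mem_insert x Z)
  have := hx x hxZ
  rw [h.self] at this
  exact absurd this (not_le.2 hr)

lemma IsQuasiMetric.disjoint_of_isNet (h : IsQuasiMetric ρ K) {r : ℝ} {Z : Set X}
    (hZ : IsNet ρ r Z) : Z.PairwiseDisjoint fun z => qball ρ z (r / (2 * K)) := by
  intro z hz z' hz' hne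
  refine Set.disjoint_left.2 fun w hw hw' => ?_
  have h1 := hZ.separated z hz z' hz' hne
  have hw'' : ρ w z' < r / (2 * K) := by rw [h.symm]; exact hw'
  have h2 := h.triangle_lt (le_of_lt hw) hw''
  have h3 : K * (r / (2 * K) + r / (2 * K)) = r := by
    have := h.pos; field_simp; ring
  linarith

end Geometry

/-! ### Doubling, packing and counting of net points -/

section Measure

variable {X : Type*} [MeasurableSpace X] {ρ : X → X → ℝ} {μ : Measure X} {K : ℝ} {A : ℝ≥0}

/-- Since `L ≤ 2 ^ ⌈L⌉₊`, iterating the doubling condition `⌈L⌉₊` times is enough; the exponent is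
crude but depends only on `L`. -/
lemma IsHomogeneousType.measure_ball_mul_le (hX : IsHomogeneousType ρ μ K A) (x : X) {r : ℝ}
    (hr : 0 < r) (L : ℝ) :
    μ (qball ρ x (L * r)) ≤ doublingFactor A L * μ (qball ρ x r) := by
  have key : ∀ n : ℕ, μ (qball ρ x (2 ^ n * r)) ≤ (A : ℝ≥0∞) ^ n * μ (qball ρ x r) := by
    intro n
    induction n with
    | zero => simp
    | succ n ih =>
      calc μ (qball ρ x (2 ^ (n + 1) * r)) = μ (qball ρ x (2 * (2 ^ n * r))) := by ring_nf
        _ ≤ A * μ (qball ρ x (2 ^ n * r)) := hX.doubling _ _ (by positivity)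
        _ ≤ A * (A ^ n * μ (qball ρ x r)) := by gcongr
        _ = _ := by rw [pow_succ, ← mul_assoc, mul_comm (A : ℝ≥0∞)]
  have hL : L ≤ 2 ^ ⌈L⌉₊ := (Nat.le_ceil L).trans (by exact_mod_cast Nat.lt_two_pow_self.le)
  refine (measure_mono (qball_mono x (mul_le_mul_of_nonneg_right hL hr.le))).trans ?_
  simpa [doublingFactor] using key ⌈L⌉₊

lemma IsHomogeneousType.measure_ball_le_of_dist (hX : IsHomogeneousType ρ μ K A) {x y : X}
    {d s r L : ℝ} (hr : 0 < r) (hxy : ρ x y ≤ d) (h : K * (d + s) ≤ L * r) :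
    μ (qball ρ y s) ≤ doublingFactor A L * μ (qball ρ x r) :=
  (measure_mono (hX.quasiMetric.qball_subset hxy h)).trans (hX.measure_ball_mul_le x hr L)

lemma IsHomogeneousType.sigmaFinite (hX : IsHomogeneousType ρ μ K A) : SigmaFinite μ := by
  rcases isEmpty_or_nonempty X with hE | ⟨⟨x⟩⟩
  · have : μ = 0 := Measure.eq_zero_of_isEmpty μ
    rw [this]; infer_instance
  · refine ⟨⟨⟨fun n : ℕ => qball ρ x (n + 1), fun _ => trivial,
      fun n => hX.ball_lt_top x _ (by positivity), ?_⟩⟩⟩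
    refine eq_univ_of_forall fun y => ?_
    obtain ⟨n, hn⟩ := exists_nat_gt (ρ x y)
    exact mem_iUnion.2 ⟨n, by simp only [qball, mem_ofPred_eq]; linarith⟩

lemma IsHomogeneousType.countable_of_disjoint_balls (hX : IsHomogeneousType ρ μ K A) {Z : Set X}
    {r : X → ℝ} (hr : ∀ z ∈ Z, 0 < r z) (hd : Z.PairwiseDisjoint fun z => qball ρ z (r z)) :
    Z.Countable := by
  have := hX.sigmaFinite
  have hc := Measure.countable_meas_pos_of_disjoint_iUnion (μ := μ)
    (As := fun z : Z => qball ρ (z : X) (r z)) (fun z => hX.measurableSet_ball _ _)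
    (fun z z' hne => hd z.2 z'.2 (fun h => hne (Subtype.ext h)))
  have huniv : {z : Z | 0 < μ (qball ρ (z : X) (r z))} = univ :=
    eq_univ_of_forall fun z => hX.ball_pos _ _ (hr z z.2)
  rw [huniv, countable_univ_iff] at hc
  exact hc

lemma IsHomogeneousType.countable_of_isNet (hX : IsHomogeneousType ρ μ K A) {r : ℝ} (hr : 0 < r)
    {Z : Set X} (hZ : IsNet ρ r Z) : Z.Countable := by
  have := hX.quasiMetric.pos
  exact hX.countable_of_disjoint_balls (r := fun _ => r / (2 * K)) (fun _ _ => by positivity)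
    (hX.quasiMetric.disjoint_of_isNet hZ)

/-- The balls of a net that have their centres in `B(x, R)` have a total measure comparable with
that of a ball. -/
lemma IsHomogeneousType.packing (hX : IsHomogeneousType ρ μ K A) {r : ℝ} (hr : 0 < r)
    {Z : Set X} (hZ : IsNet ρ r Z) (x : X) (R : ℝ) :
    ∑' z : Z, (if ρ x z < R then μ (qball ρ (z : X) r) else 0)
      ≤ doublingFactor A (2 * K) * μ (qball ρ x (K * (R + r))) := by
  have hK := hX.quasiMetric.pos
  have hK1 := hX.quasiMetric.one_le
  have : Countable Z := (hX.countable_of_isNet hr hZ).to_subtype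
  have hr' : 0 < r / (2 * K) := by positivity
  -- The condition on the centre is put into the set, so that far points give the empty set and the
  -- sum may run over the whole net.
  let S : Z → Set X := fun z => {w | w ∈ qball ρ (z : X) (r / (2 * K)) ∧ ρ x z < R}
  have hSm : ∀ z, MeasurableSet (S z) := fun z =>
    (hX.measurableSet_ball _ _).inter (MeasurableSet.const _)
  have hSd : Pairwise (Function.onFun Disjoint S) := fun z z' hne =>
    (hX.quasiMetric.disjoint_of_isNet hZ z.2 z'.2 (fun h => hne (Subtype.ext h))).mono
      (fun _ h => h.1) (fun _ h => h.1)
  calc ∑' z : Z, (if ρ x z < R then μ (qball ρ (z : X) r) else 0)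
      ≤ ∑' z : Z, doublingFactor A (2 * K) * μ (S z) := by
        refine ENNReal.tsum_le_tsum fun z => ?_
        split_ifs with h
        · have hS : S z = qball ρ (z : X) (r / (2 * K)) := by
            ext w; simp [S, h]
          rw [hS]
          convert hX.measure_ball_mul_le (z : X) hr' (2 * K) using 3
          field_simp
        · exact zero_le
    _ = doublingFactor A (2 * K) * μ (⋃ z, S z) := by
        rw [ENNReal.tsum_mul_left, measure_iUnion hSd hSm]
    _ ≤ _ := by
        gcongr
        refine iUnion_subset fun z w hw => ?_
        refine hX.quasiMetric.qball_subset (le_of_lt hw.2) ?_ hw.1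
        have : r / (2 * K) ≤ r := div_le_self hr.le (by linarith)
        gcongr

/-- The number of points of an `r`-net in a ball of radius `Λ r` is bounded. -/
lemma IsHomogeneousType.net_count (hX : IsHomogeneousType ρ μ K A) {r : ℝ} (hr : 0 < r)
    {Z : Set X} (hZ : IsNet ρ r Z) (x : X) (Λ : ℝ) :
    ∑' z : Z, (if ρ x z < Λ * r then 1 else 0)
      ≤ (doublingFactor A (K * (Λ + 1)) * (doublingFactor A (2 * K) *
        doublingFactor A (K * (Λ + 1))) : ℝ≥0∞) := by
  have hpos := hX.ball_pos x r hr
  have hfin := hX.ball_lt_top x r hr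
  calc ∑' z : Z, (if ρ x z < Λ * r then 1 else 0)
      ≤ ∑' z : Z, (doublingFactor A (K * (Λ + 1)) * (μ (qball ρ x r))⁻¹) *
          (if ρ x z < Λ * r then μ (qball ρ (z : X) r) else 0) := by
        refine ENNReal.tsum_le_tsum fun z => ?_
        split_ifs with h
        · rw [mul_right_comm, ← div_eq_mul_inv, ENNReal.le_div_iff_mul_le (Or.inl hpos.ne')
            (Or.inl hfin.ne), one_mul]
          refine hX.measure_ball_le_of_dist hr (d := Λ * r) ?_ (by rw [mul_assoc]; exact le_of_eq (by ring))
          rw [hX.quasiMetric.symm]; exact h.le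
        · exact zero_le
    _ ≤ (doublingFactor A (K * (Λ + 1)) * (μ (qball ρ x r))⁻¹) *
          (doublingFactor A (2 * K) * (doublingFactor A (K * (Λ + 1)) * μ (qball ρ x r))) := by
        rw [ENNReal.tsum_mul_left]
        gcongr
        refine (hX.packing hr hZ x (Λ * r)).trans ?_
        gcongr
        have := hX.measure_ball_mul_le x hr (K * (Λ + 1))
        rwa [show K * (Λ + 1) * r = K * (Λ * r + r) by ring] at this
    _ = _ := by
        calc _ = (doublingFactor A (K * (Λ + 1)) * (doublingFactor A (2 * K) *
              doublingFactor A (K * (Λ + 1))) : ℝ≥0∞) *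
                ((μ (qball ρ x r))⁻¹ * μ (qball ρ x r)) := by ring
          _ = _ := by rw [ENNReal.inv_mul_cancel hpos.ne' hfin.ne, mul_one]

end Measure

/-! ### Moduli of continuity: sums over scales, Dini and log-Dini norms -/

section Modulus

variable {ω : ℝ → ℝ}

lemma IsModulus.mono (hω : IsModulus ω) {u t : ℝ} (hu : 0 ≤ u) (h : u ≤ t) : ω u ≤ ω t := by
  simpa [hω.zero] using hω.subadd u t 0 hu (hu.trans h) le_rfl (by simpa using h)

lemma IsModulus.nat_mul_le (hω : IsModulus ω) {t : ℝ} (ht : 0 ≤ t) (n : ℕ) :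
    ω (n * t) ≤ n * ω t := by
  induction n with
  | zero => simp [hω.zero]
  | succ n ih =>
    have := hω.subadd ((n + 1 : ℕ) * t) (n * t) t (by positivity) (by positivity) ht
      (by push_cast; linarith)
    push_cast at this ⊢
    linarith

lemma IsModulus.mul_le (hω : IsModulus ω) {L t : ℝ} (hL : 0 ≤ L) (ht : 0 ≤ t) :
    ω (L * t) ≤ ⌈L⌉₊ * ω t :=
  (hω.mono (by positivity) (mul_le_mul_of_nonneg_right (Nat.le_ceil L) ht)).trans
    (hω.nat_mul_le ht _)

/-- The constant comparing `∑ ω (κ⁻¹ ^ n)` with the Dini norm. -/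
noncomputable def diniConst (κ : ℝ) : ℝ≥0 := (1 - κ⁻¹).toNNReal⁻¹ * ⌈κ⌉₊

/-- On the interval `(κ⁻¹ ^ (n + 1), κ⁻¹ ^ n)` the value of `ω` at the right end is at most `⌈κ⌉₊ *
ω t`, by monotonicity and subadditivity, and the `dt / t` measure is at least `1 - κ⁻¹`. The
intervals are disjoint. -/
lemma IsModulus.tsum_le_diniNorm (hω : IsModulus ω) {κ : ℝ} (hκ : 1 < κ) :
    ∑' n : ℕ, ENNReal.ofReal (ω (κ⁻¹ ^ n)) ≤ diniConst κ * diniNorm ω := by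
  have hκ0 : 0 < κ := one_pos.trans hκ
  have hq0 : 0 < κ⁻¹ := inv_pos.2 hκ0
  have hq1 : κ⁻¹ < 1 := inv_lt_one_of_one_lt₀ hκ
  set q := κ⁻¹ with hq
  let I : ℕ → Set ℝ := fun n => Ioo (q ^ (n + 1)) (q ^ n)
  have hd : Pairwise (Function.onFun Disjoint I) := by
    have hanti : Antitone fun n : ℕ => q ^ n := fun m n h => pow_le_pow_of_le_one hq0.le hq1.le h
    intro m n hne
    have key : ∀ m n : ℕ, m < n → Disjoint (I m) (I n) := fun m n hmn =>
      Set.disjoint_left.2 fun t ht ht' =>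
        absurd (ht'.2.trans_le (hanti (Nat.succ_le_of_lt hmn))) (not_lt.2 ht.1.le)
    rcases lt_or_gt_of_ne hne with h | h
    · exact key m n h
    · exact (key n m h).symm
  have hsub : ⋃ n, I n ⊆ Ioo (0 : ℝ) 1 := iUnion_subset fun n t ht =>
    ⟨(pow_pos hq0 _).trans ht.1, ht.2.trans_le (pow_le_one₀ hq0.le hq1.le)⟩
  have hc : 0 < 1 - q := by linarith
  have hterm : ∀ n, ENNReal.ofReal (ω (q ^ n)) ≤
      diniConst κ * ∫⁻ t in I n, ENNReal.ofReal (ω t / t) := by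
    intro n
    have hqn : 0 < q ^ n := pow_pos hq0 n
    have hNpos : (0 : ℝ) < ⌈κ⌉₊ := by exact_mod_cast Nat.ceil_pos.2 hκ0
    have hlow : ENNReal.ofReal (ω (q ^ n) / ⌈κ⌉₊ / q ^ n) * volume (I n) ≤
        ∫⁻ t in I n, ENNReal.ofReal (ω t / t) := by
      rw [← setLIntegral_const]
      refine setLIntegral_mono' measurableSet_Ioo fun t ht => ENNReal.ofReal_le_ofReal ?_
      have ht0 : 0 < t := (pow_pos hq0 _).trans ht.1
      have h1 : ω (q ^ n) ≤ ⌈κ⌉₊ * ω t := by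
        refine (hω.mono hqn.le ?_).trans (hω.mul_le hκ0.le ht0.le)
        have : q ^ n = κ * q ^ (n + 1) := by
          rw [pow_succ, hq]; field_simp
        rw [this]
        exact mul_le_mul_of_nonneg_left ht.1.le hκ0.le
      have h2 : ω (q ^ n) / ⌈κ⌉₊ ≤ ω t := by rw [div_le_iff₀ hNpos]; linarith
      exact div_le_div₀ (hω.nonneg t ht0.le) h2 ht0 ht.2.le
    have hvol : volume (I n) = ENNReal.ofReal (q ^ n * (1 - q)) := by
      rw [Real.volume_Ioo]; congr 1; ring
    rw [hvol, ← ENNReal.ofReal_mul (by have := hω.nonneg _ hqn.le; positivity)] at hlow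
    have hD : (diniConst κ : ℝ≥0∞) = ENNReal.ofReal ((1 - q)⁻¹ * ⌈κ⌉₊) := by
      rw [diniConst, ENNReal.ofReal_mul (by positivity), ENNReal.coe_mul]
      congr 1
      · rw [ENNReal.ofReal, Real.toNNReal_inv]
      · simp
    refine le_trans (le_of_eq ?_) (mul_le_mul_right hlow _)
    rw [hD, ← ENNReal.ofReal_mul (by positivity)]
    congr 1
    field_simp
  calc ∑' n : ℕ, ENNReal.ofReal (ω (q ^ n))
      ≤ ∑' n, diniConst κ * ∫⁻ t in I n, ENNReal.ofReal (ω t / t) := ENNReal.tsum_le_tsum hterm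
    _ = diniConst κ * ∫⁻ t in ⋃ n, I n, ENNReal.ofReal (ω t / t) := by
        rw [ENNReal.tsum_mul_left, lintegral_iUnion (fun n => measurableSet_Ioo) hd]
    _ ≤ _ := by
        gcongr
        exact lintegral_mono_set hsub

lemma IsModulus.ofReal_le_diniNorm (hω : IsModulus ω) {κ : ℝ} (hκ : 1 < κ) {L : ℝ} (hL : 0 ≤ L) :
    ENNReal.ofReal (ω L) ≤ ⌈L⌉₊ * (diniConst κ * diniNorm ω) := by
  -- The value `ω 1` is the term `n = 0` of the geometric sum.
  have h1 : ENNReal.ofReal (ω 1) ≤ diniConst κ * diniNorm ω :=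
    le_trans (by simpa using ENNReal.le_tsum (f := fun n : ℕ => ENNReal.ofReal (ω (κ⁻¹ ^ n))) 0)
      (hω.tsum_le_diniNorm hκ)
  have h2 := hω.mul_le hL zero_le_one
  rw [mul_one] at h2
  calc ENNReal.ofReal (ω L) ≤ ENNReal.ofReal (⌈L⌉₊ * ω 1) := ENNReal.ofReal_le_ofReal h2
    _ = ⌈L⌉₊ * ENNReal.ofReal (ω 1) := by
        rw [ENNReal.ofReal_mul (by positivity), ENNReal.ofReal_natCast]
    _ ≤ _ := by gcongr

lemma tsum_natAbs_sub_le (u : ℕ → ℝ≥0∞) (k : ℤ) :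
    ∑' l : ℤ, u (k - l).natAbs ≤ 2 * ∑' n, u n := by
  rw [show ∑' l : ℤ, u (k - l).natAbs = ∑' l : ℤ, u l.natAbs from
      (Equiv.subLeft k).tsum_eq (fun l : ℤ => u l.natAbs),
    tsum_of_nat_of_neg_add_one ENNReal.summable ENNReal.summable, two_mul]
  refine add_le_add (by simp) ?_
  have : ∀ n : ℕ, (-((n : ℤ) + 1)).natAbs = n + 1 := fun n => by omega
  simp_rw [this]
  exact ENNReal.tsum_comp_le_tsum_of_injective (add_left_injective 1) u

lemma IsModulus.tsum_int_le_diniNorm (hω : IsModulus ω) {κ : ℝ} (hκ : 1 < κ) (k : ℤ) :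
    ∑' l : ℤ, ENNReal.ofReal (ω (κ⁻¹ ^ (k - l).natAbs)) ≤ 2 * (diniConst κ * diniNorm ω) :=
  (tsum_natAbs_sub_le _ k).trans (mul_le_mul_right (hω.tsum_le_diniNorm hκ) _)

/-- Only the vanishing of the logarithm at `1` is an obstacle. On `(0, 1/2]` one has `|log t| ≥ log
2`. The integral over `(1/2, 1)` is at most `ω 1 ≤ 4 * ω (1/4)`, and this is recovered from the
log-Dini integral over `(1/4, 1/2]`. The two parts cost `1 / log 2` and `8 / log 2`. -/
lemma IsModulus.diniNorm_le_logDiniNorm (hω : IsModulus ω) :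
    diniNorm ω ≤ ENNReal.ofReal (9 / Real.log 2) * logDiniNorm ω := by
  have hlog : 0 < Real.log 2 := Real.log_pos one_lt_two
  have habs : ∀ t : ℝ, 0 < t → t ≤ 1 / 2 → Real.log 2 ≤ |Real.log t| := fun t ht ht' => by
    have h1 : Real.log t ≤ Real.log (1 / 2) := Real.log_le_log ht ht'
    rw [one_div, Real.log_inv] at h1
    rw [abs_of_nonpos (by linarith)]
    linarith
  have hsplit : Ioo (0 : ℝ) 1 ⊆ Ioc 0 (1 / 2) ∪ Ioo (1 / 2) 1 := fun t ht => by
    rcases le_or_gt t (1 / 2) with h | h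
    · exact Or.inl ⟨ht.1, h⟩
    · exact Or.inr ⟨h, ht.2⟩
  have h1 : ∫⁻ t in Ioc (0 : ℝ) (1 / 2), ENNReal.ofReal (ω t / t) ≤
      ENNReal.ofReal (1 / Real.log 2) * logDiniNorm ω := by
    rw [logDiniNorm, ← lintegral_const_mul' _ _ ENNReal.ofReal_ne_top]
    refine le_trans (setLIntegral_mono' measurableSet_Ioc fun t ht => ?_)
      (lintegral_mono_set (fun t ht => ⟨ht.1, by linarith [ht.2]⟩ :
        Ioc (0 : ℝ) (1 / 2) ⊆ Ioo 0 1))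
    rw [← ENNReal.ofReal_mul (by positivity)]
    refine ENNReal.ofReal_le_ofReal ?_
    have h2 := habs t ht.1 ht.2
    have h3 := hω.nonneg t ht.1.le
    have h4 : ω t ≤ 1 / Real.log 2 * (ω t * |Real.log t|) := by
      rw [one_div, inv_mul_eq_div, le_div_iff₀ hlog]
      gcongr
    calc ω t / t ≤ (1 / Real.log 2 * (ω t * |Real.log t|)) / t :=
          div_le_div_of_nonneg_right h4 ht.1.le
      _ = _ := by ring
  have h2 : ∫⁻ t in Ioo (1 / 2 : ℝ) 1, ENNReal.ofReal (ω t / t) ≤ ENNReal.ofReal (ω 1) := by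
    calc ∫⁻ t in Ioo (1 / 2 : ℝ) 1, ENNReal.ofReal (ω t / t)
        ≤ ∫⁻ t in Ioo (1 / 2 : ℝ) 1, ENNReal.ofReal (2 * ω 1) := by
          refine setLIntegral_mono' measurableSet_Ioo fun t ht => ENNReal.ofReal_le_ofReal ?_
          have ht0 : (0 : ℝ) < t := by linarith [ht.1]
          have h5 := hω.mono ht0.le ht.2.le
          have h6 := hω.nonneg t ht0.le
          rw [div_le_iff₀ ht0]
          nlinarith [ht.1]
      _ = ENNReal.ofReal (ω 1) := by
          rw [setLIntegral_const, Real.volume_Ioo,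
            ← ENNReal.ofReal_mul (by have := hω.nonneg 1 zero_le_one; positivity)]
          congr 1
          ring
  have h3 : ENNReal.ofReal (ω 1) ≤ ENNReal.ofReal (8 / Real.log 2) * logDiniNorm ω := by
    have hq := hω.nonneg (1 / 4) (by norm_num)
    have h4 : ENNReal.ofReal (2 * (ω (1 / 4) * Real.log 2)) * volume (Ioc (1 / 4 : ℝ) (1 / 2)) ≤
        logDiniNorm ω := by
      rw [← setLIntegral_const]
      refine le_trans (setLIntegral_mono' measurableSet_Ioc fun t ht => ?_)
        (lintegral_mono_set (fun t ht => ⟨by linarith [ht.1], by linarith [ht.2]⟩ :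
        Ioc (1 / 4 : ℝ) (1 / 2) ⊆ Ioo 0 1))
      refine ENNReal.ofReal_le_ofReal ?_
      have ht0 : (0 : ℝ) < t := by linarith [ht.1]
      have h5 := hω.mono (by norm_num) ht.1.le
      have h6 := habs t ht0 ht.2
      rw [le_div_iff₀ ht0]
      have h7 : ω (1 / 4) * Real.log 2 ≤ ω t * |Real.log t| :=
        mul_le_mul h5 h6 hlog.le (hq.trans h5)
      have h8 : 0 ≤ ω (1 / 4) * Real.log 2 := by positivity
      nlinarith [ht.2]
    rw [Real.volume_Ioc, ← ENNReal.ofReal_mul (by positivity)] at h4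
    refine le_trans ?_ (mul_le_mul_right h4 _)
    rw [← ENNReal.ofReal_mul (by positivity)]
    refine ENNReal.ofReal_le_ofReal ?_
    have h5 := hω.nat_mul_le (t := 1 / 4) (by norm_num) 4
    norm_num at h5
    calc ω 1 ≤ 4 * ω (1 / 4) := by norm_num; exact h5
      _ = _ := by field_simp; ring
  calc diniNorm ω ≤ ∫⁻ t in Ioc (0 : ℝ) (1 / 2) ∪ Ioo (1 / 2) 1, ENNReal.ofReal (ω t / t) :=
        lintegral_mono_set hsplit
    _ ≤ _ := lintegral_union_le _ _ _
    _ ≤ ENNReal.ofReal (1 / Real.log 2) * logDiniNorm ω +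
        ENNReal.ofReal (8 / Real.log 2) * logDiniNorm ω := add_le_add h1 (h2.trans h3)
    _ = _ := by
        rw [← add_mul, ← ENNReal.ofReal_add (by positivity) (by positivity)]
        congr 2
        ring

end Modulus

/-! ### Test functions: size from oscillation, and decay of inner products -/

section TestClass

variable {X : Type*} [MeasurableSpace X] {ρ : X → X → ℝ} {μ : Measure X} {K : ℝ} {A : ℝ≥0}
  {κ Φ : ℝ} {ω : ℝ → ℝ}

lemma IsHomogeneousType.real_ball_pos (hX : IsHomogeneousType ρ μ K A) (x : X) {r : ℝ}
    (hr : 0 < r) : 0 < μ.real (qball ρ x r) :=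
  ENNReal.toReal_pos (hX.ball_pos x r hr).ne' (hX.ball_lt_top x r hr).ne

lemma IsHomogeneousType.ofReal_inv_real_ball (hX : IsHomogeneousType ρ μ K A) (x : X) {r : ℝ}
    (hr : 0 < r) : ENNReal.ofReal (μ.real (qball ρ x r))⁻¹ = (μ (qball ρ x r))⁻¹ := by
  rw [ENNReal.ofReal_inv_of_pos (hX.real_ball_pos x hr), measureReal_def,
    ENNReal.ofReal_toReal (hX.ball_lt_top x r hr).ne]

/-- A mean-zero test function changes sign, so its size is controlled by its oscillation. -/
lemma IsHomogeneousType.testClass_subset (hX : IsHomogeneousType ρ μ K A) (hκ : 1 < κ)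
    (hω : IsModulus ω) (Φ : ℝ) (x : X) (k : ℤ) :
    testClass ρ μ κ ω Φ x k ⊆ testClass ρ μ κ ω (ω (2 * K)) x k := by
  rintro φ ⟨hsupp, ⟨hint, hzero⟩, hbd, hosc⟩
  have hs : (0 : ℝ) < κ ^ k := zpow_pos (one_pos.trans hκ) k
  have hK := hX.quasiMetric.pos
  have hM := hX.real_ball_pos x hs
  have hωK := hω.nonneg (2 * K) (by positivity)
  have houter : ∀ y, y ∉ qball ρ x (κ ^ k) → φ y = 0 := fun y hy => by
    by_contra h
    exact hy (hsupp h)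
  -- A function with zero integral that vanishes off the ball cannot be positive throughout a ball
  -- of positive measure. Used for `φ` and `-φ`, this gives points of both signs at distance less
  -- than `2Kκ ^ k` from any point of the ball.
  have key : ∀ ψ : X → ℝ, Integrable ψ μ → ∫ y, ψ y ∂μ = 0 →
      (∀ y, y ∉ qball ρ x (κ ^ k) → ψ y = 0) → ∃ y ∈ qball ρ x (κ ^ k), ψ y ≤ 0 := by
    intro ψ hψ hψ0 hψs
    by_contra! hpos
    have hnn : 0 ≤ ψ := fun y => by
      by_cases hy : y ∈ qball ρ x (κ ^ k)
      · exact (hpos y hy).le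
      · exact (hψs y hy).ge
    have hae := (integral_eq_zero_iff_of_nonneg hnn hψ).1 hψ0
    have : μ (qball ρ x (κ ^ k)) ≤ 0 := by
      rw [← ae_iff.1 hae]
      exact measure_mono fun y hy => (hpos y hy).ne'
    exact absurd this (not_le.2 (hX.ball_pos x _ hs))
  have hosc' : ∀ y ∈ qball ρ x (κ ^ k), ∀ y' ∈ qball ρ x (κ ^ k),
      |φ y - φ y'| ≤ (μ.real (qball ρ x (κ ^ k)))⁻¹ * ω (2 * K) := by
    intro y hy y' hy'
    refine (hosc y y').trans (mul_le_mul_of_nonneg_left ?_ (inv_nonneg.2 hM.le))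
    refine hω.mono (div_nonneg (hX.quasiMetric.nonneg _ _) hs.le) ?_
    rw [div_le_iff₀ hs]
    have hy2 : ρ y x ≤ κ ^ k := by rw [hX.quasiMetric.symm]; exact le_of_lt hy
    have := hX.quasiMetric.triangle_lt hy2 hy'
    linarith
  refine ⟨hsupp, ⟨hint, hzero⟩, fun y => ?_, hosc⟩
  by_cases hy : y ∈ qball ρ x (κ ^ k)
  · obtain ⟨y₁, hy₁, h₁⟩ := key φ hint hzero houter
    obtain ⟨y₂, hy₂, h₂⟩ := key (fun y => -φ y) hint.neg (by rw [integral_neg, hzero, neg_zero])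
      (fun y hy => by rw [houter y hy, neg_zero])
    have e₁ := (abs_le.1 (hosc' y hy y₁ hy₁)).2
    have e₂ := (abs_le.1 (hosc' y hy y₂ hy₂)).1
    exact abs_le.2 ⟨by linarith, by linarith⟩
  · rw [houter y hy, abs_zero]
    positivity

lemma testSup_le_of_subset {Φ' : ℝ} {x : X} {k : ℤ} (f : X → ℂ)
    (h : testClass ρ μ κ ω Φ x k ⊆ testClass ρ μ κ ω Φ' x k) :
    testSup ρ μ κ ω Φ f x k ≤ testSup ρ μ κ ω Φ' f x k :=
  biSup_mono h

lemma integrable_mul_of_mem_testClass {f : X → ℂ} {φ : X → ℝ} {x : X} {k : ℤ}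
    (hf : IntegrableOn f (qball ρ x (κ ^ k)) μ)
    (hφ : φ ∈ testClass ρ μ κ ω Φ x k) : Integrable (fun y => f y * (φ y : ℂ)) μ := by
  have h : IntegrableOn (fun y => f y * (φ y : ℂ)) (qball ρ x (κ ^ k)) μ := by
    refine Integrable.mul_bdd (c := (μ.real (qball ρ x (κ ^ k)))⁻¹ * Φ) hf ?_ ?_
    · exact (Complex.continuous_ofReal.comp_aestronglyMeasurable
        hφ.2.1.1.aestronglyMeasurable).restrict
    · exact Filter.Eventually.of_forall fun y => by
        rw [Complex.norm_real]; exact hφ.2.2.1 y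
  rw [← integrableOn_iff_integrable_of_support_subset (s := qball ρ x (κ ^ k))]
  · exact h
  · intro y hy
    refine hφ.1 ?_
    intro h0
    simp [h0] at hy

/-- As `ψ` at the finer scale has mean zero, the constant `φ y` may be subtracted from `φ`. On the
support of `ψ` the difference is controlled by `ω (κ ^ l / κ ^ k)`, and the `L¹` norm of `ψ` is at
most `Φ`. -/
lemma IsHomogeneousType.enorm_integral_mul_le (hX : IsHomogeneousType ρ μ K A) (hκ : 1 < κ)
    (hω : IsModulus ω) (hΦ : 0 ≤ Φ) {φ ψ : X → ℝ} {x y : X} {k l : ℤ}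
    (hφ : φ ∈ testClass ρ μ κ ω Φ x k) (hψ : ψ ∈ testClass ρ μ κ ω Φ y l) (hlk : l ≤ k) :
    ‖∫ w, φ w * ψ w ∂μ‖ₑ ≤ (μ (qball ρ x (κ ^ k)))⁻¹ *
      (ENNReal.ofReal Φ * ENNReal.ofReal (ω (κ⁻¹ ^ (k - l).natAbs))) := by
  have hκ0 := one_pos.trans hκ
  have hs : (0 : ℝ) < κ ^ k := zpow_pos hκ0 k
  have hs' : (0 : ℝ) < κ ^ l := zpow_pos hκ0 l
  have hM := hX.real_ball_pos x hs
  have hM' := hX.real_ball_pos y hs'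
  have hq : κ ^ l / κ ^ k = κ⁻¹ ^ (k - l).natAbs := by
    rw [← zpow_natCast, Int.natCast_natAbs, abs_of_nonneg (by omega), inv_zpow', neg_sub,
      zpow_sub₀ hκ0.ne']
  set c := (μ.real (qball ρ x (κ ^ k)))⁻¹ * ω (κ⁻¹ ^ (k - l).natAbs) with hc
  have hc0 : 0 ≤ c := mul_nonneg (inv_nonneg.2 hM.le) (hω.nonneg _ (by positivity))
  have hφψ : Integrable (fun w => φ w * ψ w) μ := by
    refine Integrable.bdd_mul (c := (μ.real (qball ρ x (κ ^ k)))⁻¹ * Φ) hψ.2.1.1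
      hφ.2.1.1.aestronglyMeasurable ?_
    exact Filter.Eventually.of_forall fun w => hφ.2.2.1 w
  have heq : ∫ w, φ w * ψ w ∂μ = ∫ w in qball ρ y (κ ^ l), (φ w - φ y) * ψ w ∂μ := by
    rw [setIntegral_eq_integral_of_forall_compl_eq_zero]
    · simp_rw [sub_mul]
      rw [integral_sub hφψ (hψ.2.1.1.const_mul _), integral_const_mul, hψ.2.1.2, mul_zero,
        sub_zero]
    · intro w hw
      have : ψ w = 0 := by
        by_contra h
        exact hw (hψ.1 h)
      rw [this, mul_zero]
  have hnorm : ‖∫ w, φ w * ψ w ∂μ‖ ≤ c * Φ := by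
    rw [heq]
    refine (norm_setIntegral_le_of_norm_le_const
      (C := c * ((μ.real (qball ρ y (κ ^ l)))⁻¹ * Φ)) (hX.ball_lt_top y _ hs') ?_).trans
        (le_of_eq (by field_simp))
    intro w hw
    rw [norm_mul]
    refine mul_le_mul ?_ (hψ.2.2.1 w) (norm_nonneg _) hc0
    refine (hφ.2.2.2 w y).trans (mul_le_mul_of_nonneg_left ?_ (inv_nonneg.2 hM.le))
    rw [← hq]
    refine hω.mono (div_nonneg (hX.quasiMetric.nonneg _ _) hs.le) ?_
    rw [hX.quasiMetric.symm]
    exact div_le_div_of_nonneg_right (le_of_lt hw) hs.le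
  rw [← ofReal_norm, ← hX.ofReal_inv_real_ball x hs, ← ENNReal.ofReal_mul hΦ,
    ← ENNReal.ofReal_mul (inv_nonneg.2 hM.le)]
  refine ENNReal.ofReal_le_ofReal (hnorm.trans (le_of_eq ?_))
  rw [hc]; ring

end TestClass

/-! ### Almost orthogonality of the test functions -/

section Schur

variable {X : Type*} [MeasurableSpace X] {ρ : X → X → ℝ} {μ : Measure X} {K : ℝ} {A : ℝ≥0}
  {κ Φ : ℝ} {ω : ℝ → ℝ} {Z : ℤ → Set X}

/-- The pairs of a scale and a point of the net of that scale. -/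
abbrev NetIndex (Z : ℤ → Set X) := (k : ℤ) × Z k

/-- The ball of the net point `a` at its scale. -/
def cell (ρ : X → X → ℝ) (κ : ℝ) (a : NetIndex Z) : Set X := qball ρ (a.2 : X) (κ ^ a.1)

/-- The ball of the net point `a` whose radius is `L` times the scale. -/
def dilate (ρ : X → X → ℝ) (κ L : ℝ) (a : NetIndex Z) : Set X := qball ρ (a.2 : X) (L * κ ^ a.1)

/-- A test function for each index, centred in the corresponding cell. -/
def IsTestFamily (ρ : X → X → ℝ) (μ : Measure X) (κ : ℝ) (ω : ℝ → ℝ) (Φ : ℝ)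
    (φ : NetIndex Z → X → ℝ) : Prop :=
  ∀ a, ∃ y ∈ cell ρ κ a, φ a ∈ testClass ρ μ κ ω Φ y a.1

lemma IsTestFamily.support_subset (hX : IsHomogeneousType ρ μ K A)
    {φ : NetIndex Z → X → ℝ} (hφ : IsTestFamily ρ μ κ ω Φ φ) (a : NetIndex Z) :
    Function.support (φ a) ⊆ dilate ρ κ (2 * K) a := by
  obtain ⟨y, hy, h⟩ := hφ a
  exact h.1.trans (hX.quasiMetric.qball_subset (le_of_lt hy) (le_of_eq (by ring)))

/-- Test functions are normalized by the ball at their own centre `y`; this passes to the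
normalization by the cell, which does not depend on `y`. -/
lemma IsHomogeneousType.inv_ball_le_inv_cell (hX : IsHomogeneousType ρ μ K A) (hκ : 1 < κ)
    (a : NetIndex Z) {y : X} (hy : y ∈ cell ρ κ a) :
    (μ (qball ρ y (κ ^ a.1)))⁻¹ ≤ doublingFactor A (2 * K) * (μ (cell ρ κ a))⁻¹ := by
  have hs : (0 : ℝ) < κ ^ a.1 := zpow_pos (one_pos.trans hκ) _
  have h : μ (cell ρ κ a) ≤ doublingFactor A (2 * K) * μ (qball ρ y (κ ^ a.1)) := by
    refine hX.measure_ball_le_of_dist hs (d := κ ^ a.1) ?_ (le_of_eq (by ring))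
    rw [hX.quasiMetric.symm]; exact le_of_lt hy
  have h0 := (hX.ball_pos y _ hs).ne'
  have ht := (hX.ball_lt_top y _ hs).ne
  have h0' : μ (cell ρ κ a) ≠ 0 := (hX.ball_pos a.2 _ hs).ne'
  have ht' : μ (cell ρ κ a) ≠ ∞ := (hX.ball_lt_top a.2 _ hs).ne
  rw [← div_eq_mul_inv, ENNReal.le_div_iff_mul_le (Or.inl h0') (Or.inl ht'), mul_comm,
    ← div_eq_mul_inv]
  exact ENNReal.div_le_of_le_mul h

/-- The constant of the almost orthogonality of test functions. -/
noncomputable def schurConst (K : ℝ) (A : ℝ≥0) : ℝ≥0 :=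
  let c := doublingFactor A (2 * K)
  let d := doublingFactor A (K * (4 * K ^ 2 + 1))
  c * (c * d) + c * (d * (c * d))

/-- Only net points near `a`, relative to the coarser of the two scales, contribute. If `l` is the
finer scale, the cells near `a` have total measure at most a multiple of that of the cell of `a`,
which cancels the normalization. If `l` is the coarser scale, the normalization cancels term by term
and the number of nearby net points is bounded. -/
lemma IsHomogeneousType.tsum_scale_le (hX : IsHomogeneousType ρ μ K A) (hκ : 1 < κ)
    (hω : IsModulus ω) (hΦ : 0 ≤ Φ) (hZ : ∀ k, IsNet ρ (κ ^ k) (Z k))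
    {φ : NetIndex Z → X → ℝ} (hφ : IsTestFamily ρ μ κ ω Φ φ) (a : NetIndex Z) (l : ℤ) :
    ∑' z : Z l, μ (cell ρ κ (⟨l, z⟩ : NetIndex Z)) * ‖∫ w, φ a w * φ ⟨l, z⟩ w ∂μ‖ₑ ≤
      schurConst K A * (ENNReal.ofReal Φ * ENNReal.ofReal (ω (κ⁻¹ ^ (a.1 - l).natAbs))) := by
  have hκ0 := one_pos.trans hκ
  have hK := hX.quasiMetric.pos
  set c := doublingFactor A (2 * K)
  set d := doublingFactor A (K * (4 * K ^ 2 + 1))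
  set E := ENNReal.ofReal Φ * ENNReal.ofReal (ω (κ⁻¹ ^ (a.1 - l).natAbs)) with hE
  have hsa : (0 : ℝ) < κ ^ a.1 := zpow_pos hκ0 _
  have hsl : (0 : ℝ) < κ ^ l := zpow_pos hκ0 _
  have hpos : μ (cell ρ κ a) ≠ 0 := (hX.ball_pos _ _ hsa).ne'
  have hfin : μ (cell ρ κ a) ≠ ∞ := (hX.ball_lt_top _ _ hsa).ne
  obtain ⟨y, hy, hφa⟩ := hφ a
  -- Both supports lie in `2K`-dilates, so overlapping supports force a distance below `K * (2K +
  -- 2K) * s`.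
  have hfar : ∀ z : Z l, ∀ s : ℝ, κ ^ a.1 ≤ s → κ ^ l ≤ s → ¬ ρ a.2 z < 4 * K ^ 2 * s →
      ∫ w, φ a w * φ ⟨l, z⟩ w ∂μ = 0 := by
    intro z s h1 h2 h
    have : ∀ w, φ a w * φ ⟨l, z⟩ w = 0 := by
      intro w
      by_contra hne
      have hwa := hφ.support_subset hX a (left_ne_zero_of_mul hne)
      have hwb := hφ.support_subset hX ⟨l, z⟩ (right_ne_zero_of_mul hne)
      apply h
      simp only [dilate, qball, mem_ofPred_eq] at hwa hwb
      rw [hX.quasiMetric.symm] at hwb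
      refine (hX.quasiMetric.triangle_lt (le_of_lt hwa) hwb).trans_le ?_
      have : K * (2 * K * κ ^ a.1 + 2 * K * κ ^ l) ≤ K * (2 * K * s + 2 * K * s) := by gcongr
      refine this.trans (le_of_eq (by ring))
    simp [this]
  rcases le_or_gt l a.1 with hl | hl
  · calc ∑' z : Z l, μ (cell ρ κ (⟨l, z⟩ : NetIndex Z)) * ‖∫ w, φ a w * φ ⟨l, z⟩ w ∂μ‖ₑ
        ≤ ∑' z : Z l, (c * (μ (cell ρ κ a))⁻¹ * E) *
          (if ρ a.2 z < 4 * K ^ 2 * κ ^ a.1 then μ (qball ρ (z : X) (κ ^ l)) else 0) := by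
          refine ENNReal.tsum_le_tsum fun z => ?_
          split_ifs with h
          · rw [mul_comm]
            refine mul_le_mul' ?_ le_rfl
            obtain ⟨y', hy', hφb⟩ := hφ ⟨l, z⟩
            refine (hX.enorm_integral_mul_le hκ hω hΦ hφa hφb hl).trans ?_
            gcongr
            exact hX.inv_ball_le_inv_cell hκ a hy
          · rw [hfar z (κ ^ a.1) le_rfl (zpow_le_zpow_right₀ hκ.le hl) h]
            simp
      _ ≤ (c * (μ (cell ρ κ a))⁻¹ * E) * (c * (d * μ (cell ρ κ a))) := by
          rw [ENNReal.tsum_mul_left]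
          gcongr
          refine (hX.packing hsl (hZ l) _ _).trans ?_
          gcongr
          refine (measure_mono (qball_mono _ ?_)).trans
            (hX.measure_ball_mul_le _ hsa (K * (4 * K ^ 2 + 1)))
          rw [mul_assoc K]
          refine mul_le_mul_of_nonneg_left ?_ hK.le
          have := zpow_le_zpow_right₀ hκ.le hl
          linarith
      _ = (c * (c * d)) * E * ((μ (cell ρ κ a))⁻¹ * μ (cell ρ κ a)) := by ring
      _ = (c * (c * d)) * E := by rw [ENNReal.inv_mul_cancel hpos hfin, mul_one]
      _ ≤ _ := by
          refine mul_le_mul' ?_ le_rfl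
          rw [schurConst]
          push_cast
          exact le_self_add
  · calc ∑' z : Z l, μ (cell ρ κ (⟨l, z⟩ : NetIndex Z)) * ‖∫ w, φ a w * φ ⟨l, z⟩ w ∂μ‖ₑ
        ≤ ∑' z : Z l, (c * E) * (if ρ a.2 z < 4 * K ^ 2 * κ ^ l then 1 else 0) := by
          refine ENNReal.tsum_le_tsum fun z => ?_
          split_ifs with h
          · obtain ⟨y', hy', hφb⟩ := hφ ⟨l, z⟩
            have h1 := hX.enorm_integral_mul_le hκ hω hΦ hφb hφa hl.le
            have h2 := hX.inv_ball_le_inv_cell hκ ⟨l, z⟩ hy'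
            simp_rw [mul_comm (φ ⟨l, z⟩ _)] at h1
            rw [← neg_sub, Int.natAbs_neg, ← hE] at h1
            have hposb : μ (cell ρ κ (⟨l, z⟩ : NetIndex Z)) ≠ 0 := (hX.ball_pos _ _ hsl).ne'
            have hfinb : μ (cell ρ κ (⟨l, z⟩ : NetIndex Z)) ≠ ∞ := (hX.ball_lt_top _ _ hsl).ne
            calc _ ≤ μ (cell ρ κ (⟨l, z⟩ : NetIndex Z)) *
                  (c * (μ (cell ρ κ (⟨l, z⟩ : NetIndex Z)))⁻¹ * E) := by
                    gcongr
                    exact h1.trans (by gcongr)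
              _ = c * E * ((μ (cell ρ κ (⟨l, z⟩ : NetIndex Z)))⁻¹ *
                  μ (cell ρ κ (⟨l, z⟩ : NetIndex Z))) := by ring
              _ = _ := by rw [ENNReal.inv_mul_cancel hposb hfinb]
          · rw [hfar z (κ ^ l) (zpow_le_zpow_right₀ hκ.le hl.le) le_rfl h]
            simp
      _ ≤ (c * E) * (d * (c * d)) := by
          rw [ENNReal.tsum_mul_left]
          gcongr
          exact hX.net_count hsl (hZ l) _ _
      _ = (c * (d * (c * d))) * E := by ring
      _ ≤ _ := by
          refine mul_le_mul' ?_ le_rfl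
          rw [schurConst]
          push_cast
          exact le_add_self

/-- Almost orthogonality of test functions, in the form of Schur's test. -/
lemma IsHomogeneousType.schur (hX : IsHomogeneousType ρ μ K A) (hκ : 1 < κ)
    (hω : IsModulus ω) (hΦ : 0 ≤ Φ) (hZ : ∀ k, IsNet ρ (κ ^ k) (Z k))
    {φ : NetIndex Z → X → ℝ} (hφ : IsTestFamily ρ μ κ ω Φ φ) (a : NetIndex Z) :
    ∑' b : NetIndex Z, μ (cell ρ κ b) * ‖∫ w, φ a w * φ b w ∂μ‖ₑ ≤
      schurConst K A * (ENNReal.ofReal Φ * (2 * (diniConst κ * diniNorm ω))) := by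
  rw [ENNReal.tsum_sigma']
  refine (ENNReal.tsum_le_tsum fun l => hX.tsum_scale_le hκ hω hΦ hZ hφ a l).trans ?_
  rw [ENNReal.tsum_mul_left, ENNReal.tsum_mul_left]
  gcongr
  exact hω.tsum_int_le_diniNorm hκ a.1

end Schur

/-! ### Bessel inequalities, unweighted and weighted -/

section Bessel

/-- Bessel's inequality under the hypothesis of Schur's test. -/
lemma sum_mul_norm_inner_sq_le {E ι : Type*} [NormedAddCommGroup E] [InnerProductSpace ℂ E]
    (T : Finset ι) (m : ι → ℝ) (hm : ∀ a, 0 ≤ m a) (x : ι → E) {Λ : ℝ}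
    (hΛ0 : 0 ≤ Λ)     (hΛ : ∀ a ∈ T, ∑ b ∈ T, m b * ‖inner ℂ (x a) (x b)‖ ≤ Λ) (F : E) :
    ∑ a ∈ T, m a * ‖inner ℂ (x a) F‖ ^ 2 ≤ Λ * ‖F‖ ^ 2 := by
  set u : ι → ℂ := fun a => inner ℂ (x a) F with hu
  set S := ∑ a ∈ T, m a * ‖u a‖ ^ 2 with hS
  -- The dual vector: `⟪y, F⟫ = S`, while Schur's hypothesis yields `‖y‖ ^ 2 ≤ Λ * S`;
  -- Cauchy–Schwarz then gives `S ^ 2 ≤ Λ * S * ‖F‖ ^ 2`.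
  set y : E := ∑ a ∈ T, ((m a : ℂ) * u a) • x a with hy
  have hS0 : 0 ≤ S := Finset.sum_nonneg fun a _ => mul_nonneg (hm a) (sq_nonneg _)
  have hyF : inner ℂ y F = (S : ℂ) := by
    rw [hy, sum_inner, hS]
    push_cast
    refine Finset.sum_congr rfl fun a _ => ?_
    rw [inner_smul_left, map_mul, Complex.conj_ofReal, mul_assoc]
    congr 1
    rw [mul_comm, Complex.mul_conj, Complex.normSq_eq_norm_sq]
    push_cast
    rfl
  have h1 : S ≤ ‖y‖ * ‖F‖ := by
    have := norm_inner_le_norm (𝕜 := ℂ) y F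
    rwa [hyF, Complex.norm_real, Real.norm_of_nonneg hS0] at this
  have h2 : ‖y‖ ^ 2 ≤ Λ * S := by
    have e1 : ‖y‖ ^ 2 = ‖(inner ℂ y y : ℂ)‖ := by
      rw [inner_self_eq_norm_sq_to_K]; simp
    have e2 : ‖(inner ℂ y y : ℂ)‖ ≤
        ∑ a ∈ T, ∑ b ∈ T, m a * m b * (‖u a‖ * ‖u b‖) * ‖inner ℂ (x a) (x b)‖ := by
      conv_lhs => rw [hy, sum_inner]
      refine (norm_sum_le _ _).trans (Finset.sum_le_sum fun a _ => ?_)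
      rw [inner_sum]
      refine (norm_sum_le _ _).trans (Finset.sum_le_sum fun b _ => le_of_eq ?_)
      rw [inner_smul_left, inner_smul_right]
      simp only [norm_mul, RCLike.norm_conj, Complex.norm_real, Real.norm_of_nonneg (hm _)]
      ring
    -- The product `‖u a‖ * ‖u b‖` is split symmetrically into squares, so that each half becomes a
    -- Schur sum after exchanging `a` and `b`.
    have e3 : ∑ a ∈ T, ∑ b ∈ T, m a * m b * (‖u a‖ * ‖u b‖) * ‖inner ℂ (x a) (x b)‖ ≤
        ∑ a ∈ T, ∑ b ∈ T, (m a * m b * ‖u a‖ ^ 2 * ‖inner ℂ (x a) (x b)‖ / 2 +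
          m b * m a * ‖u b‖ ^ 2 * ‖inner ℂ (x b) (x a)‖ / 2) := by
      refine Finset.sum_le_sum fun a _ => Finset.sum_le_sum fun b _ => ?_
      rw [norm_inner_symm (x b) (x a)]
      have h := two_mul_le_add_sq ‖u a‖ ‖u b‖
      have hc : 0 ≤ m a * m b * ‖inner ℂ (x a) (x b)‖ :=
        mul_nonneg (mul_nonneg (hm a) (hm b)) (norm_nonneg _)
      nlinarith
    have e4 : ∑ a ∈ T, ∑ b ∈ T, (m a * m b * ‖u a‖ ^ 2 * ‖inner ℂ (x a) (x b)‖ / 2 +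
          m b * m a * ‖u b‖ ^ 2 * ‖inner ℂ (x b) (x a)‖ / 2) =
        ∑ a ∈ T, m a * ‖u a‖ ^ 2 * ∑ b ∈ T, m b * ‖inner ℂ (x a) (x b)‖ := by
      simp_rw [Finset.sum_add_distrib]
      rw [Finset.sum_comm (f := fun a b => m b * m a * ‖u b‖ ^ 2 * ‖inner ℂ (x b) (x a)‖ / 2),
        ← Finset.sum_add_distrib]
      refine Finset.sum_congr rfl fun a _ => ?_
      rw [← Finset.sum_add_distrib, Finset.mul_sum]
      exact Finset.sum_congr rfl fun b _ => by ring
    have e5 : ∑ a ∈ T, m a * ‖u a‖ ^ 2 * ∑ b ∈ T, m b * ‖inner ℂ (x a) (x b)‖ ≤ Λ * S := by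
      rw [hS, Finset.mul_sum]
      refine Finset.sum_le_sum fun a ha => ?_
      rw [mul_comm Λ]
      exact mul_le_mul_of_nonneg_left (hΛ a ha) (mul_nonneg (hm a) (sq_nonneg _))
    rw [e1]
    exact e2.trans (e3.trans (e4.le.trans e5))
  rcases hS0.eq_or_lt with h0 | h0
  · rw [← h0]; positivity
  · have h3 : S ^ 2 ≤ ‖y‖ ^ 2 * ‖F‖ ^ 2 := by
      rw [← mul_pow]; exact pow_le_pow_left₀ hS0 h1 2
    have h4 : S ^ 2 ≤ Λ * S * ‖F‖ ^ 2 := h3.trans (mul_le_mul_of_nonneg_right h2 (sq_nonneg _))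
    have h5 : S * S ≤ S * (Λ * ‖F‖ ^ 2) := by nlinarith
    exact le_of_mul_le_mul_left h5 h0

variable {X ι : Type*} [MeasurableSpace X] {μ : Measure X}

/-- The Hilbert space inequality in `L²`. The convention `0 * ∞ = 0` makes the degenerate cases real
claims: for `Λ = 0` every test function of `T` vanishes almost everywhere, and for `∫ |f|² = 0` so
does `f`. -/
lemma sum_mul_enorm_integral_sq_le (T : Finset ι) (m : ι → ℝ≥0) (hm : ∀ a, m a ≠ 0)
    {φ : ι → X → ℝ} (hφ : ∀ a, MemLp (φ a) 2 μ) {Λ : ℝ≥0∞}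
    (hΛ : ∀ a ∈ T, ∑ b ∈ T, (m b : ℝ≥0∞) * ‖∫ x, φ a x * φ b x ∂μ‖ₑ ≤ Λ) {f : X → ℂ}
    (hf : AEStronglyMeasurable f μ) :
    ∑ a ∈ T, (m a : ℝ≥0∞) * ‖∫ x, f x * (φ a x : ℂ) ∂μ‖ₑ ^ 2 ≤ Λ * ∫⁻ x, ‖f x‖ₑ ^ 2 ∂μ := by
  rcases eq_or_ne Λ 0 with rfl | hΛ0
  · refine le_trans (le_of_eq (Finset.sum_eq_zero fun a ha => ?_)) zero_le
    have h1 := (Finset.sum_eq_zero_iff.1 (le_zero_iff.1 (hΛ a ha))) a ha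
    have h2 : ∫ x, φ a x * φ a x ∂μ = 0 := by simpa [hm a] using h1
    have h3 : (fun x => φ a x * φ a x) =ᵐ[μ] 0 :=
      (integral_eq_zero_iff_of_nonneg (fun x => mul_self_nonneg _)
        (MemLp.integrable_mul (hφ a) (hφ a))).1 h2
    have h4 : (fun x => f x * (φ a x : ℂ)) =ᵐ[μ] 0 := by
      filter_upwards [h3] with x hx
      have : φ a x = 0 := by simpa using hx
      simp [this]
    rw [integral_congr_ae h4]
    simp
  rcases eq_or_ne (∫⁻ x, ‖f x‖ₑ ^ 2 ∂μ) ∞ with hinf | hfin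
  · rw [hinf, ENNReal.mul_top hΛ0]; exact le_top
  rcases eq_or_ne (∫⁻ x, ‖f x‖ₑ ^ 2 ∂μ) 0 with h0 | hne
  · refine le_trans (le_of_eq (Finset.sum_eq_zero fun a ha => ?_)) zero_le
    have h1 := (lintegral_eq_zero_iff' (hf.enorm.pow_const 2)).1 h0
    have h4 : (fun x => f x * (φ a x : ℂ)) =ᵐ[μ] 0 := by
      filter_upwards [h1] with x hx
      have : f x = 0 := by simpa using hx
      simp [this]
    rw [integral_congr_ae h4]
    simp
  rcases eq_or_ne Λ ∞ with rfl | hΛt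
  · rw [ENNReal.top_mul hne]; exact le_top
  have hfL : MemLp f 2 μ := by
    refine ⟨hf, ?_⟩
    rw [eLpNorm_lt_top_iff_lintegral_rpow_enorm_lt_top (by norm_num) (by norm_num)]
    simpa using lt_top_iff_ne_top.2 hfin
  have hφL : ∀ a, MemLp (fun x => (φ a x : ℂ)) 2 μ := fun a => (hφ a).ofReal
  set F := hfL.toLp f
  set x : ι → Lp ℂ 2 μ := fun a => (hφL a).toLp _
  have hin : ∀ a b, (inner ℂ (x a) (x b) : ℂ) = ((∫ y, φ a y * φ b y ∂μ : ℝ) : ℂ) := by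
    intro a b
    rw [L2.inner_def, ← integral_complex_ofReal]
    refine integral_congr_ae ?_
    filter_upwards [(hφL a).coeFn_toLp, (hφL b).coeFn_toLp] with y ha hb
    rw [ha, hb]
    simp [mul_comm]
  have hinF : ∀ a, (inner ℂ (x a) F : ℂ) = ∫ y, f y * (φ a y : ℂ) ∂μ := by
    intro a
    rw [L2.inner_def]
    refine integral_congr_ae ?_
    filter_upwards [(hφL a).coeFn_toLp, hfL.coeFn_toLp] with y ha hb
    rw [ha, hb]
    simp
  have hF : ENNReal.ofReal (‖F‖ ^ 2) = ∫⁻ x, ‖f x‖ₑ ^ 2 ∂μ := by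
    rw [ENNReal.ofReal_pow (norm_nonneg _), ofReal_norm, Lp.enorm_toLp,
      eLpNorm_eq_lintegral_rpow_enorm_toReal (by norm_num) (by norm_num), ← ENNReal.rpow_natCast,
      ← ENNReal.rpow_mul]
    simp
  have key := sum_mul_norm_inner_sq_le T (fun a => (m a : ℝ)) (fun a => (m a).coe_nonneg) x
    (Λ := Λ.toReal) ENNReal.toReal_nonneg (fun a ha => by
      rw [← ENNReal.ofReal_le_iff_le_toReal hΛt, ENNReal.ofReal_sum_of_nonneg
        (fun b _ => mul_nonneg (m b).coe_nonneg (norm_nonneg _))]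
      refine le_trans (le_of_eq (Finset.sum_congr rfl fun b _ => ?_)) (hΛ a ha)
      rw [ENNReal.ofReal_mul (m b).coe_nonneg, hin, ofReal_norm]
      simp [enorm_eq_nnnorm]) F
  have key' := ENNReal.ofReal_le_ofReal key
  rw [ENNReal.ofReal_mul ENNReal.toReal_nonneg, hF, ENNReal.ofReal_toReal hΛt,
    ENNReal.ofReal_sum_of_nonneg (fun b _ => mul_nonneg (m b).coe_nonneg (sq_nonneg _))] at key'
  refine le_trans (le_of_eq (Finset.sum_congr rfl fun b _ => ?_)) key'
  rw [ENNReal.ofReal_mul (m b).coe_nonneg, ENNReal.ofReal_pow (norm_nonneg _), hinF, ofReal_norm]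
  simp

lemma lintegral_ite_ofReal_lt (c : ℝ≥0∞) :
    ∫⁻ t in Ioi (0 : ℝ), (if ENNReal.ofReal t < c then 1 else 0) = c := by
  have h : ∀ t : ℝ, (if ENNReal.ofReal t < c then 1 else 0 : ℝ≥0∞) =
      {t : ℝ | ENNReal.ofReal t < c}.indicator 1 t := fun t => by
    by_cases h : ENNReal.ofReal t < c <;> simp [h]
  simp_rw [h]
  rw [lintegral_indicator_one (measurableSet_lt (by fun_prop) measurable_const),
    Measure.restrict_apply (measurableSet_lt (by fun_prop) measurable_const)]
  rcases eq_or_ne c ∞ with rfl | hc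
  · simp
  · have : {t : ℝ | ENNReal.ofReal t < c} ∩ Ioi 0 = Ioo 0 c.toReal := by
      ext t
      simp only [mem_inter_iff, mem_ofPred_eq, mem_Ioi, mem_Ioo]
      constructor
      · rintro ⟨h1, h2⟩
        exact ⟨h2, (ENNReal.ofReal_lt_iff_lt_toReal h2.le hc).1 h1⟩
      · rintro ⟨h1, h2⟩
        exact ⟨(ENNReal.ofReal_lt_iff_lt_toReal h1.le hc).2 h2, h1⟩
    rw [this, Real.volume_Ioo, sub_zero, ENNReal.ofReal_toReal hc]

/-- A weighted Bessel inequality, from the unweighted one by integration over the level sets of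
the weight. -/
lemma sum_mul_weight_mul_enorm_integral_sq_le [SFinite μ] (T : Finset ι) (m : ι → ℝ≥0)
    (hm : ∀ a, m a ≠ 0) {φ : ι → X → ℝ} (hφ : ∀ a, MemLp (φ a) 2 μ) {Λ : ℝ≥0∞}
    (hΛ : ∀ a ∈ T, ∑ b ∈ T, (m b : ℝ≥0∞) * ‖∫ x, φ a x * φ b x ∂μ‖ₑ ≤ Λ) {f : X → ℂ}
    (hf : AEStronglyMeasurable f μ) (W : ι → ℝ≥0∞) {h : X → ℝ≥0∞} (hh : Measurable h)
    (hW : ∀ a ∈ T, ∀ x, φ a x ≠ 0 → W a ≤ h x) :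
    ∑ a ∈ T, W a * ((m a : ℝ≥0∞) * ‖∫ x, f x * (φ a x : ℂ) ∂μ‖ₑ ^ 2) ≤
      Λ * ∫⁻ x, ‖f x‖ₑ ^ 2 * h x ∂μ := by
  -- For an index with `W a > t` the function `φ a` lives in `{h > t}`, so `f` may be cut off to
  -- that set before Bessel's inequality is applied to those indices.
  have hlevel : ∀ t : ℝ, ∑ a ∈ T, (if ENNReal.ofReal t < W a then 1 else 0) *
      ((m a : ℝ≥0∞) * ‖∫ x, f x * (φ a x : ℂ) ∂μ‖ₑ ^ 2) ≤
      Λ * ∫⁻ x, ‖f x‖ₑ ^ 2 * (if ENNReal.ofReal t < h x then 1 else 0) ∂μ := by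
    intro t
    have hE : MeasurableSet {x | ENNReal.ofReal t < h x} := measurableSet_lt measurable_const hh
    set E := {x | ENNReal.ofReal t < h x}
    have key := sum_mul_enorm_integral_sq_le (μ := μ) (T.filter fun a => ENNReal.ofReal t < W a)
      m hm hφ (Λ := Λ) (fun a ha => (Finset.sum_le_sum_of_subset (Finset.filter_subset _ _)).trans
        (hΛ a (Finset.mem_filter.1 ha).1)) (hf.indicator hE)
    rw [Finset.sum_filter] at key
    refine le_trans (Finset.sum_le_sum fun a ha => ?_) (key.trans (le_of_eq ?_))
    · split_ifs with hlt
      · rw [one_mul]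
        refine le_of_eq ?_
        congr 4
        funext x
        by_cases hx : φ a x = 0
        · simp [hx]
        · rw [indicator_of_mem (show x ∈ E from hlt.trans_le (hW a ha x hx))]
      · simp
    · congr 1
      refine lintegral_congr fun x => ?_
      by_cases hx : x ∈ E
      · rw [indicator_of_mem hx, if_pos (show _ < _ from hx), mul_one]
      · rw [indicator_of_notMem hx, if_neg (show ¬ _ < _ from hx), mul_zero]
        simp
  calc ∑ a ∈ T, W a * ((m a : ℝ≥0∞) * ‖∫ x, f x * (φ a x : ℂ) ∂μ‖ₑ ^ 2)
      = ∫⁻ t in Ioi (0 : ℝ), ∑ a ∈ T, (if ENNReal.ofReal t < W a then 1 else 0) *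
        ((m a : ℝ≥0∞) * ‖∫ x, f x * (φ a x : ℂ) ∂μ‖ₑ ^ 2) := by
        have hmeas : ∀ a, Measurable fun t : ℝ => (if ENNReal.ofReal t < W a then 1 else 0 : ℝ≥0∞) :=
          fun a => Measurable.ite (measurableSet_lt (by fun_prop) measurable_const)
            measurable_const measurable_const
        rw [lintegral_finsetSum _ fun a _ => (hmeas a).mul_const _]
        refine Finset.sum_congr rfl fun a _ => ?_
        rw [lintegral_mul_const _ (hmeas a), lintegral_ite_ofReal_lt]
    _ ≤ ∫⁻ t in Ioi (0 : ℝ),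
          Λ * ∫⁻ x, ‖f x‖ₑ ^ 2 * (if ENNReal.ofReal t < h x then 1 else 0) ∂μ :=
        lintegral_mono hlevel
    _ = Λ * ∫⁻ x, ‖f x‖ₑ ^ 2 * h x ∂μ := by
        have hset : MeasurableSet {p : ℝ × X | ENNReal.ofReal p.1 < h p.2} :=
          measurableSet_lt (by fun_prop) (hh.comp measurable_snd)
        have hj : Measurable fun p : ℝ × X =>
            (if ENNReal.ofReal p.1 < h p.2 then 1 else 0 : ℝ≥0∞) :=
          Measurable.ite hset measurable_const measurable_const
        have hjoint : AEMeasurable (fun p : ℝ × X =>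
            ‖f p.2‖ₑ ^ 2 * (if ENNReal.ofReal p.1 < h p.2 then 1 else 0 : ℝ≥0∞))
            ((volume.restrict (Ioi (0 : ℝ))).prod μ) :=
          ((hf.enorm.pow_const 2).comp_quasiMeasurePreserving
            Measure.quasiMeasurePreserving_snd).mul hj.aemeasurable
        have hswap := lintegral_lintegral_swap (μ := volume.restrict (Ioi (0 : ℝ))) (ν := μ)
          (f := fun t x => ‖f x‖ₑ ^ 2 * (if ENNReal.ofReal t < h x then 1 else 0)) hjoint
        rw [lintegral_const_mul'' _ hjoint.lintegral_prod_right', hswap]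
        congr 1
        refine lintegral_congr fun x => ?_
        rw [lintegral_const_mul' _ _ (by simp), lintegral_ite_ofReal_lt]

end Bessel

/-! ### Discretization of the square function -/

section Dilate

variable {X : Type*} {ρ : X → X → ℝ} {κ : ℝ} {Z : ℤ → Set X}

lemma scale_pos {κ : ℝ} (hκ : 1 < κ) (k : ℤ) : (0 : ℝ) < κ ^ k := zpow_pos (one_pos.trans hκ) k

lemma dilate_mono (hκ : 1 < κ) {L L' : ℝ} (h : L ≤ L') (a : NetIndex Z) :
    dilate ρ κ L a ⊆ dilate ρ κ L' a :=
  qball_mono _ (mul_le_mul_of_nonneg_right h (scale_pos hκ _).le)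

end Dilate

section Discrete

variable {X : Type*} [MeasurableSpace X] {ρ : X → X → ℝ} {μ : Measure X} {K : ℝ} {A : ℝ≥0}
  {κ Φ β : ℝ} {ω : ℝ → ℝ} {Z : ℤ → Set X}

lemma IsHomogeneousType.cell_ne_zero (hX : IsHomogeneousType ρ μ K A) (hκ : 1 < κ)
    (a : NetIndex Z) : μ (cell ρ κ a) ≠ 0 := (hX.ball_pos _ _ (scale_pos hκ _)).ne'

lemma IsHomogeneousType.cell_ne_top (hX : IsHomogeneousType ρ μ K A) (hκ : 1 < κ)
    (a : NetIndex Z) : μ (cell ρ κ a) ≠ ∞ := (hX.ball_lt_top _ _ (scale_pos hκ _)).ne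

lemma IsHomogeneousType.dilate_ne_zero (hX : IsHomogeneousType ρ μ K A) (hκ : 1 < κ)
    {L : ℝ} (hL : 0 < L) (a : NetIndex Z) : μ (dilate ρ κ L a) ≠ 0 :=
  (hX.ball_pos _ _ (mul_pos hL (scale_pos hκ _))).ne'

lemma IsHomogeneousType.dilate_ne_top (hX : IsHomogeneousType ρ μ K A) (hκ : 1 < κ)
    {L : ℝ} (hL : 0 < L) (a : NetIndex Z) : μ (dilate ρ κ L a) ≠ ∞ :=
  (hX.ball_lt_top _ _ (mul_pos hL (scale_pos hκ _))).ne

lemma IsHomogeneousType.measurableSet_dilate (hX : IsHomogeneousType ρ μ K A) (L : ℝ)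
    (a : NetIndex Z) : MeasurableSet (dilate ρ κ L a) := hX.measurableSet_ball _ _

/-- The supremum of `testSup` over the cell of a net point. -/
noncomputable def cellSup (ρ : X → X → ℝ) (μ : Measure X) (κ : ℝ) (ω : ℝ → ℝ) (Φ : ℝ)
    (f : X → ℂ) (a : NetIndex Z) : ℝ≥0∞ :=
  ⨆ y ∈ cell ρ κ a, testSup ρ μ κ ω Φ f y a.1

lemma memLp_two_of_mem_testClass {φ : X → ℝ} {x : X} {k : ℤ}
    (hφ : φ ∈ testClass ρ μ κ ω Φ x k) : MemLp φ 2 μ := by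
  rw [memLp_two_iff_integrable_sq hφ.2.1.1.aestronglyMeasurable]
  simp_rw [sq]
  exact Integrable.bdd_mul (c := (μ.real (qball ρ x (κ ^ k)))⁻¹ * Φ) hφ.2.1.1
    hφ.2.1.1.aestronglyMeasurable (Filter.Eventually.of_forall fun y => hφ.2.2.1 y)

lemma IsHomogeneousType.enorm_integral_mul_testClass_le (hX : IsHomogeneousType ρ μ K A)
    (hκ : 1 < κ) (f : X → ℂ) {a : NetIndex Z} {y : X} (hy : y ∈ cell ρ κ a) {φ : X → ℝ}
    (hφ : φ ∈ testClass ρ μ κ ω Φ y a.1) :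
    ‖∫ x, f x * (φ x : ℂ) ∂μ‖ₑ ≤ (doublingFactor A (2 * K) * (μ (cell ρ κ a))⁻¹) *
      ENNReal.ofReal Φ * ∫⁻ x in dilate ρ κ (2 * K) a, ‖f x‖ₑ ∂μ := by
  have hs := scale_pos hκ a.1
  have hsub : qball ρ y (κ ^ a.1) ⊆ dilate ρ κ (2 * K) a :=
    hX.quasiMetric.qball_subset (le_of_lt hy) (le_of_eq (by ring))
  have hm : MeasurableSet (dilate ρ κ (2 * K) a) := hX.measurableSet_ball _ _
  refine (enorm_integral_le_lintegral_enorm _).trans ?_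
  rw [← lintegral_const_mul' _ _ (by
    refine ENNReal.mul_ne_top (ENNReal.mul_ne_top ENNReal.coe_ne_top ?_) ENNReal.ofReal_ne_top
    exact ENNReal.inv_ne_top.2 (hX.cell_ne_zero hκ a)), ← lintegral_indicator hm]
  refine lintegral_mono fun x => ?_
  by_cases hx : φ x = 0
  · simp [hx]
  rw [indicator_of_mem (hsub (hφ.1 hx)), enorm_mul, mul_comm]
  gcongr
  calc ‖(φ x : ℂ)‖ₑ = ENNReal.ofReal |φ x| := by
        rw [← ofReal_norm, Complex.norm_real, Real.norm_eq_abs]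
    _ ≤ ENNReal.ofReal ((μ.real (qball ρ y (κ ^ a.1)))⁻¹ * Φ) :=
        ENNReal.ofReal_le_ofReal (hφ.2.2.1 x)
    _ = (μ (qball ρ y (κ ^ a.1)))⁻¹ * ENNReal.ofReal Φ := by
        rw [ENNReal.ofReal_mul (inv_nonneg.2 measureReal_nonneg), hX.ofReal_inv_real_ball y hs]
    _ ≤ _ := by
        gcongr
        exact hX.inv_ball_le_inv_cell hκ a hy

lemma IsHomogeneousType.cellSup_ne_top (hX : IsHomogeneousType ρ μ K A)
    (hκ : 1 < κ) {f : X → ℂ} (hf : LocInt ρ μ f) (a : NetIndex Z) :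
    cellSup ρ μ κ ω Φ f a ≠ ∞ := by
  refine ne_top_of_le_ne_top ?_ (iSup₂_le fun y hy => iSup₂_le fun φ hφ =>
    hX.enorm_integral_mul_testClass_le hκ f hy hφ)
  refine ENNReal.mul_ne_top (ENNReal.mul_ne_top (ENNReal.mul_ne_top ENNReal.coe_ne_top ?_)
    ENNReal.ofReal_ne_top) ?_
  · exact ENNReal.inv_ne_top.2 (hX.cell_ne_zero hκ a)
  · exact (hf _ _).2.ne

lemma zero_mem_testClass (hω : IsModulus ω) (hΦ : 0 ≤ Φ) (hκ : 1 < κ)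
    (hρ : IsQuasiMetric ρ K) (x : X) (k : ℤ) :
    (fun _ => 0) ∈ testClass ρ μ κ ω Φ x k := by
  have hs := scale_pos hκ k
  refine ⟨by simp [Function.support], ⟨integrable_zero _ _ _, by simp⟩, fun y => ?_,
    fun y y' => ?_⟩
  · have : 0 ≤ (μ.real (qball ρ x (κ ^ k)))⁻¹ := inv_nonneg.2 measureReal_nonneg
    simp only [abs_zero]; positivity
  · have : 0 ≤ (μ.real (qball ρ x (κ ^ k)))⁻¹ := inv_nonneg.2 measureReal_nonneg
    have := hω.nonneg _ (div_nonneg (hρ.nonneg y y') hs.le)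
    simp only [sub_zero, abs_zero]; positivity

/-- Test functions that realize half of the suprema over the cells. -/
lemma IsHomogeneousType.exists_testFamily (hX : IsHomogeneousType ρ μ K A)
    (hκ : 1 < κ) (hω : IsModulus ω) (hΦ : 0 ≤ Φ) {f : X → ℂ} (hf : LocInt ρ μ f) :
    ∃ φ : NetIndex Z → X → ℝ, IsTestFamily ρ μ κ ω Φ φ ∧
      ∀ a, cellSup ρ μ κ ω Φ f a ≤ 2 * ‖∫ x, f x * (φ a x : ℂ) ∂μ‖ₑ := by
  have key : ∀ a : NetIndex Z, ∃ φ : X → ℝ, (∃ y ∈ cell ρ κ a, φ ∈ testClass ρ μ κ ω Φ y a.1) ∧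
      cellSup ρ μ κ ω Φ f a ≤ 2 * ‖∫ x, f x * (φ x : ℂ) ∂μ‖ₑ := by
    intro a
    rcases eq_or_ne (cellSup ρ μ κ ω Φ f a) 0 with h0 | hne
    · exact ⟨fun _ => 0, ⟨a.2, hX.quasiMetric.mem_qball_self _ (scale_pos hκ _),
        zero_mem_testClass hω hΦ hκ hX.quasiMetric _ _⟩, by rw [h0]; exact zero_le⟩
    -- Half of a nonzero finite supremum is strictly below it, hence exceeded by some test function;
    -- finiteness is where local integrability of `f` enters.
    · have hlt := ENNReal.half_lt_self hne (hX.cellSup_ne_top hκ hf a)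
      conv_rhs at hlt => rw [cellSup]
      simp only [testSup, lt_iSup_iff] at hlt
      obtain ⟨y, hy, φ, hφ, h⟩ := hlt
      refine ⟨φ, ⟨y, hy, hφ⟩, ?_⟩
      rw [mul_comm]
      exact (ENNReal.div_le_iff_le_mul (Or.inl two_ne_zero) (Or.inl ENNReal.ofNat_ne_top)).1 h.le
  choose φ h1 h2 using key
  exact ⟨φ, h1, h2⟩

/-- The constant of the `L²` bounds. -/
noncomputable def squareConst (K : ℝ) (A : ℝ≥0) (κ : ℝ) : ℝ≥0 :=
  8 * schurConst K A * diniConst κ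

/-- The weighted `L²` bound for the discretized square function. -/
lemma IsHomogeneousType.sum_cellSup_sq_le (hX : IsHomogeneousType ρ μ K A)
    (hκ : 1 < κ) (hω : IsModulus ω) (hΦ : 0 ≤ Φ) (hZ : ∀ k, IsNet ρ (κ ^ k) (Z k))
    {f : X → ℂ} (hf : LocInt ρ μ f) (hfm : AEStronglyMeasurable f μ) (T : Finset (NetIndex Z))
    (W : NetIndex Z → ℝ≥0∞) {h : X → ℝ≥0∞} (hh : Measurable h)
    (hW : ∀ a ∈ T, ∀ x ∈ dilate ρ κ (2 * K) a, W a ≤ h x) :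
    ∑ a ∈ T, W a * (μ (cell ρ κ a) * cellSup ρ μ κ ω Φ f a ^ 2) ≤
      squareConst K A κ * (ENNReal.ofReal Φ * diniNorm ω) * ∫⁻ x, ‖f x‖ₑ ^ 2 * h x ∂μ := by
  have := hX.sigmaFinite
  obtain ⟨φ, hφ, hle⟩ := hX.exists_testFamily hκ hω hΦ hf (Z := Z)
  let m : NetIndex Z → ℝ≥0 := fun a => (μ (cell ρ κ a)).toNNReal
  have hm : ∀ a, (m a : ℝ≥0∞) = μ (cell ρ κ a) := fun a =>
    ENNReal.coe_toNNReal (hX.cell_ne_top hκ a)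
  have hm0 : ∀ a, m a ≠ 0 := fun a => by
    rw [← ENNReal.coe_ne_zero, hm]; exact hX.cell_ne_zero hκ a
  have hφ2 : ∀ a, MemLp (φ a) 2 μ := fun a => by
    obtain ⟨y, -, h⟩ := hφ a
    exact memLp_two_of_mem_testClass h
  have key := sum_mul_weight_mul_enorm_integral_sq_le T m hm0 hφ2
    (Λ := schurConst K A * (ENNReal.ofReal Φ * (2 * (diniConst κ * diniNorm ω))))
    (fun a _ => by
      refine le_trans ?_ (hX.schur hκ hω hΦ hZ hφ a)
      simp_rw [hm]
      exact ENNReal.sum_le_tsum T) hfm W hh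
    (fun a ha x hx => hW a ha x (hφ.support_subset hX a hx))
  calc ∑ a ∈ T, W a * (μ (cell ρ κ a) * cellSup ρ μ κ ω Φ f a ^ 2)
      ≤ ∑ a ∈ T, 4 * (W a * ((m a : ℝ≥0∞) * ‖∫ x, f x * (φ a x : ℂ) ∂μ‖ₑ ^ 2)) := by
        refine Finset.sum_le_sum fun a _ => ?_
        calc _ ≤ W a * (μ (cell ρ κ a) * (2 * ‖∫ x, f x * (φ a x : ℂ) ∂μ‖ₑ) ^ 2) := by
              gcongr; exact hle a
          _ = _ := by rw [hm]; ring
    _ ≤ 4 * (schurConst K A * (ENNReal.ofReal Φ * (2 * (diniConst κ * diniNorm ω))) *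
          ∫⁻ x, ‖f x‖ₑ ^ 2 * h x ∂μ) := by
        rw [← Finset.mul_sum]; gcongr
    _ = _ := by
        rw [squareConst]; push_cast; ring

/-- The weight of the index `a` in the discretized square function at `x`. -/
noncomputable def cellWeight (ρ : X → X → ℝ) (μ : Measure X) (κ L : ℝ) (a : NetIndex Z) :
    X → ℝ≥0∞ :=
  (dilate ρ κ L a).indicator fun _ => μ (cell ρ κ a) / μ (dilate ρ κ L a)

lemma IsHomogeneousType.measurable_cellWeight (hX : IsHomogeneousType ρ μ K A) (L : ℝ)
    (a : NetIndex Z) : Measurable (cellWeight ρ μ κ L a) :=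
  measurable_const.indicator (hX.measurableSet_ball _ _)

lemma IsHomogeneousType.lintegral_cellWeight (hX : IsHomogeneousType ρ μ K A) (L : ℝ)
    (a : NetIndex Z) (ν : Measure X) :
    ∫⁻ x, cellWeight ρ μ κ L a x ∂ν =
      ν (dilate ρ κ L a) / μ (dilate ρ κ L a) * μ (cell ρ κ a) := by
  rw [cellWeight, lintegral_indicator (hX.measurableSet_dilate L a), setLIntegral_const,
    div_eq_mul_inv, div_eq_mul_inv]
  ring

/-- The square function is dominated by its discretization. -/
lemma IsHomogeneousType.squareFunction_sq_le (hX : IsHomogeneousType ρ μ K A)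
    (hκ : 1 < κ) (hβ : 1 ≤ β) (hZ : ∀ k, IsNet ρ (κ ^ k) (Z k)) (f : X → ℂ) (x : X) :
    squareFunction ρ μ κ ω Φ β f x ^ 2 ≤ doublingFactor A (4 * K ^ 2) *
      ∑' a : NetIndex Z, cellWeight ρ μ κ (2 * K * β) a x * cellSup ρ μ κ ω Φ f a ^ 2 := by
  have hK := hX.quasiMetric.pos
  have hK1 := hX.quasiMetric.one_le
  have hβ0 := one_pos.trans_le hβ
  rw [squareFunction, ← ENNReal.rpow_natCast, ← ENNReal.rpow_mul]
  norm_num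
  rw [ENNReal.tsum_sigma', ← ENNReal.tsum_mul_left]
  refine ENNReal.tsum_le_tsum fun k => ?_
  have hs := scale_pos hκ k
  have : Countable (Z k) := (hX.countable_of_isNet hs (hZ k)).to_subtype
  set B := qball ρ x (β * κ ^ k) with hB
  have hBm : MeasurableSet B := hX.measurableSet_ball _ _
  have hr : 0 < β * κ ^ k := mul_pos hβ0 hs
  have hB0 : μ B ≠ 0 := (hX.ball_pos _ _ hr).ne'
  have hBt : μ B ≠ ∞ := (hX.ball_lt_top _ _ hr).ne
  let a : Z k → NetIndex Z := fun z => ⟨k, z⟩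
  have hcover : B ⊆ ⋃ z : Z k, B ∩ cell ρ κ (a z) := fun y hy => by
    obtain ⟨z, hz, hzy⟩ := (hZ k).covers y
    exact mem_iUnion.2 ⟨⟨z, hz⟩, hy, hzy⟩
  rw [setLAverage_eq, ENNReal.div_eq_inv_mul]
  calc (μ B)⁻¹ * ∫⁻ y in B, testSup ρ μ κ ω Φ f y k ^ 2 ∂μ
      ≤ (μ B)⁻¹ * ∑' z : Z k, ∫⁻ y in B ∩ cell ρ κ (a z), testSup ρ μ κ ω Φ f y k ^ 2 ∂μ := by
        gcongr
        exact (lintegral_mono_set hcover).trans (lintegral_iUnion_le _ _)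
    _ = ∑' z : Z k, (μ B)⁻¹ * ∫⁻ y in B ∩ cell ρ κ (a z), testSup ρ μ κ ω Φ f y k ^ 2 ∂μ :=
        ENNReal.tsum_mul_left.symm
    _ ≤ ∑' z : Z k, doublingFactor A (4 * K ^ 2) *
          (cellWeight ρ μ κ (2 * K * β) (a z) x * cellSup ρ μ κ ω Φ f (a z) ^ 2) := by
        refine ENNReal.tsum_le_tsum fun z => ?_
        have hcm : MeasurableSet (cell ρ κ (a z)) := hX.measurableSet_ball _ _
        rcases (B ∩ cell ρ κ (a z)).eq_empty_or_nonempty with he | ⟨y, hyB, hyc⟩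
        · rw [he]; simp
        -- A cell meeting `B(x, βκ ^ k)` has its centre within `K(1 + β)κ ^ k ≤ 2Kβκ ^ k` of `x`,
        -- since `β ≥ 1`.
        have hxD : x ∈ dilate ρ κ (2 * K * β) (a z) := by
          have hyB' : ρ y x < β * κ ^ k := by rw [hX.quasiMetric.symm]; exact hyB
          refine (hX.quasiMetric.triangle_lt (le_of_lt hyc) hyB').trans_le ?_
          have : κ ^ k ≤ β * κ ^ k := le_mul_of_one_le_left hs.le hβ
          calc K * (κ ^ k + β * κ ^ k) ≤ K * (β * κ ^ k + β * κ ^ k) := by gcongr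
            _ = 2 * K * β * κ ^ k := by ring
        have hint : ∫⁻ y in B ∩ cell ρ κ (a z), testSup ρ μ κ ω Φ f y k ^ 2 ∂μ ≤
            cellSup ρ μ κ ω Φ f (a z) ^ 2 * μ (cell ρ κ (a z)) := by
          calc _ ≤ ∫⁻ y in B ∩ cell ρ κ (a z), cellSup ρ μ κ ω Φ f (a z) ^ 2 ∂μ :=
                setLIntegral_mono' (hBm.inter hcm) fun y hy =>
                  pow_le_pow_left' (le_iSup₂ (f := fun y (_ : y ∈ cell ρ κ (a z)) =>
                    testSup ρ μ κ ω Φ f y k) y hy.2) 2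
            _ = cellSup ρ μ κ ω Φ f (a z) ^ 2 * μ (B ∩ cell ρ κ (a z)) := setLIntegral_const _ _
            _ ≤ _ := by gcongr; exact inter_subset_right
        -- The aperture `β` scales both balls, so their comparison costs a constant free of `β`.
        have hinv : (μ B)⁻¹ ≤ doublingFactor A (4 * K ^ 2) *
            (μ (dilate ρ κ (2 * K * β) (a z)))⁻¹ := by
          have hD0 := hX.dilate_ne_zero hκ (by positivity : 0 < 2 * K * β) (a z)
          have hDt := hX.dilate_ne_top hκ (by positivity : 0 < 2 * K * β) (a z)
          have h : μ (dilate ρ κ (2 * K * β) (a z)) ≤ doublingFactor A (4 * K ^ 2) * μ B := by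
            refine hX.measure_ball_le_of_dist hr (d := 2 * K * β * κ ^ k) ?_ (le_of_eq ?_)
            · rw [hX.quasiMetric.symm]; exact le_of_lt hxD
            · simp only [a]; ring
          rw [← div_eq_mul_inv, ENNReal.le_div_iff_mul_le (Or.inl hD0) (Or.inl hDt), mul_comm,
            ← div_eq_mul_inv]
          exact ENNReal.div_le_of_le_mul h
        rw [cellWeight, indicator_of_mem hxD]
        calc _ ≤ (doublingFactor A (4 * K ^ 2) * (μ (dilate ρ κ (2 * K * β) (a z)))⁻¹) *
              (cellSup ρ μ κ ω Φ f (a z) ^ 2 * μ (cell ρ κ (a z))) := mul_le_mul' hinv hint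
          _ = _ := by rw [div_eq_mul_inv]; ring
    _ = _ := by rw [ENNReal.tsum_mul_left]

end Discrete

/-! ### Measurable finite substitutes for the maximal function -/

section MaxWeight

variable {X : Type*} {ρ : X → X → ℝ} {κ : ℝ} {Z : ℤ → Set X}

/-- The largest of the numbers `W a` with `x` in the dilated cell of `a ∈ T`. -/
noncomputable def maxWeight (ρ : X → X → ℝ) (κ L : ℝ) (T : Finset (NetIndex Z))
    (W : NetIndex Z → ℝ≥0∞) (x : X) : ℝ≥0∞ :=
  ⨆ a ∈ T, (dilate ρ κ L a).indicator (fun _ => W a) x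

lemma le_maxWeight {L : ℝ} {T : Finset (NetIndex Z)} (W : NetIndex Z → ℝ≥0∞) {a : NetIndex Z}
    (ha : a ∈ T) {x : X} (hx : x ∈ dilate ρ κ L a) : W a ≤ maxWeight ρ κ L T W x :=
  le_iSup₂_of_le a ha (by rw [indicator_of_mem hx])

lemma maxWeight_le {L : ℝ} {T : Finset (NetIndex Z)} {W : NetIndex Z → ℝ≥0∞} {x : X} {c : ℝ≥0∞}
    (h : ∀ a ∈ T, x ∈ dilate ρ κ L a → W a ≤ c) : maxWeight ρ κ L T W x ≤ c := by
  refine iSup₂_le fun a ha => ?_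
  by_cases hx : x ∈ dilate ρ κ L a
  · rw [indicator_of_mem hx]; exact h a ha hx
  · rw [indicator_of_notMem hx]; exact zero_le

end MaxWeight

/-! ### The weighted `L²` estimate -/

section StrongType

variable {X : Type*} [MeasurableSpace X] {ρ : X → X → ℝ} {μ : Measure X} {K : ℝ} {A : ℝ≥0}
  {κ Φ β : ℝ} {ω : ℝ → ℝ} {Z : ℤ → Set X}

lemma IsQuasiMetric.exists_nets {X : Type*} {ρ : X → X → ℝ} {K : ℝ} (h : IsQuasiMetric ρ K)
    {κ : ℝ} (hκ : 1 < κ) : ∃ Z : ℤ → Set X, ∀ k, IsNet ρ (κ ^ k) (Z k) := by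
  choose Z hZ using fun k : ℤ => h.exists_isNet (scale_pos hκ k)
  exact ⟨Z, hZ⟩

lemma IsHomogeneousType.countable_netIndex (hX : IsHomogeneousType ρ μ K A) (hκ : 1 < κ)
    (hZ : ∀ k, IsNet ρ (κ ^ k) (Z k)) : Countable (NetIndex Z) := by
  have : ∀ k, Countable (Z k) := fun k =>
    (hX.countable_of_isNet (scale_pos hκ k) (hZ k)).to_subtype
  infer_instance

lemma LocInt.aestronglyMeasurable {E : Type*} [NormedAddCommGroup E] {f : X → E}
    (hf : LocInt ρ μ f) : AEStronglyMeasurable f μ := by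
  rcases isEmpty_or_nonempty X with hE | ⟨⟨x⟩⟩
  · rw [Measure.eq_zero_of_isEmpty μ]; exact aestronglyMeasurable_zero_measure f
  · have h : (⋃ n : ℕ, qball ρ x n) = univ := eq_univ_of_forall fun y => by
      obtain ⟨n, hn⟩ := exists_nat_gt (ρ x y)
      exact mem_iUnion.2 ⟨n, hn⟩
    have := (aestronglyMeasurable_iUnion_iff (μ := μ) (s := fun n : ℕ => qball ρ x n)
      (f := f)).2 fun n => (hf x n).1
    rwa [h, Measure.restrict_univ] at this

lemma lintegral_weightMeasure {v : X → ℝ} (hv : LocInt ρ μ v) {g : X → ℝ≥0∞}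
    (hg : Measurable g) :
    ∫⁻ x, g x ∂weightMeasure μ v = ∫⁻ x, g x * ENNReal.ofReal (v x) ∂μ := by
  rw [weightMeasure, lintegral_withDensity_eq_lintegral_mul₀
    hv.aestronglyMeasurable.aemeasurable.ennreal_ofReal hg.aemeasurable]
  exact lintegral_congr fun x => mul_comm _ _

/-- Averages of the weight over a ball are controlled by the maximal function. -/
lemma IsHomogeneousType.weight_div_le (hX : IsHomogeneousType ρ μ K A) {v : X → ℝ}
    (hv : ∀ x, 0 ≤ v x) (z : X) {r : ℝ} (hr : 0 < r) {x : X} (hx : x ∈ qball ρ z r) :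
    weightMeasure μ v (qball ρ z r) / μ (qball ρ z r) ≤ maximalFunction ρ μ v x := by
  refine le_trans (le_of_eq ?_) (le_iSup₂_of_le z r (le_iSup₂_of_le hr hx le_rfl))
  rw [setLAverage_eq, weightMeasure, withDensity_apply _ (hX.measurableSet_ball _ _)]
  congr 1
  exact lintegral_congr fun y => by rw [← ofReal_norm, Real.norm_of_nonneg (hv y)]

lemma IsHomogeneousType.measurable_maxWeight (hX : IsHomogeneousType ρ μ K A) (L : ℝ)
    (T : Finset (NetIndex Z)) (W : NetIndex Z → ℝ≥0∞) :
    Measurable (maxWeight ρ κ L T W) :=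
  Measurable.biSup _ T.countable_toSet fun a _ =>
    measurable_const.indicator (hX.measurableSet_dilate L a)

/-- The average of the measure `ν` over the dilated cell of `a`. -/
noncomputable def cellAverage (ρ : X → X → ℝ) (μ ν : Measure X) (κ L : ℝ) (a : NetIndex Z) :
    ℝ≥0∞ :=
  ν (dilate ρ κ L a) / μ (dilate ρ κ L a)

/-- The part of the discretized square function with indices in the finite set `T`. -/
noncomputable def partialSquare (ρ : X → X → ℝ) (μ : Measure X) (κ : ℝ) (ω : ℝ → ℝ)
    (Φ L : ℝ) (T : Finset (NetIndex Z)) (f : X → ℂ) (x : X) : ℝ≥0∞ :=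
  ∑ a ∈ T, cellWeight ρ μ κ L a x * cellSup ρ μ κ ω Φ f a ^ 2

lemma IsHomogeneousType.measurable_partialSquare (hX : IsHomogeneousType ρ μ K A) (L : ℝ)
    (T : Finset (NetIndex Z)) (f : X → ℂ) : Measurable (partialSquare ρ μ κ ω Φ L T f) :=
  Finset.measurable_fun_sum _ fun a _ => (hX.measurable_cellWeight L a).mul_const _

/-- Integrating the weight of a cell against `ν` produces the `ν`-average over the dilate times the
measure of the cell, which is the form of the weighted Bessel inequality. The measure `ν` is kept
general because the weak type estimate uses the weight restricted off the exceptional set. -/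
lemma IsHomogeneousType.lintegral_partialSquare_le (hX : IsHomogeneousType ρ μ K A)
    (hκ : 1 < κ) (hω : IsModulus ω) (hΦ : 0 ≤ Φ) (hZ : ∀ k, IsNet ρ (κ ^ k) (Z k))
    {f : X → ℂ} (hf : LocInt ρ μ f) (L : ℝ) (T : Finset (NetIndex Z)) (ν : Measure X) :
    ∫⁻ x, partialSquare ρ μ κ ω Φ L T f x ∂ν ≤
      squareConst K A κ * (ENNReal.ofReal Φ * diniNorm ω) *
        ∫⁻ x, ‖f x‖ₑ ^ 2 * maxWeight ρ κ (2 * K) T (cellAverage ρ μ ν κ L) x ∂μ := by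
  refine le_trans (le_of_eq ?_) (hX.sum_cellSup_sq_le hκ hω hΦ hZ hf hf.aestronglyMeasurable T
    (cellAverage ρ μ ν κ L) (hX.measurable_maxWeight _ T _)
    (fun a ha x hx => le_maxWeight _ ha hx))
  unfold partialSquare
  rw [lintegral_finsetSum _ fun a _ => (hX.measurable_cellWeight L a).mul_const _]
  refine Finset.sum_congr rfl fun a _ => ?_
  rw [lintegral_mul_const _ (hX.measurable_cellWeight L a), hX.lintegral_cellWeight, cellAverage]
  ring

/-- As `β ≥ 1`, the `2K`-dilate lies in the `2Kβ`-dilate, whose average of `v` competes in `Mv x`.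
The level set argument needs a measurable weight; the finite maximum is one, whereas `Mv` is an
uncountable supremum over balls that need not be open. -/
lemma IsHomogeneousType.maxWeight_le_maximalFunction (hX : IsHomogeneousType ρ μ K A)
    (hκ : 1 < κ) (hβ : 1 ≤ β) {v : X → ℝ} (hv : ∀ x, 0 ≤ v x) (T : Finset (NetIndex Z)) (x : X) :
    maxWeight ρ κ (2 * K) T (cellAverage ρ μ (weightMeasure μ v) κ (2 * K * β)) x ≤
      maximalFunction ρ μ v x := by
  have hK := hX.quasiMetric.pos
  have hβ0 := one_pos.trans_le hβ
  refine maxWeight_le fun a _ hx => ?_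
  exact hX.weight_div_le hv _ (mul_pos (by positivity) (scale_pos hκ _))
    (dilate_mono hκ (le_mul_of_one_le_right (by positivity) hβ) a hx)

/-- The weighted `L²` estimate of the square function. -/
lemma IsHomogeneousType.lintegral_squareFunction_sq_le (hX : IsHomogeneousType ρ μ K A)
    (hκ : 1 < κ) (hω : IsModulus ω) (hΦ : 0 ≤ Φ) (hβ : 1 ≤ β) {v : X → ℝ} (hv : ∀ x, 0 ≤ v x)
    (hvi : LocInt ρ μ v) {f : X → ℂ} (hf : LocInt ρ μ f) :
    ∫⁻ x, squareFunction ρ μ κ ω Φ β f x ^ 2 * ENNReal.ofReal (v x) ∂μ ≤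
      (doublingFactor A (4 * K ^ 2) * squareConst K A κ : ℝ≥0) *
        (ENNReal.ofReal Φ * diniNorm ω *
          ∫⁻ x, ‖f x‖ₑ ^ 2 * maximalFunction ρ μ v x ∂μ) := by
  obtain ⟨Z, hZ⟩ := hX.quasiMetric.exists_nets hκ
  have := hX.countable_netIndex hκ hZ
  have hmeas : ∀ a : NetIndex Z, Measurable fun x =>
      cellWeight ρ μ κ (2 * K * β) a x * cellSup ρ μ κ ω Φ f a ^ 2 := fun a =>
    (hX.measurable_cellWeight _ a).mul_const _
  calc ∫⁻ x, squareFunction ρ μ κ ω Φ β f x ^ 2 * ENNReal.ofReal (v x) ∂μ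
      ≤ ∫⁻ x, doublingFactor A (4 * K ^ 2) *
          ((∑' a : NetIndex Z, cellWeight ρ μ κ (2 * K * β) a x * cellSup ρ μ κ ω Φ f a ^ 2) *
            ENNReal.ofReal (v x)) ∂μ := by
        refine lintegral_mono fun x => ?_
        rw [← mul_assoc]
        gcongr
        exact hX.squareFunction_sq_le hκ hβ hZ f x
    _ = doublingFactor A (4 * K ^ 2) * ∑' a : NetIndex Z, ∫⁻ x,
          cellWeight ρ μ κ (2 * K * β) a x * cellSup ρ μ κ ω Φ f a ^ 2 ∂weightMeasure μ v := by
        rw [lintegral_const_mul' _ _ ENNReal.coe_ne_top,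
          ← lintegral_weightMeasure hvi (Measurable.tsum hmeas),
          lintegral_tsum fun a => (hmeas a).aemeasurable]
    _ ≤ doublingFactor A (4 * K ^ 2) * (squareConst K A κ * (ENNReal.ofReal Φ * diniNorm ω) *
          ∫⁻ x, ‖f x‖ₑ ^ 2 * maximalFunction ρ μ v x ∂μ) := by
        gcongr
        rw [ENNReal.tsum_eq_iSup_sum]
        refine iSup_le fun T => ?_
        rw [← lintegral_finsetSum _ fun a _ => hmeas a]
        refine (hX.lintegral_partialSquare_le hκ hω hΦ hZ hf _ T _).trans ?_
        gcongr with x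
        exact hX.maxWeight_le_maximalFunction hκ hβ hv T x
    _ = _ := by push_cast; ring

end StrongType

/-! ### Stopping balls -/

section Stopping

lemma exists_disjoint_refinement {X ι : Type*} [MeasurableSpace X] [Countable ι] {S : ι → Set X}
    (hS : ∀ i, MeasurableSet (S i)) :
    ∃ P : ι → Set X, (∀ i, P i ⊆ S i) ∧ (∀ i, MeasurableSet (P i)) ∧
      Pairwise (Function.onFun Disjoint P) ∧ ⋃ i, P i = ⋃ i, S i := by
  obtain ⟨e, he⟩ := exists_injective_nat ι
  refine ⟨fun i => S i \ ⋃ (j) (_ : e j < e i), S j, fun i => sdiff_subset, fun i =>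
    (hS i).diff (MeasurableSet.iUnion fun j => MeasurableSet.iUnion fun _ => hS j), ?_, ?_⟩
  · have key : ∀ i j, e i < e j → Disjoint (S i \ ⋃ (l) (_ : e l < e i), S l)
        (S j \ ⋃ (l) (_ : e l < e j), S l) := fun i j hij =>
      Set.disjoint_left.2 fun x hx hx' => hx'.2 (mem_iUnion₂.2 ⟨i, hij, hx.1⟩)
    intro i j hne
    rcases lt_or_gt_of_ne (he.ne hne) with h | h
    · exact key i j h
    · exact (key j i h).symm
  · refine subset_antisymm (iUnion_mono fun i => sdiff_subset) fun x hx => ?_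
    obtain ⟨i, hi⟩ := mem_iUnion.1 hx
    obtain ⟨j, hj, hmin⟩ := (InvImage.wf e Nat.lt_wfRel.wf).has_min {i | x ∈ S i} ⟨i, hi⟩
    refine mem_iUnion.2 ⟨j, hj, fun h => ?_⟩
    obtain ⟨l, hl, hx⟩ := mem_iUnion₂.1 h
    exact hmin l hx hl

variable {X : Type*} [MeasurableSpace X] {ρ : X → X → ℝ} {μ : Measure X} {K : ℝ} {A : ℝ≥0}

/-- The family of stopping balls of a Calderón–Zygmund decomposition of `f` at height `α`, with
radii at least `δ`. -/
structure StoppingBalls (ρ : X → X → ℝ) (μ : Measure X) (K : ℝ) (C : ℝ≥0) (f : X → ℂ) (δ : ℝ)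
    (α : ℝ≥0∞) (u : Set X) (r : X → ℝ) : Prop where
  le_radius : ∀ x, δ ≤ r x
  disjoint : u.PairwiseDisjoint fun x => qball ρ x (r x)
  covers : ∀ y, ∃ x ∈ u, y ∈ qball ρ x (4 * K * r x)
  mass_le : ∀ x, ∫⁻ y in qball ρ x (4 * K * r x), ‖f y‖ₑ ∂μ ≤ C * α * μ (qball ρ x (r x))
  stopping : ∀ x, r x = δ ∨ α * μ (qball ρ x (r x)) ≤ ∫⁻ y in qball ρ x (r x), ‖f y‖ₑ ∂μ

/-- The constant in the upper bound for the averages over stopping balls. -/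
noncomputable def stoppingConst (K : ℝ) (A : ℝ≥0) : ℝ≥0 := doublingFactor A (2 ^ (⌈4 * K⌉₊ + 1))

/-- At each point take the largest dyadic multiple of `δ` at which the average of `|f|` exceeds `α`;
such radii are bounded because large balls have small averages. A Vitali selection makes the balls
disjoint, and maximality of the radius bounds the mass on the enlarged ball. -/
lemma IsHomogeneousType.exists_stoppingBalls (hX : IsHomogeneousType ρ μ K A) (f : X → ℂ)
    {δ : ℝ} (hδ : 0 < δ) {α : ℝ≥0∞} {R : ℝ}
    (hR : ∀ x, ∀ r, R ≤ r → ∫⁻ y in qball ρ x r, ‖f y‖ₑ ∂μ ≤ α * μ (qball ρ x r)) :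
    ∃ u r, StoppingBalls ρ μ K (stoppingConst K A) f δ α u r := by
  classical
  have hK := hX.quasiMetric.pos
  have hK1 := hX.quasiMetric.one_le
  obtain ⟨N, hN⟩ : ∃ N : ℕ, R ≤ 2 ^ N * δ := by
    obtain ⟨N, hN⟩ := pow_unbounded_of_one_lt (R / δ) one_lt_two
    exact ⟨N, by rw [div_lt_iff₀ hδ] at hN; exact hN.le⟩
  let P : X → ℕ → Prop := fun x n =>
    α * μ (qball ρ x (2 ^ n * δ)) < ∫⁻ y in qball ρ x (2 ^ n * δ), ‖f y‖ₑ ∂μ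
  -- If no multiple qualifies, the value is `0` and the radius is `δ` with no lower bound on the
  -- average; this is the first alternative of `stopping`.
  let n : X → ℕ := fun x => Nat.findGreatest (P x) N
  let r : X → ℝ := fun x => 2 ^ n x * δ
  have hr : ∀ x, 0 < r x := fun x => by positivity
  have hgt : ∀ x m, n x < m → ¬ P x m := fun x m hm => by
    rcases le_or_gt m N with h | h
    · exact Nat.findGreatest_is_greatest hm h
    · refine not_lt.2 (hR x _ (hN.trans ?_))
      gcongr
      exact one_le_two
  obtain ⟨u, -, hd, hc⟩ := Vitali.exists_disjoint_subfamily_covering_enlargement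
    (fun x => qball ρ x (r x)) univ r 2 one_lt_two (fun x _ => (hr x).le) (2 ^ N * δ)
    (fun x _ => by
      change 2 ^ n x * δ ≤ 2 ^ N * δ
      gcongr
      · exact one_le_two
      · exact Nat.findGreatest_le N)
    (fun x _ => ⟨x, hX.quasiMetric.mem_qball_self x (hr x)⟩)
  refine ⟨u, r, fun x => le_mul_of_one_le_left hδ.le (one_le_pow₀ one_le_two), hd, fun y => ?_,
    fun x => ?_, fun x => ?_⟩
  · obtain ⟨x, hx, ⟨w, hwy, hwx⟩, hyx⟩ := hc y (mem_univ y)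
    refine ⟨x, hx, ?_⟩
    have hwy' : ρ w y < r y := by rw [hX.quasiMetric.symm]; exact hwy
    refine (hX.quasiMetric.triangle_lt (le_of_lt hwx) hwy').trans_le ?_
    -- The Vitali selection allows the discarded radius to be at most twice the chosen one, so `3K`,
    -- hence `4K`, times the radius suffices.
    have : K * (r x + r y) ≤ K * (r x + 2 * r x) := by gcongr
    nlinarith [hr x]
  · set j := ⌈4 * K⌉₊ + 1 with hj
    have h4 : 4 * K ≤ 2 ^ j := by
      refine (Nat.le_ceil _).trans ?_
      exact_mod_cast (Nat.lt_two_pow_self.le.trans (Nat.pow_le_pow_right two_pos (by omega)))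
    have hball : (2 : ℝ) ^ (n x + j) * δ = 2 ^ j * r x := by
      simp only [r]; rw [pow_add]; ring
    have h1 := not_lt.1 (hgt x (n x + j) (by omega))
    rw [hball] at h1
    calc ∫⁻ y in qball ρ x (4 * K * r x), ‖f y‖ₑ ∂μ
        ≤ ∫⁻ y in qball ρ x (2 ^ j * r x), ‖f y‖ₑ ∂μ :=
          lintegral_mono_set (qball_mono x (mul_le_mul_of_nonneg_right h4 (hr x).le))
      _ ≤ α * μ (qball ρ x (2 ^ j * r x)) := h1
      _ ≤ α * (stoppingConst K A * μ (qball ρ x (r x))) := by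
          gcongr
          exact hX.measure_ball_mul_le x (hr x) _
      _ = _ := by ring
  · rcases eq_or_ne (n x) 0 with h | h
    · left; simp [r, h]
    · right
      exact (Nat.findGreatest_of_ne_zero (P := P x) rfl h).le

/-- Either the averages of `f` over large balls are at most `α`, or `μ` is finite and small. -/
lemma IsHomogeneousType.large_balls (hX : IsHomogeneousType ρ μ K A) {f : X → ℂ} {x₀ : X}
    {R₀ : ℝ} (hR₀ : 0 < R₀) (hf : Function.support f ⊆ qball ρ x₀ R₀) (α : ℝ≥0∞) :
    (∃ R, ∀ x, ∀ r, R ≤ r → ∫⁻ y in qball ρ x r, ‖f y‖ₑ ∂μ ≤ α * μ (qball ρ x r)) ∨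
      α * μ univ ≤ doublingFactor A (K * (2 * K + 1)) * ∫⁻ y, ‖f y‖ₑ ∂μ := by
  have hK := hX.quasiMetric.pos
  rw [or_iff_not_imp_right, not_le]
  intro hlt
  have huniv : (⋃ n : ℕ, qball ρ x₀ n) = univ := eq_univ_of_forall fun y => by
    obtain ⟨n, hn⟩ := exists_nat_gt (ρ x₀ y)
    exact mem_iUnion.2 ⟨n, hn⟩
  have hmono : Monotone fun n : ℕ => qball ρ x₀ n := fun m n h =>
    qball_mono x₀ (by exact_mod_cast h)
  rw [← huniv, hmono.measure_iUnion, ENNReal.mul_iSup, lt_iSup_iff] at hlt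
  obtain ⟨n, hn⟩ := hlt
  refine ⟨max n R₀, fun x r hr => ?_⟩
  by_contra! hcon
  have hnr : (n : ℝ) ≤ r := (le_max_left _ _).trans hr
  have hRr : R₀ ≤ r := (le_max_right _ _).trans hr
  have hr0 : 0 < r := hR₀.trans_le hRr
  -- A ball with a large average meets the support of `f`; being large, it has a fixed dilate
  -- containing `B(x₀, n)`, whose measure was chosen too big for that.
  obtain ⟨y, hyx, hy0⟩ : ∃ y ∈ qball ρ x r, y ∈ qball ρ x₀ R₀ := by
    by_contra! hno
    have : ∫⁻ y in qball ρ x r, ‖f y‖ₑ ∂μ = 0 := by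
      rw [setLIntegral_congr_fun (g := fun _ => 0) (hX.measurableSet_ball x r) fun y hy => ?_]
      · simp
      · have : f y = 0 := by
          by_contra h
          exact hno y hy (hf h)
        simp [this]
    rw [this] at hcon
    exact not_lt_zero hcon
  have hy0' : ρ y x₀ < R₀ := by rw [hX.quasiMetric.symm]; exact hy0
  have hdist := hX.quasiMetric.triangle_lt (le_of_lt hyx) hy0'
  have hcomp : μ (qball ρ x₀ n) ≤ doublingFactor A (K * (2 * K + 1)) * μ (qball ρ x r) := by
    refine hX.measure_ball_le_of_dist hr0 hdist.le ?_
    calc K * (K * (r + R₀) + n) ≤ K * (K * (r + r) + r) := by gcongr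
      _ = _ := by ring
  refine absurd hn (not_lt.2 ?_)
  calc α * μ (qball ρ x₀ n) ≤ α * (doublingFactor A (K * (2 * K + 1)) * μ (qball ρ x r)) := by
        gcongr
    _ = doublingFactor A (K * (2 * K + 1)) * (α * μ (qball ρ x r)) := by ring
    _ ≤ doublingFactor A (K * (2 * K + 1)) * ∫⁻ y, ‖f y‖ₑ ∂μ := by
        gcongr
        exact hcon.le.trans (setLIntegral_le_lintegral _ _)

/-- If `μ` is finite and small compared with the mass of `f`, so is the whole weight. -/
lemma IsHomogeneousType.weight_univ_le (hX : IsHomogeneousType ρ μ K A) {v : X → ℝ}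
    (hv : ∀ x, 0 ≤ v x) {f : X → ℂ} (hfi : Integrable f μ) {x₀ : X}
    {R₀ : ℝ} (hR₀ : 0 < R₀) (hf : Function.support f ⊆ qball ρ x₀ R₀) {α : ℝ≥0∞}
    (hα : α ≠ 0) {C : ℝ≥0} (h : α * μ univ ≤ C * ∫⁻ y, ‖f y‖ₑ ∂μ) :
    α * weightMeasure μ v univ ≤ C * ∫⁻ x, ‖f x‖ₑ * maximalFunction ρ μ v x ∂μ := by
  set ν := weightMeasure μ v
  set J := ∫⁻ y, ‖f y‖ₑ ∂μ
  have hJt : J ≠ ∞ := hfi.2.ne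
  have hJ0 : J ≠ 0 := fun h0 => by
    rw [h0, mul_zero, le_zero_iff, mul_eq_zero, or_iff_right hα] at h
    exact (hX.ball_pos x₀ 1 one_pos).ne' (measure_mono_null (subset_univ _) h)
  have huniv : (⋃ n : ℕ, qball ρ x₀ (R₀ + n)) = univ := eq_univ_of_forall fun y => by
    obtain ⟨n, hn⟩ := exists_nat_gt (ρ x₀ y)
    exact mem_iUnion.2 ⟨n, by simp only [qball, mem_ofPred_eq]; linarith⟩
  have hmono : Monotone fun n : ℕ => qball ρ x₀ (R₀ + n) := fun m n h =>
    qball_mono x₀ (by gcongr)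
  rw [← huniv, hmono.measure_iUnion, ENNReal.mul_iSup]
  refine iSup_le fun n => ?_
  have hr : 0 < R₀ + n := by positivity
  set B := qball ρ x₀ (R₀ + n)
  have hB0 : μ B ≠ 0 := (hX.ball_pos _ _ hr).ne'
  have hBt : μ B ≠ ∞ := (hX.ball_lt_top _ _ hr).ne
  -- A ball containing the support of `f` competes in `Mv` at every point where `f` is nonzero, so
  -- its average of `v` can be moved inside the integral of `|f|`.
  have h1 : ν B / μ B * J ≤ ∫⁻ x, ‖f x‖ₑ * maximalFunction ρ μ v x ∂μ := by
    rw [← lintegral_const_mul'' _ hfi.1.enorm]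
    refine lintegral_mono fun x => ?_
    rw [mul_comm]
    rcases eq_or_ne (f x) 0 with h0 | h0
    · simp [h0]
    · gcongr
      exact hX.weight_div_le hv x₀ hr
        (qball_mono x₀ (le_add_of_nonneg_right n.cast_nonneg) (hf h0))
  rw [← ENNReal.mul_le_mul_iff_left hJ0 hJt]
  calc α * ν B * J = α * μ B * (ν B / μ B * J) := by
        rw [← mul_assoc, mul_assoc α (μ B), ENNReal.mul_div_cancel hB0 hBt]
    _ ≤ (C * J) * ∫⁻ x, ‖f x‖ₑ * maximalFunction ρ μ v x ∂μ :=
        mul_le_mul' (le_trans (by gcongr; exact subset_univ _) h) h1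
    _ = _ := by ring

end Stopping

/-! ### The exceptional set, and the scales that survive outside it -/

section Exceptional

variable {X : Type*} [MeasurableSpace X] {ρ : X → X → ℝ} {μ : Measure X} {K : ℝ} {A : ℝ≥0}
  {κ β δ : ℝ} {ω : ℝ → ℝ} {Z : ℤ → Set X} {C : ℝ≥0} {f : X → ℂ} {α : ℝ≥0∞} {u : Set X}
  {r : X → ℝ} {v : X → ℝ}

/-- The dilated stopping balls on which the average of `f` is large. -/
def exceptionalSet (ρ : X → X → ℝ) (μ : Measure X) (K β : ℝ) (f : X → ℂ) (α : ℝ≥0∞) (u : Set X)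
    (r : X → ℝ) : Set X :=
  ⋃ x ∈ {x ∈ u | α * μ (qball ρ x (r x)) ≤ ∫⁻ y in qball ρ x (r x), ‖f y‖ₑ ∂μ},
    qball ρ x (8 * K ^ 3 * β * r x)

lemma StoppingBalls.radius_pos (h : StoppingBalls ρ μ K C f δ α u r) (hδ : 0 < δ) (x : X) :
    0 < r x := hδ.trans_le (h.le_radius x)

lemma StoppingBalls.countable (h : StoppingBalls ρ μ K C f δ α u r)
    (hX : IsHomogeneousType ρ μ K A) (hδ : 0 < δ) : u.Countable :=
  hX.countable_of_disjoint_balls (fun z _ => h.radius_pos hδ z) h.disjoint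

lemma StoppingBalls.measurableSet_exceptionalSet (h : StoppingBalls ρ μ K C f δ α u r)
    (hX : IsHomogeneousType ρ μ K A) (hδ : 0 < δ) :
    MeasurableSet (exceptionalSet ρ μ K β f α u r) :=
  MeasurableSet.biUnion ((h.countable hX hδ).mono (sep_subset _ _)) fun _ _ =>
    hX.measurableSet_ball _ _

lemma IsHomogeneousType.measure_le_ballRatio_mul (hX : IsHomogeneousType ρ μ K A) (β : ℝ) (x : X)
    {t : ℝ} (ht : 0 < t) :
    μ (qball ρ x (β * t)) ≤ ballRatio ρ μ β * μ (qball ρ x t) := by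
  rw [← ENNReal.div_le_iff_le_mul (Or.inl (hX.ball_pos x t ht).ne')
    (Or.inl (hX.ball_lt_top x t ht).ne)]
  exact le_iSup₂_of_le x t (le_iSup_of_le ht le_rfl)

/-- Write the weight of a dilated ball as its measure times its average. The measure is at most a
multiple of `γ` times that of the stopping ball, which `α` times is at most the mass of `f` there;
the average is at most `Mv` on the stopping ball. Disjointness allows summation. -/
lemma StoppingBalls.weight_exceptionalSet_le (h : StoppingBalls ρ μ K C f δ α u r)
    (hX : IsHomogeneousType ρ μ K A) (hδ : 0 < δ) (hβ : 1 ≤ β) (hv : ∀ x, 0 ≤ v x)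
    (hf : AEStronglyMeasurable f μ) :
    α * weightMeasure μ v (exceptionalSet ρ μ K β f α u r) ≤
      (doublingFactor A (8 * K ^ 3) * ballRatio ρ μ β) *
        ∫⁻ x, ‖f x‖ₑ * maximalFunction ρ μ v x ∂μ := by
  have hK := hX.quasiMetric.pos
  have hK1 := hX.quasiMetric.one_le
  have hβ0 := one_pos.trans_le hβ
  set ν := weightMeasure μ v
  set U := {x ∈ u | α * μ (qball ρ x (r x)) ≤ ∫⁻ y in qball ρ x (r x), ‖f y‖ₑ ∂μ} with hU
  have hUc : U.Countable := (h.countable hX hδ).mono (sep_subset _ _)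
  have : Countable U := hUc.to_subtype
  have hterm : ∀ x : U, α * ν (qball ρ x (8 * K ^ 3 * β * r x)) ≤
      (doublingFactor A (8 * K ^ 3) * ballRatio ρ μ β) *
        ∫⁻ y in qball ρ (x : X) (r x), ‖f y‖ₑ * maximalFunction ρ μ v y ∂μ := by
    rintro ⟨x, hxu, hx⟩
    have hr := h.radius_pos hδ x
    have hR : 0 < 8 * K ^ 3 * β * r x := by positivity
    set B := qball ρ x (8 * K ^ 3 * β * r x) with hB
    have hB0 : μ B ≠ 0 := (hX.ball_pos _ _ hR).ne'
    have hBt : μ B ≠ ∞ := (hX.ball_lt_top _ _ hR).ne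
    have hμB : μ B ≤ ballRatio ρ μ β * (doublingFactor A (8 * K ^ 3) * μ (qball ρ x (r x))) := by
      calc μ B = μ (qball ρ x (β * (8 * K ^ 3 * r x))) := by rw [hB]; congr 2; ring
        _ ≤ ballRatio ρ μ β * μ (qball ρ x (8 * K ^ 3 * r x)) :=
            hX.measure_le_ballRatio_mul β x (by positivity)
        _ ≤ _ := by gcongr; exact hX.measure_ball_mul_le x hr _
    calc α * ν B = α * (μ B * (ν B / μ B)) := by rw [ENNReal.mul_div_cancel hB0 hBt]
      _ ≤ α * (ballRatio ρ μ β * (doublingFactor A (8 * K ^ 3) * μ (qball ρ x (r x))) *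
            (ν B / μ B)) := by gcongr
      _ = (doublingFactor A (8 * K ^ 3) * ballRatio ρ μ β) *
            ((ν B / μ B) * (α * μ (qball ρ x (r x)))) := by ring
      _ ≤ (doublingFactor A (8 * K ^ 3) * ballRatio ρ μ β) *
            ((ν B / μ B) * ∫⁻ y in qball ρ x (r x), ‖f y‖ₑ ∂μ) := by gcongr
      _ ≤ _ := by
          rw [← lintegral_const_mul'' _ hf.enorm.restrict]
          refine mul_le_mul_right ?_ _
          refine setLIntegral_mono' (hX.measurableSet_ball _ _) fun y hy => ?_
          rw [mul_comm]
          gcongr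
          refine hX.weight_div_le hv x hR (qball_mono x ?_ hy)
          have : 1 ≤ 8 * K ^ 3 * β := by nlinarith [one_le_pow₀ hK1 (n := 3)]
          exact le_mul_of_one_le_left hr.le this
  calc α * ν (⋃ x ∈ U, qball ρ x (8 * K ^ 3 * β * r x))
      ≤ α * ∑' x : U, ν (qball ρ x (8 * K ^ 3 * β * r x)) := by
        gcongr
        exact measure_biUnion_le ν hUc _
    _ ≤ ∑' x : U, (doublingFactor A (8 * K ^ 3) * ballRatio ρ μ β) *
        ∫⁻ y in qball ρ (x : X) (r x), ‖f y‖ₑ * maximalFunction ρ μ v y ∂μ := by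
        rw [← ENNReal.tsum_mul_left]
        exact ENNReal.tsum_le_tsum hterm
    _ = (doublingFactor A (8 * K ^ 3) * ballRatio ρ μ β) *
        ∫⁻ y in ⋃ x : U, qball ρ (x : X) (r x), ‖f y‖ₑ * maximalFunction ρ μ v y ∂μ := by
        rw [ENNReal.tsum_mul_left, lintegral_iUnion (fun x => hX.measurableSet_ball _ _)]
        exact fun x y hne => h.disjoint x.2.1 y.2.1 (fun e => hne (Subtype.ext e))
    _ ≤ _ := by
        exact mul_le_mul_right (setLIntegral_le_lintegral _ _) _

/-- An index whose large dilate is not contained in the exceptional set has a scale of at least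
the radius of each stopping ball that it meets, and the averages of the weight are comparable. -/
lemma StoppingBalls.radius_le_and_cellAverage_le (h : StoppingBalls ρ μ K C f δ α u r)
    (hX : IsHomogeneousType ρ μ K A) (hκ : 1 < κ) (hβ : 1 ≤ β) (hδ : 0 < δ) (hv : ∀ x, 0 ≤ v x)
    {a : NetIndex Z} (ha : δ ≤ κ ^ a.1) {x : X} (hx : x ∈ u)
    (hmeet : (qball ρ x (4 * K * r x) ∩ dilate ρ κ (2 * K) a).Nonempty)
    (hne : (weightMeasure μ v).restrict (exceptionalSet ρ μ K β f α u r)ᶜ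
      (dilate ρ κ (2 * K * β) a) ≠ 0) :
    r x ≤ κ ^ a.1 ∧ ∀ y ∈ qball ρ x (4 * K * r x),
      cellAverage ρ μ ((weightMeasure μ v).restrict (exceptionalSet ρ μ K β f α u r)ᶜ) κ
        (2 * K * β) a ≤ doublingFactor A (6 * K ^ 2) * maximalFunction ρ μ v y := by
  have hK := hX.quasiMetric.pos
  have hK1 := hX.quasiMetric.one_le
  have hβ0 := one_pos.trans_le hβ
  have hρ := hX.quasiMetric
  have hs := scale_pos hκ a.1
  have hr := h.radius_pos hδ x
  obtain ⟨q, hqx, hqa⟩ := hmeet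
  have hrs : r x ≤ κ ^ a.1 := by
    rcases h.stopping x with hsmall | hbig
    · rw [hsmall]; exact ha
    -- If the radius exceeded the scale, the whole `2Kβ`-dilate would lie in `B(x, 8K³β r x)`, a
    -- part of the exceptional set, and would have no weight off that set. This fixes the dilation
    -- factor in `exceptionalSet`.
    · by_contra! hlt
      refine hne ?_
      rw [Measure.restrict_apply (hX.measurableSet_dilate _ _)]
      convert measure_empty (μ := weightMeasure μ v)
      refine Set.eq_empty_of_forall_notMem fun p hp => hp.2 ?_
      refine mem_iUnion₂.2 ⟨x, ⟨hx, hbig⟩, ?_⟩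
      have hqa' : ρ q a.2 ≤ 2 * K * κ ^ a.1 := by rw [hρ.symm]; exact le_of_lt hqa
      have h1 := hρ.triangle_lt hqa' hp.1
      have h2 := hρ.triangle_lt (le_of_lt hqx) h1
      refine h2.trans_le ?_
      calc K * (4 * K * r x + K * (2 * K * κ ^ a.1 + 2 * K * β * κ ^ a.1))
          ≤ K * (4 * K * r x + K * (2 * K * r x + 2 * K * β * r x)) := by gcongr
        _ = (4 * K ^ 2 * 1 + 2 * K ^ 3 * 1 + 2 * K ^ 3 * β) * r x := by ring
        _ ≤ (4 * K ^ 3 * β + 2 * K ^ 3 * β + 2 * K ^ 3 * β) * r x := by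
            gcongr
            norm_num
        _ = _ := by ring
  refine ⟨hrs, fun y hy => ?_⟩
  have hrad : 0 < 2 * K * β * κ ^ a.1 := by positivity
  -- A common ball containing both the dilate of `a` and the enlarged stopping ball, so that its
  -- average of `v` bounds the cell average and is bounded by `Mv` on the latter.
  set B := qball ρ (a.2 : X) (6 * K ^ 2 * (2 * K * β * κ ^ a.1))
  have hB : 0 < 6 * K ^ 2 * (2 * K * β * κ ^ a.1) := by positivity
  have hB0 : μ B ≠ 0 := (hX.ball_pos _ _ hB).ne'
  have hBt : μ B ≠ ∞ := (hX.ball_lt_top _ _ hB).ne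
  have hD0 := hX.dilate_ne_zero hκ (by positivity : 0 < 2 * K * β) a
  have hDt := hX.dilate_ne_top hκ (by positivity : 0 < 2 * K * β) a
  have hyB : y ∈ B := by
    have hqx' : ρ q x < 4 * K * r x := by rw [hρ.symm]; exact hqx
    have h1 := hρ.triangle_lt hqx'.le hy
    have h2 := hρ.triangle_lt (le_of_lt hqa) h1
    refine h2.trans_le ?_
    calc K * (2 * K * κ ^ a.1 + K * (4 * K * r x + 4 * K * r x))
        ≤ K * (2 * K * κ ^ a.1 + K * (4 * K * κ ^ a.1 + 4 * K * κ ^ a.1)) := by gcongr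
      _ = (2 * K ^ 2 * 1 + 8 * K ^ 3 * 1) * κ ^ a.1 := by ring
      _ ≤ (4 * K ^ 3 * β + 8 * K ^ 3 * β) * κ ^ a.1 := by
          gcongr ?_ * _
          gcongr <;> norm_num
      _ = _ := by ring
  have hsub : dilate ρ κ (2 * K * β) a ⊆ B :=
    qball_mono _ (le_mul_of_one_le_left hrad.le (by nlinarith [one_le_pow₀ hK1 (n := 2)]))
  have hμ : μ B ≤ doublingFactor A (6 * K ^ 2) * μ (dilate ρ κ (2 * K * β) a) :=
    hX.measure_ball_mul_le _ hrad _
  have hinv : (μ (dilate ρ κ (2 * K * β) a))⁻¹ ≤ doublingFactor A (6 * K ^ 2) * (μ B)⁻¹ := by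
    rw [← div_eq_mul_inv, ENNReal.le_div_iff_mul_le (Or.inl hB0) (Or.inl hBt), mul_comm,
      ← div_eq_mul_inv]
    exact ENNReal.div_le_of_le_mul hμ
  calc cellAverage ρ μ ((weightMeasure μ v).restrict (exceptionalSet ρ μ K β f α u r)ᶜ) κ
        (2 * K * β) a
      ≤ weightMeasure μ v B * (doublingFactor A (6 * K ^ 2) * (μ B)⁻¹) := by
        rw [cellAverage, div_eq_mul_inv]
        exact mul_le_mul' ((Measure.restrict_apply_le _ _).trans (measure_mono hsub)) hinv
    _ = doublingFactor A (6 * K ^ 2) * (weightMeasure μ v B / μ B) := by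
        rw [div_eq_mul_inv]; ring
    _ ≤ _ := by gcongr; exact hX.weight_div_le hv _ hB hyB

/-- The sum of the moduli over all indices that meet a stopping ball. -/
lemma IsHomogeneousType.tsum_modulus_le (hX : IsHomogeneousType ρ μ K A) (hκ : 1 < κ)
    (hω : IsModulus ω) (hZ : ∀ k, IsNet ρ (κ ^ k) (Z k)) (x : X) {t : ℝ} (ht : 0 < t)
    (p : NetIndex Z → Prop) [DecidablePred p]
    (hp : ∀ a, p a → t ≤ κ ^ a.1 ∧ (qball ρ x (4 * K * t) ∩ dilate ρ κ (2 * K) a).Nonempty) :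
    ∑' a : NetIndex Z, (if p a then ENNReal.ofReal (ω (8 * K ^ 2 * t / κ ^ a.1)) else 0) ≤
      (doublingFactor A (K * (6 * K ^ 2 + 1)) * (doublingFactor A (2 * K) *
        doublingFactor A (K * (6 * K ^ 2 + 1))) : ℝ≥0∞) *
      (⌈8 * K ^ 2⌉₊ * (2 * (diniConst κ * diniNorm ω))) := by
  have hK := hX.quasiMetric.pos
  have hκ0 := one_pos.trans hκ
  -- Here `κ ^ n < t ≤ κ ^ (n + 1)`, so the admissible scales start at `n + 1`, and `t / κ ^ k` is
  -- at most `κ⁻¹` to the power `k - (n + 1)`.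
  obtain ⟨n, hn1, hn2⟩ := exists_mem_Ioc_zpow ht hκ
  set N : ℝ≥0∞ := (doublingFactor A (K * (6 * K ^ 2 + 1)) * (doublingFactor A (2 * K) *
        doublingFactor A (K * (6 * K ^ 2 + 1))) : ℝ≥0∞)
  set c : ℤ → ℝ≥0∞ := fun k =>
    ⌈8 * K ^ 2⌉₊ * ENNReal.ofReal (ω (κ⁻¹ ^ ((n + 1) - k).natAbs)) with hc
  have hterm : ∀ a : NetIndex Z, (if p a then ENNReal.ofReal (ω (8 * K ^ 2 * t / κ ^ a.1)) else 0)
      ≤ c a.1 * (if ρ x a.2 < 6 * K ^ 2 * κ ^ a.1 then 1 else 0) := by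
    intro a
    split_ifs with hpa hdist hdist
    · rw [mul_one]
      have hs := scale_pos hκ a.1
      obtain ⟨hta, -⟩ := hp a hpa
      have hna : n + 1 ≤ a.1 := by
        by_contra! hlt
        have : κ ^ a.1 ≤ κ ^ n := zpow_le_zpow_right₀ hκ.le (by omega)
        linarith
      have hq : κ⁻¹ ^ ((n + 1) - a.1).natAbs = κ ^ (n + 1) / κ ^ a.1 := by
        rw [← zpow_natCast, Int.natCast_natAbs, abs_of_nonpos (by omega), inv_zpow', neg_neg,
          zpow_sub₀ hκ0.ne']
      have hle : t / κ ^ a.1 ≤ κ⁻¹ ^ ((n + 1) - a.1).natAbs := by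
        rw [hq]; exact div_le_div_of_nonneg_right hn2 hs.le
      simp only [hc]
      rw [← ENNReal.ofReal_natCast, ← ENNReal.ofReal_mul (by positivity)]
      refine ENNReal.ofReal_le_ofReal ((hω.mono (by positivity) ?_).trans
        (hω.mul_le (by positivity) (by positivity)))
      rw [mul_div_assoc]
      gcongr
    · exfalso
      apply hdist
      obtain ⟨hta, q, hqx, hqa⟩ := hp a hpa
      have hqa' : ρ q a.2 < 2 * K * κ ^ a.1 := by rw [hX.quasiMetric.symm]; exact hqa
      refine (hX.quasiMetric.triangle_lt (le_of_lt hqx) hqa').trans_le ?_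
      calc K * (4 * K * t + 2 * K * κ ^ a.1) ≤ K * (4 * K * κ ^ a.1 + 2 * K * κ ^ a.1) := by gcongr
        _ = _ := by ring
    · exact zero_le
    · exact zero_le
  calc _ ≤ ∑' a : NetIndex Z, c a.1 * (if ρ x a.2 < 6 * K ^ 2 * κ ^ a.1 then 1 else 0) :=
        ENNReal.tsum_le_tsum hterm
    _ = ∑' k, c k * ∑' z : Z k, (if ρ x z < 6 * K ^ 2 * κ ^ k then 1 else 0) := by
        rw [ENNReal.tsum_sigma']
        refine tsum_congr fun k => ?_
        dsimp only
        rw [ENNReal.tsum_mul_left]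
    _ ≤ ∑' k, c k * N := by
        refine ENNReal.tsum_le_tsum fun k => mul_le_mul_right ?_ _
        exact hX.net_count (scale_pos hκ k) (hZ k) x _
    _ = N * (⌈8 * K ^ 2⌉₊ * ∑' k, ENNReal.ofReal (ω (κ⁻¹ ^ ((n + 1) - k).natAbs))) := by
        rw [ENNReal.tsum_mul_right, ENNReal.tsum_mul_left, mul_comm]
    _ ≤ _ := by
        gcongr
        exact hω.tsum_int_le_diniNorm hκ (n + 1)

end Exceptional

/-! ### The good part, and the cancellation in the bad part -/

section GoodPart

variable {X : Type*} [MeasurableSpace X] {ρ : X → X → ℝ} {μ : Measure X} {K : ℝ} {A : ℝ≥0}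
  {κ β δ Φ : ℝ} {ω : ℝ → ℝ} {Z : ℤ → Set X} {C : ℝ≥0} {f g : X → ℂ} {α : ℝ≥0∞} {u : Set X}
  {r : X → ℝ} {v : X → ℝ} {P : u → Set X}

/-- The good part `g` of `f` for a family of stopping balls: the mass of `f` on the piece `P x` of
the space is spread evenly over the ball at `x`. -/
structure IsGoodPart (ρ : X → X → ℝ) (μ : Measure X) (K : ℝ) (f : X → ℂ) (u : Set X) (r : X → ℝ)
    (P : u → Set X) (g : X → ℂ) : Prop where
  subset : ∀ x, P x ⊆ qball ρ (x : X) (4 * K * r x)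
  measurableSet : ∀ x, MeasurableSet (P x)
  disjoint : Pairwise (Function.onFun Disjoint P)
  iUnion_eq : ⋃ x, P x = univ
  measurable : Measurable g
  eq_on : ∀ x : u, ∀ y ∈ qball ρ (x : X) (r x),
    g y = (∫ w in P x, f w ∂μ) / (μ.real (qball ρ (x : X) (r x)) : ℂ)
  eq_zero : ∀ y, y ∉ ⋃ x : u, qball ρ (x : X) (r x) → g y = 0

lemma StoppingBalls.pairwise_disjoint (h : StoppingBalls ρ μ K C f δ α u r) :
    Pairwise (Function.onFun Disjoint fun x : u => qball ρ (x : X) (r x)) :=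
  fun x y hne => h.disjoint x.2 y.2 (fun e => hne (Subtype.ext e))

lemma StoppingBalls.exists_isGoodPart (h : StoppingBalls ρ μ K C f δ α u r)
    (hX : IsHomogeneousType ρ μ K A) (hδ : 0 < δ) : ∃ P g, IsGoodPart ρ μ K f u r P g := by
  have : Countable u := (h.countable hX hδ).to_subtype
  obtain ⟨P, hP1, hP2, hP3, hP4⟩ := exists_disjoint_refinement
    (S := fun x : u => qball ρ (x : X) (4 * K * r x)) (fun x => hX.measurableSet_ball _ _)
  set c : u → ℂ := fun x => (∫ w in P x, f w ∂μ) / (μ.real (qball ρ (x : X) (r x)) : ℂ)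
  refine ⟨P, fun y => ∑' x : u, (qball ρ (x : X) (r x)).indicator (fun _ => c x) y, hP1, hP2, hP3,
    ?_, ?_, ?_, ?_⟩
  · rw [hP4]
    refine eq_univ_of_forall fun y => ?_
    obtain ⟨x, hx, hy⟩ := h.covers y
    exact mem_iUnion.2 ⟨⟨x, hx⟩, hy⟩
  · exact Measurable.tsum fun x => measurable_const.indicator (hX.measurableSet_ball _ _)
  · intro x y hy
    rw [tsum_eq_single x, indicator_of_mem hy]
    intro x' hne
    exact indicator_of_notMem (Set.disjoint_left.1 (h.pairwise_disjoint hne.symm) hy) _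
  · intro y hy
    rw [mem_iUnion] at hy
    push Not at hy
    simp [indicator_of_notMem (hy _)]

lemma IsGoodPart.enorm_mul_le (hg : IsGoodPart ρ μ K f u r P g)
    (hX : IsHomogeneousType ρ μ K A) {x : u} (hr : 0 < r x) {y : X}
    (hy : y ∈ qball ρ (x : X) (r x)) :
    ‖g y‖ₑ * μ (qball ρ (x : X) (r x)) ≤ ∫⁻ w in P x, ‖f w‖ₑ ∂μ := by
  have hpos := hX.real_ball_pos (x : X) hr
  have h1 : g y * (μ.real (qball ρ (x : X) (r x)) : ℂ) = ∫ w in P x, f w ∂μ := by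
    rw [hg.eq_on x y hy]
    exact div_mul_cancel₀ _ (by exact_mod_cast hpos.ne')
  have h2 : ‖(μ.real (qball ρ (x : X) (r x)) : ℂ)‖ₑ = μ (qball ρ (x : X) (r x)) := by
    rw [← ofReal_norm, Complex.norm_real, Real.norm_of_nonneg hpos.le, measureReal_def,
      ENNReal.ofReal_toReal (hX.ball_lt_top _ _ hr).ne]
  rw [← h2, ← enorm_mul, h1]
  exact enorm_integral_le_lintegral_enorm _

/-- On a stopping ball the size of `g` is at most the mass of `f` on its piece divided by the
measure of the ball. The piece lies in the `4K`-enlargement, where the mass was bounded by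
maximality of the stopping radius. -/
lemma IsGoodPart.enorm_le (hg : IsGoodPart ρ μ K f u r P g)
    (h : StoppingBalls ρ μ K C f δ α u r) (hX : IsHomogeneousType ρ μ K A) (hδ : 0 < δ) (y : X) :
    ‖g y‖ₑ ≤ C * α := by
  by_cases hy : y ∈ ⋃ x : u, qball ρ (x : X) (r x)
  · obtain ⟨x, hx⟩ := mem_iUnion.1 hy
    have hr := h.radius_pos hδ x
    have h0 := (hX.ball_pos (x : X) _ hr).ne'
    have ht := (hX.ball_lt_top (x : X) _ hr).ne
    rw [← ENNReal.mul_le_mul_iff_left h0 ht]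
    exact (hg.enorm_mul_le hX hr hx).trans ((lintegral_mono_set (hg.subset x)).trans (h.mass_le x))
  · rw [hg.eq_zero y hy]; simp

lemma IsGoodPart.lintegral_eq_tsum (hg : IsGoodPart ρ μ K f u r P g)
    (h : StoppingBalls ρ μ K C f δ α u r) (hX : IsHomogeneousType ρ μ K A) (hδ : 0 < δ)
    {H : X → ℝ≥0∞} (hH : ∀ y, g y = 0 → H y = 0) :
    ∫⁻ y, H y ∂μ = ∑' x : u, ∫⁻ y in qball ρ (x : X) (r x), H y ∂μ := by
  have : Countable u := (h.countable hX hδ).to_subtype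
  rw [← lintegral_iUnion (fun x : u => hX.measurableSet_ball (x : X) (r x)) h.pairwise_disjoint,
    ← lintegral_indicator (MeasurableSet.iUnion fun x : u => hX.measurableSet_ball (x : X) (r x))]
  refine lintegral_congr fun y => ?_
  by_cases hy : y ∈ ⋃ x : u, qball ρ (x : X) (r x)
  · rw [indicator_of_mem hy]
  · rw [indicator_of_notMem hy, hH y (hg.eq_zero y hy)]

lemma IsGoodPart.tsum_lintegral_pieces (hg : IsGoodPart ρ μ K f u r P g)
    (h : StoppingBalls ρ μ K C f δ α u r) (hX : IsHomogeneousType ρ μ K A) (hδ : 0 < δ)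
    (H : X → ℝ≥0∞) : ∑' x : u, ∫⁻ y in P x, H y ∂μ = ∫⁻ y, H y ∂μ := by
  have : Countable u := (h.countable hX hδ).to_subtype
  rw [← lintegral_iUnion hg.measurableSet hg.disjoint, hg.iUnion_eq, Measure.restrict_univ]

lemma IsGoodPart.integrable (hg : IsGoodPart ρ μ K f u r P g)
    (h : StoppingBalls ρ μ K C f δ α u r) (hX : IsHomogeneousType ρ μ K A) (hδ : 0 < δ)
    (hf : Integrable f μ) : Integrable g μ := by
  refine ⟨hg.measurable.aestronglyMeasurable, lt_of_le_of_lt ?_ hf.2⟩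
  rw [hg.lintegral_eq_tsum h hX hδ (H := fun y => ‖g y‖ₑ) (fun y hy => by simp [hy]),
    ← hg.tsum_lintegral_pieces h hX hδ (fun y => ‖f y‖ₑ)]
  refine ENNReal.tsum_le_tsum fun x => ?_
  have hr := h.radius_pos hδ x
  have hmem := hX.quasiMetric.mem_qball_self (x : X) hr
  refine le_trans (le_of_eq ?_) (hg.enorm_mul_le hX hr hmem)
  rw [← setLIntegral_const]
  refine setLIntegral_congr_fun (hX.measurableSet_ball _ _) fun y hy => ?_
  simp only [hg.eq_on x y hy, hg.eq_on x x hmem]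

/-- The weighted `L²` norm of the good part. -/
lemma IsGoodPart.lintegral_sq_mul_maxWeight_le (hg : IsGoodPart ρ μ K f u r P g)
    (h : StoppingBalls ρ μ K C f δ α u r) (hX : IsHomogeneousType ρ μ K A) (hδ : 0 < δ)
    (hκ : 1 < κ) (hβ : 1 ≤ β) (hv : ∀ x, 0 ≤ v x) (hf : Integrable f μ)
    {T : Finset (NetIndex Z)} (hT : ∀ a ∈ T, δ ≤ κ ^ a.1) :
    ∫⁻ y, ‖g y‖ₑ ^ 2 * maxWeight ρ κ (2 * K) T (cellAverage ρ μ
        ((weightMeasure μ v).restrict (exceptionalSet ρ μ K β f α u r)ᶜ) κ (2 * K * β)) y ∂μ ≤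
      C * α * (doublingFactor A (6 * K ^ 2) *
        ∫⁻ y, ‖f y‖ₑ * maximalFunction ρ μ v y ∂μ) := by
  have hK := hX.quasiMetric.pos
  have hK1 := hX.quasiMetric.one_le
  set ν' := (weightMeasure μ v).restrict (exceptionalSet ρ μ K β f α u r)ᶜ
  set H := maxWeight ρ κ (2 * K) T (cellAverage ρ μ ν' κ (2 * K * β)) with hH
  rw [hg.lintegral_eq_tsum h hX hδ (H := fun y => ‖g y‖ₑ ^ 2 * H y) (fun y hy => by simp [hy]),
    ← hg.tsum_lintegral_pieces h hX hδ (fun y => ‖f y‖ₑ * maximalFunction ρ μ v y),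
    ← ENNReal.tsum_mul_left, ← ENNReal.tsum_mul_left]
  refine ENNReal.tsum_le_tsum fun x => ?_
  have hr := h.radius_pos hδ x
  have hmem := hX.quasiMetric.mem_qball_self (x : X) hr
  set w := ⨆ y ∈ qball ρ (x : X) (r x), H y with hw
  -- The values of `g` live on the stopping ball but the mass of `f` lives on the piece, so the
  -- weight has to be transferred. Every relevant cell average is at most a multiple of `Mv` at all
  -- points of the enlarged ball, in particular on the piece.
  have hwle : ∀ y' ∈ P x, w ≤ doublingFactor A (6 * K ^ 2) * maximalFunction ρ μ v y' := by
    intro y' hy'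
    refine iSup₂_le fun y hy => maxWeight_le fun a ha hya => ?_
    have hy4 : y ∈ qball ρ (x : X) (4 * K * r x) :=
      qball_mono _ (le_mul_of_one_le_left hr.le (by linarith)) hy
    by_cases hne : ν' (dilate ρ κ (2 * K * β) a) = 0
    · rw [cellAverage, hne, ENNReal.zero_div]; exact zero_le
    · exact (h.radius_le_and_cellAverage_le hX hκ hβ hδ hv (hT a ha) x.2 ⟨y, hy4, hya⟩ hne).2 y'
        (hg.subset x hy')
  calc ∫⁻ y in qball ρ (x : X) (r x), ‖g y‖ₑ ^ 2 * H y ∂μ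
      ≤ ∫⁻ y in qball ρ (x : X) (r x), C * α * (‖g x‖ₑ * w) ∂μ := by
        refine setLIntegral_mono' (hX.measurableSet_ball _ _) fun y hy => ?_
        have hgy : g y = g x := by rw [hg.eq_on x y hy, hg.eq_on x x hmem]
        rw [hgy, sq, mul_assoc]
        gcongr
        · exact hg.enorm_le h hX hδ x
        · exact le_iSup₂ (f := fun y (_ : y ∈ qball ρ (x : X) (r x)) => H y) y hy
    _ = C * α * (w * (‖g x‖ₑ * μ (qball ρ (x : X) (r x)))) := by
        rw [setLIntegral_const]; ring
    _ ≤ C * α * (w * ∫⁻ y in P x, ‖f y‖ₑ ∂μ) := by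
        gcongr
        exact hg.enorm_mul_le hX hr hmem
    _ ≤ C * α * (doublingFactor A (6 * K ^ 2) *
          ∫⁻ y in P x, ‖f y‖ₑ * maximalFunction ρ μ v y ∂μ) := by
        refine mul_le_mul_right ?_ _
        rw [← lintegral_const_mul'' _ hf.1.enorm.restrict,
          ← lintegral_const_mul' _ _ ENNReal.coe_ne_top]
        refine setLIntegral_mono' (hg.measurableSet x) fun y hy => ?_
        calc w * ‖f y‖ₑ ≤ (doublingFactor A (6 * K ^ 2) * maximalFunction ρ μ v y) * ‖f y‖ₑ := by
              gcongr; exact hwle y hy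
          _ = _ := by ring

/-- The test functions on the bad part see only the oscillation over the stopping balls. -/
lemma IsGoodPart.cellSup_sub_le (hg : IsGoodPart ρ μ K f u r P g)
    (h : StoppingBalls ρ μ K C f δ α u r) (hX : IsHomogeneousType ρ μ K A) (hδ : 0 < δ)
    (hκ : 1 < κ) (hω : IsModulus ω) (hf : Integrable f μ) (a : NetIndex Z)
    (p : u → Prop) [DecidablePred p]
    (hp : ∀ x : u, (qball ρ (x : X) (4 * K * r x) ∩ dilate ρ κ (2 * K) a).Nonempty → p x) :
    cellSup ρ μ κ ω Φ (f - g) a ≤ ∑' x : u, if p x then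
      doublingFactor A (2 * K) * (μ (cell ρ κ a))⁻¹ *
        ENNReal.ofReal (ω (8 * K ^ 2 * r x / κ ^ a.1)) * ∫⁻ y in P x, ‖f y‖ₑ ∂μ else 0 := by
  have hK := hX.quasiMetric.pos
  have hK1 := hX.quasiMetric.one_le
  have hs := scale_pos hκ a.1
  have : Countable u := (h.countable hX hδ).to_subtype
  have hgi := hg.integrable h hX hδ hf
  refine iSup₂_le fun y hy => iSup₂_le fun φ hφ => ?_
  have hsupp : Function.support φ ⊆ dilate ρ κ (2 * K) a :=
    hφ.1.trans (hX.quasiMetric.qball_subset (le_of_lt hy) (le_of_eq (by ring)))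
  have hfφ := integrable_mul_of_mem_testClass hf.integrableOn hφ
  have hgφ := integrable_mul_of_mem_testClass hgi.integrableOn hφ
  have hsumf : HasSum (fun x : u => ∫ w in P x, f w * (φ w : ℂ) ∂μ)
      (∫ w, f w * (φ w : ℂ) ∂μ) := by
    have := hasSum_integral_iUnion hg.measurableSet hg.disjoint hfφ.integrableOn
    rwa [hg.iUnion_eq, Measure.restrict_univ] at this
  have hsumg : HasSum (fun x : u => ∫ w in qball ρ (x : X) (r x), g w * (φ w : ℂ) ∂μ)
      (∫ w, g w * (φ w : ℂ) ∂μ) := by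
    have := hasSum_integral_iUnion (fun x : u => hX.measurableSet_ball (x : X) (r x))
      h.pairwise_disjoint hgφ.integrableOn
    rwa [setIntegral_eq_integral_of_forall_compl_eq_zero
      (fun w hw => by rw [hg.eq_zero w hw, zero_mul])] at this
  have hsum := hsumf.sub hsumg
  have heq : ∫ w, (f - g) w * (φ w : ℂ) ∂μ =
      ∫ w, f w * (φ w : ℂ) ∂μ - ∫ w, g w * (φ w : ℂ) ∂μ := by
    rw [← integral_sub hfφ hgφ]
    simp [sub_mul]
  rw [heq, ← hsum.tsum_eq]
  refine enorm_tsum_le_tsum_enorm.trans (ENNReal.tsum_le_tsum fun x => ?_)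
  have hr := h.radius_pos hδ x
  set Q := qball ρ (x : X) (r x) with hQ
  have hQ4 : Q ⊆ qball ρ (x : X) (4 * K * r x) :=
    qball_mono _ (le_mul_of_one_le_left hr.le (by linarith))
  have hQpos := hX.real_ball_pos (x : X) hr
  have hQm : MeasurableSet Q := hX.measurableSet_ball _ _
  by_cases hmeet : (qball ρ (x : X) (4 * K * r x) ∩ dilate ρ κ (2 * K) a).Nonempty
  swap
  · have hz : ∀ w ∈ qball ρ (x : X) (4 * K * r x), φ w = 0 := fun w hw => by
      by_contra hne
      exact hmeet ⟨w, hw, hsupp hne⟩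
    rw [setIntegral_eq_zero_of_forall_eq_zero (fun w hw => by rw [hz w (hg.subset x hw)]; simp),
      setIntegral_eq_zero_of_forall_eq_zero (fun w hw => by rw [hz w (hQ4 hw)]; simp)]
    simp
  rw [if_pos (hp x hmeet)]
  -- Integrating `φ` against the constant `g` on `Q` equals integrating the mean `m` against `f` on
  -- the piece. The bad part is therefore tested against `φ - m`, bounded by the oscillation of `φ`
  -- over the enlarged ball of quasi-diameter at most `8K² r x`.
  set m : ℝ := (∫ w in Q, φ w ∂μ) / μ.real Q with hm
  have hgterm : ∫ w in Q, g w * (φ w : ℂ) ∂μ = ∫ w in P x, f w * (m : ℂ) ∂μ := by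
    rw [integral_mul_const]
    have : ∫ w in Q, g w * (φ w : ℂ) ∂μ =
        ∫ w in Q, (∫ w in P x, f w ∂μ) / (μ.real Q : ℂ) * (φ w : ℂ) ∂μ :=
      setIntegral_congr_fun hQm fun w hw => by simp only [hg.eq_on x w hw, hQ]
    rw [this, integral_const_mul, integral_complex_ofReal, hm]
    push_cast
    ring
  have hosc : ∀ w ∈ P x, |φ w - m| ≤
      (μ.real (qball ρ y (κ ^ a.1)))⁻¹ * ω (8 * K ^ 2 * r x / κ ^ a.1) := by
    intro w hw
    set b := (μ.real (qball ρ y (κ ^ a.1)))⁻¹ * ω (8 * K ^ 2 * r x / κ ^ a.1) with hb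
    have hpt : ∀ q ∈ Q, ‖φ w - φ q‖ ≤ b := fun q hq => by
      refine (hφ.2.2.2 w q).trans ?_
      refine mul_le_mul_of_nonneg_left (hω.mono (div_nonneg (hX.quasiMetric.nonneg _ _) hs.le) ?_)
        (inv_nonneg.2 measureReal_nonneg)
      refine div_le_div_of_nonneg_right ?_ hs.le
      have hwx : ρ w x ≤ 4 * K * r x := by
        rw [hX.quasiMetric.symm]; exact le_of_lt (hg.subset x hw)
      refine (hX.quasiMetric.triangle_lt hwx (hQ4 hq)).le.trans (le_of_eq (by ring))
    have hint : ∫ q in Q, (φ w - φ q) ∂μ = (φ w - m) * μ.real Q := by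
      have hconst : IntegrableOn (fun _ => φ w) Q μ :=
        integrableOn_const (hX.ball_lt_top _ _ hr).ne
      rw [integral_sub hconst hφ.2.1.1.integrableOn,
        setIntegral_const, hm, sub_mul, div_mul_cancel₀ _ hQpos.ne', smul_eq_mul, mul_comm]
    have hbd := norm_setIntegral_le_of_norm_le_const (hX.ball_lt_top _ _ hr) hpt
    rw [hint, norm_mul, Real.norm_of_nonneg hQpos.le] at hbd
    exact le_of_mul_le_mul_right hbd hQpos
  rw [hgterm, ← integral_sub hfφ.integrableOn (hf.integrableOn.mul_const _)]
  refine (enorm_integral_le_lintegral_enorm _).trans ?_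
  rw [← lintegral_const_mul'' _ hf.1.enorm.restrict]
  refine setLIntegral_mono' (hg.measurableSet x) fun w hw => ?_
  rw [← mul_sub, enorm_mul, mul_comm]
  gcongr
  calc ‖(φ w : ℂ) - (m : ℂ)‖ₑ = ENNReal.ofReal |φ w - m| := by
        rw [← ofReal_norm, ← Complex.ofReal_sub, Complex.norm_real, Real.norm_eq_abs]
    _ ≤ ENNReal.ofReal ((μ.real (qball ρ y (κ ^ a.1)))⁻¹ * ω (8 * K ^ 2 * r x / κ ^ a.1)) :=
        ENNReal.ofReal_le_ofReal (hosc w hw)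
    _ = (μ (qball ρ y (κ ^ a.1)))⁻¹ * ENNReal.ofReal (ω (8 * K ^ 2 * r x / κ ^ a.1)) := by
        rw [ENNReal.ofReal_mul (inv_nonneg.2 measureReal_nonneg), hX.ofReal_inv_real_ball y hs]
    _ ≤ _ := by
        gcongr
        exact hX.inv_ball_le_inv_cell hκ a hy

end GoodPart

/-! ### The weighted `L¹` estimate of the bad part -/

section WeakType

variable {X : Type*} [MeasurableSpace X] {ρ : X → X → ℝ} {μ : Measure X} {K : ℝ} {A : ℝ≥0}
  {κ β δ Φ : ℝ} {ω : ℝ → ℝ} {Z : ℤ → Set X} {C : ℝ≥0} {f g : X → ℂ} {α : ℝ≥0∞} {u : Set X}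
  {r : X → ℝ} {v : X → ℝ} {P : u → Set X}

/-- The constant of the `L¹` bound for the bad part. -/
noncomputable def badConst (K : ℝ) (A : ℝ≥0) (κ : ℝ) : ℝ≥0 :=
  doublingFactor A (2 * K) ^ (1 / 2 : ℝ) * doublingFactor A (2 * K) * doublingFactor A (6 * K ^ 2) *
    (doublingFactor A (K * (6 * K ^ 2 + 1)) * (doublingFactor A (2 * K) *
      doublingFactor A (K * (6 * K ^ 2 + 1))) * (⌈8 * K ^ 2⌉₊ * (2 * diniConst κ)))

lemma IsHomogeneousType.dilate_div_cell_le (hX : IsHomogeneousType ρ μ K A) (hκ : 1 < κ)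
    (a : NetIndex Z) (β : ℝ) :
    μ (dilate ρ κ (2 * K * β) a) / μ (cell ρ κ a) ≤ doublingFactor A (2 * K) * ballRatio ρ μ β := by
  have hK := hX.quasiMetric.pos
  have hs := scale_pos hκ a.1
  refine ENNReal.div_le_of_le_mul ?_
  calc μ (dilate ρ κ (2 * K * β) a) = μ (qball ρ (a.2 : X) (β * (2 * K * κ ^ a.1))) := by
        rw [dilate]; congr 2; ring
    _ ≤ ballRatio ρ μ β * μ (qball ρ (a.2 : X) (2 * K * κ ^ a.1)) :=
        hX.measure_le_ballRatio_mul β _ (by positivity)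
    _ ≤ ballRatio ρ μ β * (doublingFactor A (2 * K) * μ (cell ρ κ a)) := by
        gcongr
        exact hX.measure_ball_mul_le _ hs _
    _ = _ := by ring

lemma rpow_half_mul_self (x : ℝ≥0∞) : x ^ (1 / 2 : ℝ) * x ^ (1 / 2 : ℝ) = x := by
  rw [← ENNReal.rpow_add_of_nonneg _ _ (by norm_num) (by norm_num)]
  norm_num

/-- With `m` the measure of a cell and `D` that of its dilate, this isolates the average `N / D` and
leaves the factor `(D / m) ^ (1 / 2)`, the source of `γ ^ (1 / 2)` in the bad part. -/
lemma mul_inv_mul_sqrt_div {m D : ℝ≥0∞} (hm : m ≠ 0) (hm' : m ≠ ∞) (hD : D ≠ 0) (hD' : D ≠ ∞)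
    (N : ℝ≥0∞) :
    (m / D) ^ (1 / 2 : ℝ) * N * m⁻¹ = N / D * (D / m) ^ (1 / 2 : ℝ) := by
  have h1 : (m / D) ^ (1 / 2 : ℝ) * (D / m) ^ (1 / 2 : ℝ) = 1 := by
    rw [← ENNReal.mul_rpow_of_nonneg _ _ (by norm_num), div_eq_mul_inv, div_eq_mul_inv,
      show m * D⁻¹ * (D * m⁻¹) = (m * m⁻¹) * (D * D⁻¹) by ring, ENNReal.mul_inv_cancel hm hm',
      ENNReal.mul_inv_cancel hD hD', one_mul, ENNReal.one_rpow]
  calc (m / D) ^ (1 / 2 : ℝ) * N * m⁻¹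
      = (m / D) ^ (1 / 2 : ℝ) * N * m⁻¹ * ((m / D) ^ (1 / 2 : ℝ) * (D / m) ^ (1 / 2 : ℝ)) := by
        rw [h1, mul_one]
    _ = N * m⁻¹ * ((m / D) ^ (1 / 2 : ℝ) * (m / D) ^ (1 / 2 : ℝ)) * (D / m) ^ (1 / 2 : ℝ) := by ring
    _ = (m * m⁻¹) * (N / D) * (D / m) ^ (1 / 2 : ℝ) := by
        rw [rpow_half_mul_self]; simp only [div_eq_mul_inv]; ring
    _ = _ := by rw [ENNReal.mul_inv_cancel hm hm', one_mul]

/-- The weighted `L¹` estimate of the bad part off the exceptional set. -/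
lemma IsGoodPart.lintegral_bad_le (hg : IsGoodPart ρ μ K f u r P g)
    (h : StoppingBalls ρ μ K C f δ α u r) (hX : IsHomogeneousType ρ μ K A) (hδ : 0 < δ)
    (hκ : 1 < κ) (hβ : 1 ≤ β) (hω : IsModulus ω) (hZ : ∀ k, IsNet ρ (κ ^ k) (Z k))
    (hv : ∀ x, 0 ≤ v x) (hf : Integrable f μ)
    {T : Finset (NetIndex Z)} (hT : ∀ a ∈ T, δ ≤ κ ^ a.1) :
    ∫⁻ x, ∑ a ∈ T, cellWeight ρ μ κ (2 * K * β) a x ^ (1 / 2 : ℝ) * cellSup ρ μ κ ω Φ (f - g) a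
      ∂(weightMeasure μ v).restrict (exceptionalSet ρ μ K β f α u r)ᶜ ≤
      badConst K A κ * (ballRatio ρ μ β ^ (1 / 2 : ℝ) * diniNorm ω *
        ∫⁻ y, ‖f y‖ₑ * maximalFunction ρ μ v y ∂μ) := by
  classical
  have hK := hX.quasiMetric.pos
  have hβ0 := one_pos.trans_le hβ
  set ν' := (weightMeasure μ v).restrict (exceptionalSet ρ μ K β f α u r)ᶜ
  set c := doublingFactor A (2 * K)
  set c' := doublingFactor A (6 * K ^ 2)
  set G : ℝ≥0∞ := (c * ballRatio ρ μ β) ^ (1 / 2 : ℝ) * c * c' with hG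
  let q : NetIndex Z → u → Prop := fun a x =>
    r x ≤ κ ^ a.1 ∧ (qball ρ (x : X) (4 * K * r x) ∩ dilate ρ κ (2 * K) a).Nonempty
  let w : NetIndex Z → u → ℝ≥0∞ := fun a x =>
    if q a x then ENNReal.ofReal (ω (8 * K ^ 2 * r x / κ ^ a.1)) else 0
  have hcw : ∀ a : NetIndex Z, (fun x => cellWeight ρ μ κ (2 * K * β) a x ^ (1 / 2 : ℝ)) =
      (dilate ρ κ (2 * K * β) a).indicator fun _ =>
        (μ (cell ρ κ a) / μ (dilate ρ κ (2 * K * β) a)) ^ (1 / 2 : ℝ) := fun a => by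
    funext x
    by_cases hx : x ∈ dilate ρ κ (2 * K * β) a
    · simp [cellWeight, hx]
    · simp [cellWeight, hx]
  have hterm : ∀ a ∈ T, ∫⁻ x, cellWeight ρ μ κ (2 * K * β) a x ^ (1 / 2 : ℝ) *
      cellSup ρ μ κ ω Φ (f - g) a ∂ν' ≤
      ∑' x : u, G * (w a x * ∫⁻ y in P x, ‖f y‖ₑ * maximalFunction ρ μ v y ∂μ) := by
    intro a ha
    rw [lintegral_mul_const _ ((hX.measurable_cellWeight _ a).pow_const _), hcw,
      lintegral_indicator (hX.measurableSet_dilate _ _), setLIntegral_const]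
    set m := μ (cell ρ κ a)
    set B := dilate ρ κ (2 * K * β) a
    have hm0 : m ≠ 0 := hX.cell_ne_zero hκ a
    have hmt : m ≠ ∞ := hX.cell_ne_top hκ a
    have hB0 : μ B ≠ 0 := hX.dilate_ne_zero hκ (by positivity) a
    have hBt : μ B ≠ ∞ := hX.dilate_ne_top hκ (by positivity) a
    by_cases hne : ν' B = 0
    -- Indices whose dilate has no weight off the exceptional set drop out; for all others the scale
    -- dominates the radii of the stopping balls met.
    · rw [hne, mul_zero, zero_mul]; exact zero_le
    refine (mul_le_mul_right (hg.cellSup_sub_le h hX hδ hκ hω hf a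
      (fun x => (qball ρ (x : X) (4 * K * r x) ∩ dilate ρ κ (2 * K) a).Nonempty)
      (fun x hx => hx)) _).trans ?_
    rw [← ENNReal.tsum_mul_left]
    refine ENNReal.tsum_le_tsum fun x => ?_
    split_ifs with hmeet
    swap
    · rw [mul_zero]; exact zero_le
    obtain ⟨hr, havg⟩ := h.radius_le_and_cellAverage_le hX hκ hβ hδ hv (hT a ha) x.2 hmeet hne
    have hw : w a x = ENNReal.ofReal (ω (8 * K ^ 2 * r x / κ ^ a.1)) := if_pos ⟨hr, hmeet⟩
    rw [hw]
    set W := ENNReal.ofReal (ω (8 * K ^ 2 * r x / κ ^ a.1))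
    calc (m / μ B) ^ (1 / 2 : ℝ) * ν' B * (c * m⁻¹ * W * ∫⁻ y in P x, ‖f y‖ₑ ∂μ)
        = ((m / μ B) ^ (1 / 2 : ℝ) * ν' B * m⁻¹) * (c * W * ∫⁻ y in P x, ‖f y‖ₑ ∂μ) := by ring
      _ = (μ B / m) ^ (1 / 2 : ℝ) * c * W * ((ν' B / μ B) * ∫⁻ y in P x, ‖f y‖ₑ ∂μ) := by
          rw [mul_inv_mul_sqrt_div hm0 hmt hB0 hBt]; ring
      _ ≤ (c * ballRatio ρ μ β) ^ (1 / 2 : ℝ) * c * W *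
            (c' * ∫⁻ y in P x, ‖f y‖ₑ * maximalFunction ρ μ v y ∂μ) := by
          refine mul_le_mul' ?_ ?_
          · gcongr
            exact hX.dilate_div_cell_le hκ a β
          · rw [← lintegral_const_mul'' _ hf.1.enorm.restrict,
              ← lintegral_const_mul' _ _ ENNReal.coe_ne_top]
            refine setLIntegral_mono' (hg.measurableSet x) fun y hy => ?_
            calc ν' B / μ B * ‖f y‖ₑ ≤ (c' * maximalFunction ρ μ v y) * ‖f y‖ₑ := by
                  gcongr; exact havg y (hg.subset x hy)
              _ = _ := by ring
      _ = _ := by rw [hG]; ring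
  rw [lintegral_finsetSum _ fun a _ =>
    ((hX.measurable_cellWeight _ a).pow_const _).mul_const _]
  calc _ ≤ ∑ a ∈ T, ∑' x : u,
          G * (w a x * ∫⁻ y in P x, ‖f y‖ₑ * maximalFunction ρ μ v y ∂μ) :=
        Finset.sum_le_sum hterm
    _ ≤ ∑' a : NetIndex Z, ∑' x : u,
          G * (w a x * ∫⁻ y in P x, ‖f y‖ₑ * maximalFunction ρ μ v y ∂μ) :=
        ENNReal.sum_le_tsum T
    -- Exchanging the sums leaves, for each stopping ball, the sum of the moduli over all indices
    -- that meet it at scales at least its radius; this is at most a multiple of the Dini norm.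
    _ = G * ∑' x : u, (∑' a : NetIndex Z, w a x) *
          ∫⁻ y in P x, ‖f y‖ₑ * maximalFunction ρ μ v y ∂μ := by
        rw [ENNReal.tsum_comm, ← ENNReal.tsum_mul_left]
        exact tsum_congr fun x => by rw [ENNReal.tsum_mul_left, ENNReal.tsum_mul_right]
    _ ≤ G * ∑' x : u, ((doublingFactor A (K * (6 * K ^ 2 + 1)) * (doublingFactor A (2 * K) *
        doublingFactor A (K * (6 * K ^ 2 + 1))) : ℝ≥0∞) *
          (⌈8 * K ^ 2⌉₊ * (2 * (diniConst κ * diniNorm ω)))) *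
          ∫⁻ y in P x, ‖f y‖ₑ * maximalFunction ρ μ v y ∂μ := by
        refine mul_le_mul_right (ENNReal.tsum_le_tsum fun x => mul_le_mul_left ?_ _) _
        exact hX.tsum_modulus_le hκ hω hZ (x : X) (h.radius_pos hδ x) (fun a => q a x)
          (fun a ha => ha)
    _ = _ := by
        rw [ENNReal.tsum_mul_left, hg.tsum_lintegral_pieces h hX hδ, hG,
          ENNReal.mul_rpow_of_nonneg _ _ (by norm_num), badConst,
          ← ENNReal.coe_rpow_of_nonneg _ (by norm_num)]
        push_cast
        ring

end WeakType

/-! ### Assembly of the weak type estimate for finite sums -/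

section Assembly

variable {X : Type*} [MeasurableSpace X] {ρ : X → X → ℝ} {μ : Measure X} {K : ℝ} {A : ℝ≥0}
  {κ β Φ : ℝ} {ω : ℝ → ℝ} {Z : ℤ → Set X} {f g : X → ℂ} {v : X → ℝ}

lemma cellSup_add_le (hf : LocInt ρ μ f) (hg : LocInt ρ μ g) (a : NetIndex Z) :
    cellSup ρ μ κ ω Φ (f + g) a ≤ cellSup ρ μ κ ω Φ f a + cellSup ρ μ κ ω Φ g a := by
  refine iSup₂_le fun y hy => iSup₂_le fun φ hφ => ?_
  have hle : ∀ F : X → ℂ, ‖∫ x, F x * (φ x : ℂ) ∂μ‖ₑ ≤ cellSup ρ μ κ ω Φ F a := fun F =>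
    le_iSup₂_of_le y hy (le_iSup₂ (f := fun φ (_ : φ ∈ testClass ρ μ κ ω Φ y a.1) =>
      ‖∫ x, F x * (φ x : ℂ) ∂μ‖ₑ) φ hφ)
  have heq : ∫ x, (f + g) x * (φ x : ℂ) ∂μ =
      ∫ x, f x * (φ x : ℂ) ∂μ + ∫ x, g x * (φ x : ℂ) ∂μ := by
    rw [← integral_add (integrable_mul_of_mem_testClass (hf _ _) hφ)
      (integrable_mul_of_mem_testClass (hg _ _) hφ)]
    simp [add_mul]
  rw [heq]
  exact (enorm_add_le _ _).trans (add_le_add (hle f) (hle g))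

lemma add_sq_le_two_mul (x y : ℝ≥0∞) : (x + y) ^ 2 ≤ 2 * x ^ 2 + 2 * y ^ 2 := by
  have := ENNReal.rpow_add_le_mul_rpow_add_rpow x y (p := 2) (by norm_num)
  norm_num at this
  rwa [mul_add] at this

lemma partialSquare_add_le (hf : LocInt ρ μ f) (hg : LocInt ρ μ g) (L : ℝ)
    (T : Finset (NetIndex Z)) (x : X) :
    partialSquare ρ μ κ ω Φ L T (f + g) x ≤
      2 * partialSquare ρ μ κ ω Φ L T f x + 2 * partialSquare ρ μ κ ω Φ L T g x := by
  unfold partialSquare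
  rw [Finset.mul_sum, Finset.mul_sum, ← Finset.sum_add_distrib]
  refine Finset.sum_le_sum fun a _ => ?_
  calc _ ≤ cellWeight ρ μ κ L a x * (2 * cellSup ρ μ κ ω Φ f a ^ 2 +
        2 * cellSup ρ μ κ ω Φ g a ^ 2) := by
        gcongr
        exact (pow_le_pow_left' (cellSup_add_le hf hg a) 2).trans (add_sq_le_two_mul _ _)
    _ = _ := by ring

/-- The `ℓ²` norm is at most the `ℓ¹` norm. This makes the bad part accessible to an `L¹` estimate
with square roots of the weights. -/
lemma partialSquare_le_sq (L : ℝ) (T : Finset (NetIndex Z)) (f : X → ℂ) (x : X) :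
    partialSquare ρ μ κ ω Φ L T f x ≤
      (∑ a ∈ T, cellWeight ρ μ κ L a x ^ (1 / 2 : ℝ) * cellSup ρ μ κ ω Φ f a) ^ 2 := by
  unfold partialSquare
  rw [sq, Finset.sum_mul]
  refine Finset.sum_le_sum fun a ha => ?_
  calc cellWeight ρ μ κ L a x * cellSup ρ μ κ ω Φ f a ^ 2
      = (cellWeight ρ μ κ L a x ^ (1 / 2 : ℝ) * cellSup ρ μ κ ω Φ f a) *
        (cellWeight ρ μ κ L a x ^ (1 / 2 : ℝ) * cellSup ρ μ κ ω Φ f a) := by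
        conv_lhs => rw [← rpow_half_mul_self (cellWeight ρ μ κ L a x)]
        ring
    _ ≤ _ := by
        gcongr
        exact Finset.single_le_sum (f := fun a => cellWeight ρ μ κ L a x ^ (1 / 2 : ℝ) *
          cellSup ρ μ κ ω Φ f a) (fun _ _ => zero_le) ha

lemma Integrable.locInt {E : Type*} [NormedAddCommGroup E] {f : X → E} (hf : Integrable f μ) :
    LocInt ρ μ f := fun _ _ => hf.integrableOn

lemma IsHomogeneousType.one_le_ballRatio (hX : IsHomogeneousType ρ μ K A) (hβ : 1 ≤ β) (x : X) :
    1 ≤ ballRatio ρ μ β := by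
  refine le_iSup₂_of_le x 1 (le_iSup_of_le one_pos ?_)
  rw [ENNReal.le_div_iff_mul_le (Or.inl (hX.ball_pos x 1 one_pos).ne')
    (Or.inl (hX.ball_lt_top x 1 one_pos).ne), one_mul]
  exact measure_mono (qball_mono x (by linarith))

lemma IsHomogeneousType.ballRatio_ne_top (hX : IsHomogeneousType ρ μ K A) (β : ℝ) :
    ballRatio ρ μ β ≠ ∞ := by
  refine ne_top_of_le_ne_top (ENNReal.coe_ne_top (r := doublingFactor A β)) ?_
  refine iSup₂_le fun x t => iSup_le fun ht => ?_
  exact ENNReal.div_le_of_le_mul (hX.measure_ball_mul_le x ht β)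

/-- The constant in the bound for the good part. -/
noncomputable def goodConst (K : ℝ) (A : ℝ≥0) (κ : ℝ) : ℝ≥0 :=
  squareConst K A κ * (⌈2 * K⌉₊ * diniConst κ) * stoppingConst K A * doublingFactor A (6 * K ^ 2)

/-- The constant of the weak type estimate of the discretized square function. -/
noncomputable def weakConst (K : ℝ) (A : ℝ≥0) (κ : ℝ) : ℝ≥0 :=
  doublingFactor A (K * (2 * K + 1)) +
    (doublingFactor A (8 * K ^ 3) + 4 * goodConst K A κ + 2 * badConst K A κ) + 1

/-- With `γ` here the square root of the ball ratio and `I` the integral on the right, the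
exceptional set, the good part and the bad part contribute multiples of `γ² I / α`, `α D² I / t²`
and `γ D I / t`. In the second, one factor `D` bounds `ω (2K)`. The choice `α D = t γ` makes all
three equal to multiples of `γ D I / t`. -/
lemma IsHomogeneousType.weak_partialSquare_of_stoppingBalls (hX : IsHomogeneousType ρ μ K A)
    (hκ : 1 < κ) (hω : IsModulus ω) (hβ : 1 ≤ β) (hZ : ∀ k, IsNet ρ (κ ^ k) (Z k))
    (hv : ∀ x, 0 ≤ v x) (hf : Integrable f μ) {δ : ℝ} (hδ : 0 < δ)
    {T : Finset (NetIndex Z)} (hT : ∀ a ∈ T, δ ≤ κ ^ a.1) {α γ : ℝ≥0∞} {u : Set X} {r : X → ℝ}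
    (h : StoppingBalls ρ μ K (stoppingConst K A) f δ α u r) {t : ℝ≥0} (ht : 0 < t)
    (hγ : γ * γ = ballRatio ρ μ β) (hγ' : ballRatio ρ μ β ^ (1 / 2 : ℝ) = γ)
    (hγ0 : γ ≠ 0) (hγt : γ ≠ ∞) (hα : α * diniNorm ω = t * γ) :
    t * weightMeasure μ v {x | (t : ℝ≥0∞) ^ 2 <
        partialSquare ρ μ κ ω (ω (2 * K)) (2 * K * β) T f x} ≤
      (doublingFactor A (8 * K ^ 3) + 4 * goodConst K A κ + 2 * badConst K A κ : ℝ≥0) *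
        (γ * diniNorm ω * ∫⁻ x, ‖f x‖ₑ * maximalFunction ρ μ v x ∂μ) := by
  have hK := hX.quasiMetric.pos
  have ht0 : (t : ℝ≥0∞) ≠ 0 := by exact_mod_cast ht.ne'
  have htt : (t : ℝ≥0∞) ≠ ∞ := ENNReal.coe_ne_top
  set I := ∫⁻ x, ‖f x‖ₑ * maximalFunction ρ μ v x ∂μ
  set D := diniNorm ω
  set ν := weightMeasure μ v
  set E := exceptionalSet ρ μ K β f α u r
  have hE : MeasurableSet E := h.measurableSet_exceptionalSet hX hδ
  obtain ⟨P, g, hg⟩ := h.exists_isGoodPart hX hδ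
  have hgi := hg.integrable h hX hδ hf
  set S : (X → ℂ) → X → ℝ≥0∞ := partialSquare ρ μ κ ω (ω (2 * K)) (2 * K * β) T
  set R : X → ℝ≥0∞ := fun x => ∑ a ∈ T, cellWeight ρ μ κ (2 * K * β) a x ^ (1 / 2 : ℝ) *
    cellSup ρ μ κ ω (ω (2 * K)) (f - g) a
  have hωK : 0 ≤ ω (2 * K) := hω.nonneg _ (by positivity)
  have hexc : t * ν E ≤ doublingFactor A (8 * K ^ 3) * (γ * D * I) := by
    have h1 := h.weight_exceptionalSet_le (v := v) (β := β) hX hδ hβ hv hf.1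
    -- The extra factor `γ` turns `t * γ` into `α * D`, which avoids dividing by `α`.
    rw [← ENNReal.mul_le_mul_iff_right hγ0 hγt]
    calc γ * (t * ν E) = D * (α * ν E) := by
          rw [← mul_assoc, mul_comm γ, ← hα]; ring
      _ ≤ D * ((doublingFactor A (8 * K ^ 3) * ballRatio ρ μ β) * I) := by gcongr
      _ = _ := by rw [← hγ]; ring
  have hgood : t * ν.restrict Eᶜ {x | (t : ℝ≥0∞) ^ 2 / 4 ≤ S g x} ≤
      4 * goodConst K A κ * (γ * D * I) := by
    have h1 := mul_meas_ge_le_lintegral (μ := ν.restrict Eᶜ)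
      (hX.measurable_partialSquare (κ := κ) (ω := ω) (Φ := ω (2 * K)) (2 * K * β) T g)
      ((t : ℝ≥0∞) ^ 2 / 4)
    have h2 := hX.lintegral_partialSquare_le hκ hω hωK hZ (Integrable.locInt (ρ := ρ) hgi)
      (2 * K * β) T (ν.restrict Eᶜ)
    have h3 := hg.lintegral_sq_mul_maxWeight_le h hX hδ hκ hβ hv hf hT
    have h4 := hω.ofReal_le_diniNorm hκ (L := 2 * K) (by positivity)
    rw [← ENNReal.mul_le_mul_iff_right ht0 htt]
    calc t * (t * ν.restrict Eᶜ {x | (t : ℝ≥0∞) ^ 2 / 4 ≤ S g x})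
        = 4 * ((t : ℝ≥0∞) ^ 2 / 4 * ν.restrict Eᶜ {x | (t : ℝ≥0∞) ^ 2 / 4 ≤ S g x}) := by
          rw [← mul_assoc, ← mul_assoc, ENNReal.mul_div_cancel (by norm_num) (by norm_num), sq]
      _ ≤ 4 * (squareConst K A κ * ((⌈2 * K⌉₊ * (diniConst κ * D)) * D) *
            (stoppingConst K A * α * (doublingFactor A (6 * K ^ 2) * I))) := by
          refine mul_le_mul_right (h1.trans (h2.trans ?_)) _
          gcongr
      _ = 4 * (squareConst K A κ * (⌈2 * K⌉₊ * diniConst κ) * stoppingConst K A *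
            doublingFactor A (6 * K ^ 2)) * ((α * D) * D * I) := by ring
      _ = _ := by rw [hα, goodConst]; push_cast; ring
  have hRm : Measurable R := Finset.measurable_fun_sum _ fun a _ =>
    ((hX.measurable_cellWeight _ a).pow_const _).mul_const _
  have hbad : t * ν.restrict Eᶜ {x | (t : ℝ≥0∞) / 2 ≤ R x} ≤
      2 * badConst K A κ * (γ * D * I) := by
    have h1 := mul_meas_ge_le_lintegral (μ := ν.restrict Eᶜ) hRm ((t : ℝ≥0∞) / 2)
    have h2 := hg.lintegral_bad_le (Φ := ω (2 * K)) h hX hδ hκ hβ hω hZ hv hf hT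
    rw [hγ'] at h2
    calc t * ν.restrict Eᶜ {x | (t : ℝ≥0∞) / 2 ≤ R x}
        = 2 * ((t : ℝ≥0∞) / 2 * ν.restrict Eᶜ {x | (t : ℝ≥0∞) / 2 ≤ R x}) := by
          rw [← mul_assoc, ENNReal.mul_div_cancel (by norm_num) (by norm_num)]
      _ ≤ 2 * (badConst K A κ * (γ * D * I)) := mul_le_mul_right (h1.trans h2) _
      _ = _ := by ring
  -- The thresholds match `S f ≤ 2 * S g + 2 * S (f - g)`, since `2 * (t² / 4) + 2 * (t / 2)² = t²`.
  have hsub : {x | (t : ℝ≥0∞) ^ 2 < S f x} ⊆ E ∪ ((Eᶜ ∩ {x | (t : ℝ≥0∞) ^ 2 / 4 ≤ S g x}) ∪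
      (Eᶜ ∩ {x | (t : ℝ≥0∞) / 2 ≤ R x})) := by
    intro x hx
    by_cases hxE : x ∈ E
    · exact Or.inl hxE
    refine Or.inr ?_
    by_contra hcon
    rw [mem_union, not_or] at hcon
    have h1 : S g x < (t : ℝ≥0∞) ^ 2 / 4 := by
      by_contra! hle
      exact hcon.1 ⟨hxE, hle⟩
    have h2 : R x < (t : ℝ≥0∞) / 2 := by
      by_contra! hle
      exact hcon.2 ⟨hxE, hle⟩
    have h3 : S f x ≤ 2 * S g x + 2 * S (f - g) x := by
      have := partialSquare_add_le (κ := κ) (ω := ω) (Φ := ω (2 * K))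
        (Integrable.locInt (ρ := ρ) hgi) (Integrable.locInt (ρ := ρ) (hf.sub hgi)) (2 * K * β) T x
      rwa [add_sub_cancel] at this
    have h4 : S (f - g) x ≤ ((t : ℝ≥0∞) / 2) ^ 2 :=
      (partialSquare_le_sq _ _ _ _).trans (pow_le_pow_left' h2.le 2)
    refine absurd hx (not_lt.2 (h3.trans ?_))
    calc 2 * S g x + 2 * S (f - g) x ≤ 2 * ((t : ℝ≥0∞) ^ 2 / 4) + 2 * ((t : ℝ≥0∞) / 2) ^ 2 := by
          gcongr
      _ = (t : ℝ≥0∞) ^ 2 := by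
          have e : ((2 : ℝ≥0∞)⁻¹) ^ 2 = 4⁻¹ := by rw [← ENNReal.inv_pow]; norm_num
          have e' : (4 : ℝ≥0∞) * 4⁻¹ = 1 := ENNReal.mul_inv_cancel (by norm_num) (by norm_num)
          rw [div_eq_mul_inv, div_eq_mul_inv, mul_pow, e]
          calc _ = (t : ℝ≥0∞) ^ 2 * (4 * 4⁻¹) := by ring
            _ = _ := by rw [e', mul_one]
  calc t * ν {x | (t : ℝ≥0∞) ^ 2 < S f x}
      ≤ t * (ν E + (ν.restrict Eᶜ {x | (t : ℝ≥0∞) ^ 2 / 4 ≤ S g x} +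
          ν.restrict Eᶜ {x | (t : ℝ≥0∞) / 2 ≤ R x})) := by
        refine mul_le_mul_right ((measure_mono hsub).trans ?_) _
        refine (measure_union_le _ _).trans (add_le_add le_rfl ((measure_union_le _ _).trans ?_))
        rw [Measure.restrict_apply' hE.compl, Measure.restrict_apply' hE.compl,
          inter_comm, inter_comm _ {x | (t : ℝ≥0∞) / 2 ≤ R x}]
    _ ≤ doublingFactor A (8 * K ^ 3) * (γ * D * I) + (4 * goodConst K A κ * (γ * D * I) +
          2 * badConst K A κ * (γ * D * I)) := by
        rw [mul_add, mul_add]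
        gcongr
    _ = _ := by push_cast; ring

/-- The weak type estimate of the discretized square function for functions with bounded
support. -/
lemma IsHomogeneousType.weak_partialSquare (hX : IsHomogeneousType ρ μ K A)
    (hκ : 1 < κ) (hω : IsModulus ω) (hβ : 1 ≤ β) (hZ : ∀ k, IsNet ρ (κ ^ k) (Z k))
    (hv : ∀ x, 0 ≤ v x) (hf : Integrable f μ) {x₀ : X} {R₀ : ℝ} (hR₀ : 0 < R₀)
    (hsupp : Function.support f ⊆ qball ρ x₀ R₀) (T : Finset (NetIndex Z)) {t : ℝ≥0} (ht : 0 < t) :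
    t * weightMeasure μ v {x | (t : ℝ≥0∞) ^ 2 <
        partialSquare ρ μ κ ω (ω (2 * K)) (2 * K * β) T f x} ≤
      weakConst K A κ * (ballRatio ρ μ β ^ (1 / 2 : ℝ) * diniNorm ω *
        ∫⁻ x, ‖f x‖ₑ * maximalFunction ρ μ v x ∂μ) := by
  have hK := hX.quasiMetric.pos
  have ht0 : (t : ℝ≥0∞) ≠ 0 := by exact_mod_cast ht.ne'
  have htt : (t : ℝ≥0∞) ≠ ∞ := ENNReal.coe_ne_top
  have hωK : 0 ≤ ω (2 * K) := hω.nonneg _ (by positivity)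
  set I := ∫⁻ x, ‖f x‖ₑ * maximalFunction ρ μ v x ∂μ with hI
  set D := diniNorm ω with hD
  set γ := ballRatio ρ μ β ^ (1 / 2 : ℝ) with hγ
  have hγ1 : 1 ≤ γ := ENNReal.one_le_rpow (hX.one_le_ballRatio hβ x₀) (by norm_num)
  have hγ0 : γ ≠ 0 := (one_pos.trans_le hγ1).ne'
  have hγt : γ ≠ ∞ := ENNReal.rpow_ne_top_of_nonneg (by norm_num) (hX.ballRatio_ne_top β)
  have hγγ : γ * γ = ballRatio ρ μ β := rpow_half_mul_self _
  -- The summand `1` in `weakConst` keeps the right side infinite when the Dini norm is.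
  have hweak1 : (weakConst K A κ : ℝ≥0∞) ≠ 0 := by
    rw [weakConst]; push_cast; exact (one_pos.trans_le le_add_self).ne'
  -- When `D` or `I` vanishes, the right side is `0` even if the other is infinite. The `L²` bound
  -- then shows that the partial square function vanishes almost everywhere for the weight.
  have hzero : ∫⁻ x, partialSquare ρ μ κ ω (ω (2 * K)) (2 * K * β) T f x ∂weightMeasure μ v = 0 →
      weightMeasure μ v {x | (t : ℝ≥0∞) ^ 2 <
        partialSquare ρ μ κ ω (ω (2 * K)) (2 * K * β) T f x} = 0 := fun h => by
    rw [lintegral_eq_zero_iff (hX.measurable_partialSquare _ T f)] at h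
    refine measure_mono_null (fun x hx => ?_) (ae_iff.1 h)
    exact (lt_of_le_of_lt zero_le hx).ne'
  have hstrong := hX.lintegral_partialSquare_le hκ hω hωK hZ (Integrable.locInt (ρ := ρ) hf)
    (2 * K * β) T (weightMeasure μ v)
  rcases eq_or_ne D 0 with hD0 | hD0
  · rw [hzero, mul_zero]
    · exact zero_le
    · rw [← hD, hD0, mul_zero, mul_zero, zero_mul] at hstrong
      exact le_zero_iff.1 hstrong
  rcases eq_or_ne I 0 with hI0 | hI0
  · rw [hzero, mul_zero]
    · exact zero_le
    · set H := maxWeight ρ κ (2 * K) T (cellAverage ρ μ (weightMeasure μ v) κ (2 * K * β)) with hH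
      have hHm : Measurable H := hX.measurable_maxWeight _ _ _
      have h1 : ∫⁻ x, ‖f x‖ₑ * H x ∂μ = 0 := by
        refine le_zero_iff.1 (le_trans ?_ hI0.le)
        refine lintegral_mono fun x => ?_
        gcongr
        exact hX.maxWeight_le_maximalFunction hκ hβ hv T x
      replace h1 := (lintegral_eq_zero_iff' (hf.1.enorm.mul hHm.aemeasurable)).1 h1
      have h2 : ∫⁻ x, ‖f x‖ₑ ^ 2 * H x ∂μ = 0 := by
        refine (lintegral_eq_zero_iff' ((hf.1.enorm.pow_const 2).mul hHm.aemeasurable)).2 ?_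
        filter_upwards [h1] with x hx
        have hx' : ‖f x‖ₑ * H x = 0 := hx
        change ‖f x‖ₑ ^ 2 * H x = 0
        rw [sq, mul_assoc, hx', mul_zero]
      rw [h2, mul_zero] at hstrong
      exact le_zero_iff.1 hstrong
  rcases eq_or_ne D ∞ with hDt | hDt
  · rw [hDt, ENNReal.mul_top hγ0, ENNReal.top_mul hI0, ENNReal.mul_top hweak1]
    exact le_top
  set α : ℝ≥0∞ := t * γ / D with hα
  have hαD : α * D = t * γ := ENNReal.div_mul_cancel hD0 hDt
  have hα0 : α ≠ 0 := fun h => by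
    rw [h, zero_mul] at hαD
    exact (mul_ne_zero ht0 hγ0) hαD.symm
  -- Finiteness of `T` gives a lower bound for its scales, which serves as the least stopping radius
  -- `δ`.
  obtain ⟨k, hk⟩ : ∃ k : ℤ, ∀ a ∈ T, k ≤ a.1 := by
    obtain ⟨k, hk⟩ := (T.image fun a => a.1).bddBelow
    exact ⟨k, fun a ha => hk (Finset.mem_coe.2 (Finset.mem_image_of_mem _ ha))⟩
  have hδ := scale_pos hκ k
  have hT : ∀ a ∈ T, κ ^ k ≤ κ ^ a.1 := fun a ha => zpow_le_zpow_right₀ hκ.le (hk a ha)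
  rcases hX.large_balls hR₀ hsupp α with ⟨R, hR⟩ | hsmall
  · obtain ⟨u, r, h⟩ := hX.exists_stoppingBalls f hδ hR
    refine (hX.weak_partialSquare_of_stoppingBalls hκ hω hβ hZ hv hf hδ hT h ht hγγ rfl hγ0 hγt
      hαD).trans ?_
    gcongr
    rw [weakConst]
    exact le_add_right le_add_self
  -- No decomposition at height `α` is needed here: the level set is estimated by the whole space,
  -- using `γ ≥ 1`.
  · have h1 := hX.weight_univ_le hv hf hR₀ hsupp hα0 hsmall
    calc t * weightMeasure μ v {x | (t : ℝ≥0∞) ^ 2 <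
          partialSquare ρ μ κ ω (ω (2 * K)) (2 * K * β) T f x}
        ≤ t * γ * weightMeasure μ v univ := by
          refine mul_le_mul' (le_mul_of_one_le_right zero_le hγ1) (measure_mono (subset_univ _))
      _ = D * (α * weightMeasure μ v univ) := by rw [← hαD]; ring
      _ ≤ D * (doublingFactor A (K * (2 * K + 1)) * I) := by gcongr
      _ ≤ D * (doublingFactor A (K * (2 * K + 1)) * (γ * I)) := by
          gcongr
          exact le_mul_of_one_le_left zero_le hγ1
      _ = doublingFactor A (K * (2 * K + 1)) * (γ * D * I) := by ring
      _ ≤ _ := by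
          gcongr
          rw [weakConst, add_assoc]
          exact le_self_add

end Assembly

/-! ### Locally integrable functions and the full square function -/

section Conclusion

variable {X : Type*} [MeasurableSpace X] {ρ : X → X → ℝ} {μ : Measure X} {K : ℝ} {A : ℝ≥0}
  {κ β Φ : ℝ} {ω : ℝ → ℝ} {Z : ℤ → Set X} {f : X → ℂ} {v : X → ℝ}

lemma IsHomogeneousType.cellSup_congr (hX : IsHomogeneousType ρ μ K A) {f f' : X → ℂ}
    (a : NetIndex Z) (h : ∀ x ∈ dilate ρ κ (2 * K) a, f x = f' x) :
    cellSup ρ μ κ ω Φ f a = cellSup ρ μ κ ω Φ f' a := by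
  refine iSup_congr fun y => iSup_congr fun hy => iSup_congr fun φ => iSup_congr fun hφ => ?_
  congr 2
  funext x
  by_cases hx : φ x = 0
  · simp [hx]
  · rw [h x (hX.quasiMetric.qball_subset (le_of_lt hy) (le_of_eq (by ring)) (hφ.1 hx))]

/-- The weak type estimate of the discretized square function. -/
lemma IsHomogeneousType.weak_partialSquare_of_locInt (hX : IsHomogeneousType ρ μ K A)
    (hκ : 1 < κ) (hω : IsModulus ω) (hβ : 1 ≤ β) (hZ : ∀ k, IsNet ρ (κ ^ k) (Z k))
    (hv : ∀ x, 0 ≤ v x) (hf : LocInt ρ μ f) (x₀ : X) (T : Finset (NetIndex Z)) {t : ℝ≥0}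
    (ht : 0 < t) :
    t * weightMeasure μ v {x | (t : ℝ≥0∞) ^ 2 <
        partialSquare ρ μ κ ω (ω (2 * K)) (2 * K * β) T f x} ≤
      weakConst K A κ * (ballRatio ρ μ β ^ (1 / 2 : ℝ) * diniNorm ω *
        ∫⁻ x, ‖f x‖ₑ * maximalFunction ρ μ v x ∂μ) := by
  classical
  have hK := hX.quasiMetric.pos
  -- One ball contains the supports of all test functions for `T`, so cutting `f` off to it leaves
  -- the partial square function unchanged.
  obtain ⟨R, hR⟩ : ∃ R : ℝ, ∀ a ∈ T, K * (ρ x₀ a.2 + 2 * K * κ ^ a.1) ≤ R := by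
    obtain ⟨R, hR⟩ := (T.image fun a => K * (ρ x₀ a.2 + 2 * K * κ ^ a.1)).bddAbove
    exact ⟨R, fun a ha => hR (Finset.mem_coe.2 (Finset.mem_image_of_mem _ ha))⟩
  set B := qball ρ x₀ (max R 1) with hB
  have hBm : MeasurableSet B := hX.measurableSet_ball _ _
  have hfB : Integrable (B.indicator f) μ := (hf x₀ (max R 1)).integrable_indicator hBm
  have hpartial : partialSquare ρ μ κ ω (ω (2 * K)) (2 * K * β) T f =
      partialSquare ρ μ κ ω (ω (2 * K)) (2 * K * β) T (B.indicator f) := by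
    funext x
    refine Finset.sum_congr rfl fun a ha => ?_
    rw [hX.cellSup_congr a fun y hy => ?_]
    refine (indicator_of_mem ?_ f).symm
    exact hX.quasiMetric.qball_subset le_rfl ((hR a ha).trans (le_max_left _ _)) hy
  rw [hpartial]
  refine (hX.weak_partialSquare hκ hω hβ hZ hv hfB (lt_max_of_lt_right one_pos)
    support_indicator_subset T ht).trans ?_
  gcongr with x
  exact enorm_indicator_le_enorm_self f x

/-- The weak type estimate of the square function. -/
lemma IsHomogeneousType.weak_squareFunction (hX : IsHomogeneousType ρ μ K A)
    (hκ : 1 < κ) (hω : IsModulus ω) (hβ : 1 ≤ β) (hv : ∀ x, 0 ≤ v x) (hf : LocInt ρ μ f) :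
    (⨆ (t : ℝ≥0) (_ : 0 < t), (t : ℝ≥0∞) * weightMeasure μ v
        {x | (t : ℝ≥0∞) < squareFunction ρ μ κ ω Φ β f x}) ≤
      ((doublingFactor A (4 * K ^ 2) + 1) * weakConst K A κ : ℝ≥0) *
        (ballRatio ρ μ β ^ (1 / 2 : ℝ) * diniNorm ω *
          ∫⁻ x, ‖f x‖ₑ * maximalFunction ρ μ v x ∂μ) := by
  refine iSup₂_le fun t ht => ?_
  rcases isEmpty_or_nonempty X with hE | ⟨⟨x₀⟩⟩
  · rw [Set.eq_empty_of_isEmpty {x | (t : ℝ≥0∞) < squareFunction ρ μ κ ω Φ β f x}]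
    simp
  obtain ⟨Z, hZ⟩ := hX.quasiMetric.exists_nets hκ
  have := hX.countable_netIndex hκ hZ
  -- Adding `1` ensures `c ≥ 1`, so the discretization constant is at most `c ^ 2` and can be
  -- absorbed by lowering the level from `t` to `t / c`.
  set c : ℝ≥0 := doublingFactor A (4 * K ^ 2) + 1 with hc
  have hc1 : 1 ≤ c := le_add_self
  have hc0 : 0 < c := one_pos.trans_le hc1
  have ht' : 0 < t / c := div_pos ht hc0
  set S : Finset (NetIndex Z) → X → ℝ≥0∞ := fun T =>
    partialSquare ρ μ κ ω (ω (2 * K)) (2 * K * β) T f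
  have hsub : {x | (t : ℝ≥0∞) < squareFunction ρ μ κ ω Φ β f x} ⊆
      ⋃ T, {x | ((t / c : ℝ≥0) : ℝ≥0∞) ^ 2 < S T x} := by
    intro x hx
    rw [mem_iUnion]
    by_contra! hcon
    have h1 : ∑' a : NetIndex Z, cellWeight ρ μ κ (2 * K * β) a x * cellSup ρ μ κ ω Φ f a ^ 2 ≤
        ((t / c : ℝ≥0) : ℝ≥0∞) ^ 2 := by
      rw [ENNReal.tsum_eq_iSup_sum]
      refine iSup_le fun T => le_trans (Finset.sum_le_sum fun a _ => ?_) (not_lt.1 (hcon T))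
      gcongr
      -- Here `Φ` disappears: the test class is contained in the one with size bound `ω (2K)`.
      exact iSup₂_mono fun y _ => testSup_le_of_subset f (hX.testClass_subset hκ hω Φ y a.1)
    have h2 := hX.squareFunction_sq_le (ω := ω) (Φ := Φ) hκ hβ hZ f x
    have h3 : squareFunction ρ μ κ ω Φ β f x ^ 2 ≤ (t : ℝ≥0∞) ^ 2 := by
      refine h2.trans ?_
      calc (doublingFactor A (4 * K ^ 2) : ℝ≥0∞) *
            ∑' a : NetIndex Z, cellWeight ρ μ κ (2 * K * β) a x * cellSup ρ μ κ ω Φ f a ^ 2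
          ≤ (c ^ 2 : ℝ≥0) * ((t / c : ℝ≥0) : ℝ≥0∞) ^ 2 := by
            refine mul_le_mul' ?_ h1
            have : doublingFactor A (4 * K ^ 2) ≤ c ^ 2 :=
              (le_add_right le_rfl : _ ≤ c).trans (le_self_pow₀ hc1 two_ne_zero)
            exact_mod_cast this
        _ = (t : ℝ≥0∞) ^ 2 := by
            rw [← ENNReal.coe_pow, ← ENNReal.coe_mul, ← mul_pow, mul_div_cancel₀ _ hc0.ne',
              ENNReal.coe_pow]
    exact absurd hx (not_lt.2 ((ENNReal.pow_le_pow_left_iff two_ne_zero).1 h3))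
  have hmono : Monotone fun T => {x | ((t / c : ℝ≥0) : ℝ≥0∞) ^ 2 < S T x} := fun T T' hTT x hx =>
    (show _ < S T' x from lt_of_lt_of_le hx (Finset.sum_le_sum_of_subset hTT))
  calc (t : ℝ≥0∞) * weightMeasure μ v {x | (t : ℝ≥0∞) < squareFunction ρ μ κ ω Φ β f x}
      ≤ t * weightMeasure μ v (⋃ T, {x | ((t / c : ℝ≥0) : ℝ≥0∞) ^ 2 < S T x}) := by gcongr
    _ = ⨆ T, c * (((t / c : ℝ≥0) : ℝ≥0∞) *
          weightMeasure μ v {x | ((t / c : ℝ≥0) : ℝ≥0∞) ^ 2 < S T x}) := by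
        rw [hmono.directed_le.measure_iUnion, ENNReal.mul_iSup]
        refine iSup_congr fun T => ?_
        rw [← mul_assoc, ← ENNReal.coe_mul, mul_div_cancel₀ _ hc0.ne']
    _ ≤ _ := by
        refine iSup_le fun T => ?_
        rw [ENNReal.coe_mul, mul_assoc]
        refine mul_le_mul_right ?_ _
        exact hX.weak_partialSquare_of_locInt hκ hω hβ hZ hv hf x₀ T ht'

end Conclusion

end IntrinsicSquare

theorem theorem1p1 (K : ℝ) (A : ℝ≥0) (κ : ℝ) (hκ : 1 < κ) :
    -- the two main estimates, with a constant depending on `K`, `A`, `κ` only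
    (∃ C : ℝ≥0, ∀ (X : Type*) [MeasurableSpace X] (ρ : X → X → ℝ) (μ : Measure X),
      IntrinsicSquare.IsHomogeneousType ρ μ K A →
      ∀ (ω : ℝ → ℝ), IntrinsicSquare.IsModulus ω →
      ∀ (Φ β : ℝ), 0 < Φ → 1 ≤ β →
      ∀ (v : X → ℝ), (∀ x, 0 ≤ v x) → IntrinsicSquare.LocInt ρ μ v →
      ∀ (f : X → ℂ), IntrinsicSquare.LocInt ρ μ f →
        (∫⁻ x, IntrinsicSquare.squareFunction ρ μ κ ω Φ β f x ^ 2 * ENNReal.ofReal (v x) ∂μ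
          ≤ C * (ENNReal.ofReal Φ * IntrinsicSquare.diniNorm ω *
              ∫⁻ x, ‖f x‖ₑ ^ 2 * IntrinsicSquare.maximalFunction ρ μ v x ∂μ)) ∧
        (⨆ (t : ℝ≥0) (_ : 0 < t), (t : ℝ≥0∞) * IntrinsicSquare.weightMeasure μ v
              {x | (t : ℝ≥0∞) < IntrinsicSquare.squareFunction ρ μ κ ω Φ β f x})
          ≤ C * (IntrinsicSquare.ballRatio ρ μ β ^ (1 / 2 : ℝ) * IntrinsicSquare.logDiniNorm ω *
              ∫⁻ x, ‖f x‖ₑ * IntrinsicSquare.maximalFunction ρ μ v x ∂μ)) ∧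
    -- the improvement under reverse doubling; the constant may also depend on `c` and `ε`
    (∀ (c ε : ℝ), 1 < c → 0 < ε →
      ∃ C : ℝ≥0, ∀ (X : Type*) [MeasurableSpace X] (ρ : X → X → ℝ) (μ : Measure X),
      IntrinsicSquare.IsHomogeneousType ρ μ K A →
      IntrinsicSquare.ReverseDoubling ρ μ c ε →
      ∀ (ω : ℝ → ℝ), IntrinsicSquare.IsModulus ω →
      ∀ (Φ β : ℝ), 0 < Φ → 1 ≤ β →
      ∀ (v : X → ℝ), (∀ x, 0 ≤ v x) → IntrinsicSquare.LocInt ρ μ v →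
      ∀ (f : X → ℂ), IntrinsicSquare.LocInt ρ μ f →
        (⨆ (t : ℝ≥0) (_ : 0 < t), (t : ℝ≥0∞) * IntrinsicSquare.weightMeasure μ v
              {x | (t : ℝ≥0∞) < IntrinsicSquare.squareFunction ρ μ κ ω Φ β f x})
          ≤ C * (IntrinsicSquare.ballRatio ρ μ β ^ (1 / 2 : ℝ) * IntrinsicSquare.diniNorm ω *
              ∫⁻ x, ‖f x‖ₑ * IntrinsicSquare.maximalFunction ρ μ v x ∂μ)) := by
  -- One constant for both estimates: the sum of the `L²` constant and the weak type constant times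
  -- `9 / log 2`, the price of passing from the Dini to the log-Dini norm.
  refine ⟨⟨IntrinsicSquare.doublingFactor A (4 * K ^ 2) * IntrinsicSquare.squareConst K A κ +
    (IntrinsicSquare.doublingFactor A (4 * K ^ 2) + 1) * IntrinsicSquare.weakConst K A κ *
      (9 / Real.log 2).toNNReal, ?_⟩, ?_⟩
  · intro X _ ρ μ hX ω hω Φ β hΦ hβ v hv hvi f hf
    constructor
    · refine (hX.lintegral_squareFunction_sq_le hκ hω hΦ.le hβ hv hvi hf).trans ?_
      gcongr
      exact le_self_add
    · refine (hX.weak_squareFunction hκ hω hβ hv hf).trans ?_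
      have hlog := hω.diniNorm_le_logDiniNorm
      set γ := IntrinsicSquare.ballRatio ρ μ β ^ (1 / 2 : ℝ)
      set I := ∫⁻ x, ‖f x‖ₑ * IntrinsicSquare.maximalFunction ρ μ v x ∂μ
      set c := (IntrinsicSquare.doublingFactor A (4 * K ^ 2) + 1) *
        IntrinsicSquare.weakConst K A κ
      calc (c : ℝ≥0∞) * (γ * IntrinsicSquare.diniNorm ω * I)
          ≤ c * (γ * ((9 / Real.log 2).toNNReal * IntrinsicSquare.logDiniNorm ω) * I) := by
            gcongr
            exact hlog
        _ = (c * (9 / Real.log 2).toNNReal : ℝ≥0) *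
              (γ * IntrinsicSquare.logDiniNorm ω * I) := by
            push_cast
            ring
        _ ≤ _ := by
            gcongr
            exact le_add_self
  · intro c ε _ _
    refine ⟨(IntrinsicSquare.doublingFactor A (4 * K ^ 2) + 1) *
      IntrinsicSquare.weakConst K A κ, ?_⟩
    intro X _ ρ μ hX _ ω hω Φ β hΦ hβ v hv hvi f hf
    exact hX.weak_squareFunction hκ hω hβ hv hf
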